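/- Let $\Omega=\mathbb{R}^3_+=\{x=(x_1,x_2,z): z>0\}$, $\varphi(z)=z/(1+z)$, $Z_1=\partial_1$, $Z_2=\partial_2$, $Z_3=\varphi\,\partial_z$, and $Z^\alpha=Z_1^{\alpha_1}Z_2^{\alpha_2}Z_3^{\alpha_3}$ for $\alpha\in\mathbb{N}_0^3$. For scalar or vector fields $f$ on $\Omega$ put $$\Vert f\Vert_{m,p}^p=\sum_{|\alpha|\le m}\Vert Z^\alpha f\Vert_{L^p(\Omega)}^p\ (p<\infty),\qquad \Vert f\Vert_{m,\infty}=\sum_{|\alpha|\le m}\Vert Z^\alpha f\Vert_{L^\infty(\Omega)},\qquad \Vert f\Vert_{W^{1,\infty}}=\Vert f\Vert_{L^\infty(\Omega)}+\sum_{i=1}^3\Vert\partial_i f\Vert_{L^\infty(\Omega)}.$$ Let $\mu\in\mathbb{R}$, $\bar\nu>0$ and $p\in(2,\infty)$. Then there are constants $c_0>0$ and $C>0$, depending only on $\mu$, $\bar\nu$ and $p$, such that the following holds for all $\nu\in[0,\bar\nu]$ and $T\in(0,1]$. Let $(u,q)$ (velocity and pressure) be smooth on $\overline\Omega\times[0,T]$,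 with $u(0)=u_0$, $\int_0^T\Vert u(s)\Vert_{3,p}^p\,ds<\infty$, $$\partial_t u-\nu\Delta u+u\cdot\nabla u+\nabla q=0,\qquad \nabla\cdot u=0\qquad\text{in }\Omega\times(0,T),$$ $u_3=0$ on $\{z=0\}\times(0,T)$ and, if $\nu>0$, $\partial_z u_i=2\mu u_i$ for $i=1,2$ on $\{z=0\}\times(0,T)$. Then for every $t\in[0,T]$ $$\Vert u(t)\Vert_{3,p}^p+c_0\nu\sum_{|\alpha|\le3}\int_0^t\!\int_\Omega\Big(|\nabla Z^\alpha u|^2|Z^\alpha u|^{p-2}+\big|\nabla|Z^\alpha u|^{p/2}\big|^2\Big)dx\,ds$$ $$\le C\Big(\Vert u_0\Vert_{3,p}^p+\int_0^t\Big(\Vert u\Vert_{3,p}^p\big(\Vert u\Vert_{2,\infty}+\Vert u\Vert_{W^{1,\infty}}\big)+\Vert u\Vert_{3,p}^{p-1}\Vert\nabla q\Vert_{3,p}\Big)ds+\nu^{p/2}\int_0^t\Vert\partial_z u\Vert_{2,p}^p\,ds\Big).$$ Here all integrals and norms take values in $[0,\infty]$, with $0\cdot\infty=0$. -/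

import Mathlib

open MeasureTheory Set
open scoped ENNReal NNReal ContDiff

namespace ConormalNS

/-- Euclidean three-space; a point is `x = (x₁, x₂, z)`, with `z = x 2`. -/
abbrev E3 : Type := EuclideanSpace ℝ (Fin 3)

/-- The open half-space `Ω = ℝ² × (0, ∞)`. -/
def halfSpace : Set E3 := {x | 0 < x 2}

/-- The closed half-space. -/
def closedHalfSpace : Set E3 := {x | 0 ≤ x 2}

/-- The standard basis vector `eᵢ`. -/
noncomputable def basisVec (i : Fin 3) : E3 := EuclideanSpace.single i 1

section Operators

variable {F : Type*} [NormedAddCommGroup F] [NormedSpace ℝ F]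

/-- The partial derivative `∂ᵢ f`. -/
noncomputable def pd (i : Fin 3) (f : E3 → F) : E3 → F :=
  fun x => fderiv ℝ f x (basisVec i)

/-- The conormal weight `φ(z) = z / (1 + z)`. -/
noncomputable def weight (z : ℝ) : ℝ := z / (1 + z)

/-- The conormal fields `Z₁ = ∂₁`, `Z₂ = ∂₂`, `Z₃ = φ ∂_z`. -/
noncomputable def conormalField (i : Fin 3) (f : E3 → F) : E3 → F :=
  if i = 2 then fun x => weight (x 2) • pd 2 f x else pd i f

/-- `Z^α = Z₁^{α₁} Z₂^{α₂} Z₃^{α₃}`. -/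
noncomputable def conormalDeriv (α : Fin 3 → ℕ) (f : E3 → F) : E3 → F :=
  (conormalField 0)^[α 0] ((conormalField 1)^[α 1] ((conormalField 2)^[α 2] f))

/-- The multi-indices `α ∈ ℕ₀³` with `|α| ≤ m`. -/
def multiIndices (m : ℕ) : Finset (Fin 3 → ℕ) :=
  (Fintype.piFinset fun _ => Finset.range (m + 1)).filter fun α => ∑ i, α i ≤ m

/-- The measure on the half-space. -/
noncomputable def vol : Measure E3 := volume.restrict halfSpace

/-- `‖f‖_{m,p}`, where `‖f‖_{m,p}^p = ∑_{|α| ≤ m} ‖Z^α f‖_{L^p(Ω)}^p`, for finite `p`. -/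
noncomputable def conormalNorm (m : ℕ) (p : ℝ) (f : E3 → F) : ℝ≥0∞ :=
  (∑ α ∈ multiIndices m, eLpNorm (conormalDeriv α f) (ENNReal.ofReal p) vol ^ p) ^ (1 / p)

/-- `‖f‖_{m,∞} = ∑_{|α| ≤ m} ‖Z^α f‖_{L^∞(Ω)}`. -/
noncomputable def conormalSupNorm (m : ℕ) (f : E3 → F) : ℝ≥0∞ :=
  ∑ α ∈ multiIndices m, eLpNorm (conormalDeriv α f) ∞ vol

/-- `‖f‖_{W^{1,∞}(Ω)}`, the usual (not conormal) norm. -/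
noncomputable def lipNorm (f : E3 → F) : ℝ≥0∞ :=
  eLpNorm f ∞ vol + ∑ i, eLpNorm (pd i f) ∞ vol

/-- `|∇f|² = ∑ᵢ |∂ᵢ f|²` at the point `x`. -/
noncomputable def gradSq (f : E3 → F) (x : E3) : ℝ := ∑ i, ‖pd i f x‖ ^ 2

/-- `|∇f|² |f|^{p-2} + |∇ |f|^{p/2}|²` at the point `x`. -/
noncomputable def dissipationDensity (p : ℝ) (f : E3 → F) (x : E3) : ℝ :=
  gradSq f x * ‖f x‖ ^ (p - 2) + gradSq (fun y => ‖f y‖ ^ (p / 2)) x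

end Operators

/-- `(u, q)` is a smooth solution (up to the boundary and up to the end times) on `[0, T]`, with
initial datum `u₀`, of the Navier-Stokes equations with viscosity `ν` in the half-space under the
Navier boundary condition with friction `μ`; for `ν = 0`, of the Euler equations with the slip
condition. -/
structure IsSmoothSolution (ν μ T : ℝ) (u₀ : E3 → E3) (u : ℝ → E3 → E3) (q : ℝ → E3 → ℝ) :
    Prop where
  smooth_u : ContDiffOn ℝ ∞ (fun y : ℝ × E3 => u y.1 y.2) (Icc 0 T ×ˢ closedHalfSpace)
  smooth_q : ContDiffOn ℝ ∞ (fun y : ℝ × E3 => q y.1 y.2) (Icc 0 T ×ˢ closedHalfSpace)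
  momentum : ∀ t ∈ Ioo 0 T, ∀ x ∈ halfSpace,
    deriv (fun s => u s x) t - ν • Laplacian.laplacian (u t) x
      + fderiv ℝ (u t) x (u t x) + gradient (q t) x = 0
  divFree : ∀ t ∈ Ioo 0 T, ∀ x ∈ halfSpace, ∑ i, pd i (u t) x i = 0
  noPenetration : ∀ t ∈ Ioo 0 T, ∀ x : E3, x 2 = 0 → u t x 2 = 0
  navierSlip : 0 < ν → ∀ t ∈ Ioo 0 T, ∀ x : E3, x 2 = 0 → ∀ i : Fin 3, i ≠ 2 →
    fderivWithin ℝ (u t) closedHalfSpace x (basisVec 2) i = 2 * μ * u t x i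
  initial : ∀ x ∈ closedHalfSpace, u 0 x = u₀ x

end ConormalNS

/-! For |α| ≤ 3 the field f = Z^α u solves a transport-diffusion system ∂ₜf + u·∇f = ν(Δf + ∂_z A +
B) + r (`exists_isTransportDiffusion`), which is tested against p|f|^{p-2}f. Since p > 2 this test
function is C¹ in f, so no regularization is needed. Convection integrates to zero because u is
divergence free and tangent to the wall; the Laplacian yields the dissipation.

Viscous commutators. The fields Zᵢ commute with each other and with all ∂ⱼ except for [Z₃, ∂_z] =
-w²∂_z, where w = 1/(1+z). Hence [Z^α, ∂_z²]u = ∂_z a + b with a, b combinations of Z^δ∂_z u, |δ| ≤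
2 (`exists_commutator_dzz`). After integration by parts they cost ν g²|f|^{p-2} ≤ ν^{p/2}g^p + |f|^p
with g = ∑|Z^δ∂_z u|, which is the last term of the theorem. The Navier condition enters by adding
-2μwf to the flux: then f is orthogonal to ∂_z f + A on the wall and no boundary integral remains.

Convection commutators. They are sums of P(w) Z^γ u_j ∂_j Z^δ u with |γ| + |δ| ≤ 3 and |δ| < 3
(`exists_commutator_transport`). For j = 3 the derivative ∂_z is not conormal, but Z^γ u₃ vanishes
on the wall, and Z^γu₃ ∂_z = (1+z)(Z^γu₃/z) Z₃. The quotient is controlled by ∂_z Z^γ u₃, in L^∞ by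
an average over the segment to the wall and in L^p by Hardy's inequality (`hardy_inequality`). By
incompressibility ∂_z Z^γ u₃ is again conormal (`exists_normal_bound`). When all derivatives fall on
u₃ the remaining factor ∂_z u is taken in L^∞. So each product is a sup-norm quantity times an L^p
quantity (`abs_mul_abs_le`).

The computation is localized by cutoffs, which are then removed by monotone convergence
(`energy_inequality`). Summation over α leaves an extra K∫‖u‖_{3,p}^p, removed by Gronwall's
inequality on a time interval of length at most one, where the finiteness of this integral is used.

The commutator identities are purely algebraic. They are proved once in an abstract ring with
derivations and then specialized to the functions smooth on the closed slab; quantifying over all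
such rings makes the constants independent of the solution and of T. -/

namespace ConormalNS

/-! ### Commuting conormal derivations on an abstract ring -/

/-- A commutative algebra with commuting derivations `∂ₜ, ∂₁, ∂₂, ∂_z` and an element `w` playing
the role of `1 / (1 + z)`. -/
structure ConormalRing (A : Type) [CommRing A] [Algebra ℝ A] where
  d : Fin 3 → Derivation ℝ A A
  dt : Derivation ℝ A A
  w : A
  comm : ∀ i j a, d i (d j a) = d j (d i a)
  comm_t : ∀ i a, dt (d i a) = d i (dt a)
  d_w : ∀ i, d i w = if i = 2 then -w ^ 2 else 0
  dt_w : dt w = 0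

namespace ConormalRing

variable {A : Type} [CommRing A] [Algebra ℝ A] (S : ConormalRing A)

/-- The conormal derivations `∂₁, ∂₂, (1 - w) ∂_z`. -/
def Z (i : Fin 3) : Derivation ℝ A A := if i = 2 then (1 - S.w) • S.d 2 else S.d i

lemma Z_two (a : A) : S.Z 2 a = (1 - S.w) * S.d 2 a := by simp [Z]

lemma Z_of_ne {i : Fin 3} (hi : i ≠ 2) (a : A) : S.Z i a = S.d i a := by simp [Z, hi]

lemma d_w_two : S.d 2 S.w = -S.w ^ 2 := by simp [S.d_w]

lemma d_w_of_ne {i : Fin 3} (hi : i ≠ 2) : S.d i S.w = 0 := by simp [S.d_w, hi]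

/-- Since ∂_z(1 - w) = w², the only nonzero commutator is the one between Z₃ and ∂_z. All later
commutators are iterates of this identity. -/
lemma Z_d (i j : Fin 3) (a : A) :
    S.Z i (S.d j a) = S.d j (S.Z i a) - if i = 2 ∧ j = 2 then S.w ^ 2 * S.d 2 a else 0 := by
  by_cases hi : i = 2
  · subst hi
    by_cases hj : j = 2
    · subst hj
      simp only [Z_two, Derivation.leibniz, map_sub, Derivation.map_one_eq_zero, S.d_w_two,
        smul_eq_mul, and_self, if_true]
      ring
    · simp only [Z_two, Derivation.leibniz, map_sub, Derivation.map_one_eq_zero,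
        S.d_w_of_ne hj, smul_eq_mul, hj, and_false, if_false, S.comm j 2 a]
      ring
  · simp [S.Z_of_ne hi, hi, S.comm i j a]

lemma Z_comm (i j : Fin 3) (a : A) : S.Z i (S.Z j a) = S.Z j (S.Z i a) := by
  by_cases hi : i = 2
  · by_cases hj : j = 2
    · rw [hi, hj]
    · rw [S.Z_of_ne hj, S.Z_of_ne hj, S.Z_d]
      simp [hj]
  · rw [S.Z_of_ne hi, S.Z_of_ne hi]
    have := S.Z_d j i a
    simp only [hi, and_false, if_false, sub_zero] at this
    exact this.symm

lemma dt_Z (i : Fin 3) (a : A) : S.dt (S.Z i a) = S.Z i (S.dt a) := by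
  by_cases hi : i = 2
  · subst hi
    simp [Z_two, S.dt_w, S.comm_t]
  · simp [S.Z_of_ne hi, S.comm_t]

/-- `Z^α`. -/
def Zpow (α : Fin 3 → ℕ) : Module.End ℝ A :=
  (S.Z 0 : A →ₗ[ℝ] A) ^ α 0 * (S.Z 1 : A →ₗ[ℝ] A) ^ α 1 * (S.Z 2 : A →ₗ[ℝ] A) ^ α 2

lemma Zpow_zero (a : A) : S.Zpow 0 a = a := by simp [Zpow]

lemma Zpow_apply (α : Fin 3 → ℕ) (a : A) :
    S.Zpow α a = (S.Z 0)^[α 0] ((S.Z 1)^[α 1] ((S.Z 2)^[α 2] a)) := by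
  simp [Zpow, Module.End.pow_apply]

lemma commute_Z (i j : Fin 3) :
    Commute (S.Z i : Module.End ℝ A) (S.Z j : Module.End ℝ A) :=
  LinearMap.ext fun a => S.Z_comm i j a

lemma commute_Z_Zpow (i : Fin 3) (α : Fin 3 → ℕ) :
    Commute (S.Z i : Module.End ℝ A) (S.Zpow α) :=
  (((S.commute_Z i 0).pow_right _).mul_right ((S.commute_Z i 1).pow_right _)).mul_right
    ((S.commute_Z i 2).pow_right _)

lemma Zpow_Z_eq (i : Fin 3) (α : Fin 3 → ℕ) (a : A) :
    S.Zpow α (S.Z i a) = S.Z i (S.Zpow α a) :=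
  (LinearMap.congr_fun (S.commute_Z_Zpow i α).eq a).symm

lemma Zpow_add_single (i : Fin 3) (α : Fin 3 → ℕ) (a : A) :
    S.Zpow (α + Pi.single i 1) a = S.Z i (S.Zpow α a) := by
  have h01 := (S.commute_Z 1 0).pow_right (α 0)
  have h02 := (S.commute_Z 2 0).pow_right (α 0)
  have h12 := (S.commute_Z 2 1).pow_right (α 1)
  have key : S.Zpow (α + Pi.single i 1) = (S.Z i : Module.End ℝ A) * S.Zpow α := by
    fin_cases i
    · simp [Zpow, pow_succ', mul_assoc]
    · simp only [Zpow, Fin.mk_one, Pi.add_apply, Pi.single_apply, Fin.isValue, zero_ne_one,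
        if_false, add_zero, if_true, pow_succ', Fin.reduceEq]
      rw [← mul_assoc, ← mul_assoc, ← mul_assoc, h01.eq]
    · simp only [Zpow, Fin.reduceFinMk, Pi.add_apply, Pi.single_apply, Fin.isValue,
        if_false, add_zero, if_true, pow_succ', Fin.reduceEq]
      rw [← mul_assoc, ← mul_assoc, ← mul_assoc, h02.eq, mul_assoc _ _ ((S.Z 1 : Module.End ℝ A) ^ α 1),
        h12.eq, ← mul_assoc]
  exact LinearMap.congr_fun key a

lemma Zpow_Z (i : Fin 3) (α : Fin 3 → ℕ) (a : A) :
    S.Zpow α (S.Z i a) = S.Zpow (α + Pi.single i 1) a := by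
  rw [Zpow_add_single, Zpow_Z_eq]

/-- The step may raise any coordinate, which fits `Zpow_add_single`: the fields commute, so the
order of application is irrelevant. -/
lemma multiIndex_induction {P : (Fin 3 → ℕ) → Prop} (h0 : P 0)
    (hs : ∀ α i, P α → P (α + Pi.single i 1)) (α : Fin 3 → ℕ) : P α := by
  have h : ∀ n, ∀ α : Fin 3 → ℕ, ∑ i, α i = n → P α := by
    intro n
    induction n with
    | zero =>
      intro α hα
      have : α = 0 := by
        ext i
        exact (Finset.sum_eq_zero_iff.1 hα) i (Finset.mem_univ i)
      exact this ▸ h0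
    | succ n ih =>
      intro α hα
      obtain ⟨i, hi⟩ : ∃ i, α i ≠ 0 := by
        by_contra! h
        simp [h] at hα
      have h1 : α = (α - Pi.single i 1) + Pi.single i 1 := by
        ext j
        by_cases hj : j = i
        · subst hj; simp; omega
        · simp [hj]
      rw [h1]
      apply hs
      apply ih
      have h2 : ∑ j, α j = ∑ j, (α - Pi.single i 1 : Fin 3 → ℕ) j + ∑ j, (Pi.single i 1 : Fin 3 → ℕ) j := by
        rw [← Finset.sum_add_distrib]
        exact Finset.sum_congr rfl fun j _ => congrFun h1 j
      simp only [Finset.sum_pi_single', Finset.mem_univ, if_true] at h2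
      omega
  exact h _ α rfl

lemma sum_add_single (α : Fin 3 → ℕ) (i : Fin 3) :
    ∑ j, (α + Pi.single i 1 : Fin 3 → ℕ) j = ∑ j, α j + 1 := by
  simp [Finset.sum_add_distrib]

lemma dt_Zpow (α : Fin 3 → ℕ) (a : A) : S.dt (S.Zpow α a) = S.Zpow α (S.dt a) := by
  induction α using multiIndex_induction with
  | h0 => simp [Zpow_zero]
  | hs α i ih => rw [Zpow_add_single, Zpow_add_single, dt_Z, ih]

lemma Zpow_d_of_ne {j : Fin 3} (hj : j ≠ 2) (α : Fin 3 → ℕ) (a : A) :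
    S.Zpow α (S.d j a) = S.d j (S.Zpow α a) := by
  rw [← S.Z_of_ne hj, ← S.Z_of_ne hj, Zpow_Z_eq]

lemma d_poly (i : Fin 3) (P : Polynomial ℝ) :
    S.d i (Polynomial.aeval S.w P)
      = if i = 2 then Polynomial.aeval S.w (-(Polynomial.X ^ 2 * P.derivative)) else 0 := by
  rw [Derivation.map_aeval, S.d_w]
  split_ifs <;> simp [mul_comm]

/-- Coefficients remain polynomials in w because ∂_z w = -w². The polynomial `Q` is chosen before
the ring, so bounds on it are uniform over all rings. -/
lemma Z_poly (i : Fin 3) (P : Polynomial ℝ) :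
    ∃ Q : Polynomial ℝ, ∀ (A : Type) [CommRing A] [Algebra ℝ A] (S : ConormalRing A),
      S.Z i (Polynomial.aeval S.w P) = Polynomial.aeval S.w Q := by
  by_cases hi : i = 2
  · refine ⟨(1 - Polynomial.X) * (-(Polynomial.X ^ 2 * P.derivative)), ?_⟩
    intro A _ _ S
    rw [hi, Z_two, d_poly]
    simp
  · refine ⟨0, ?_⟩
    intro A _ _ S
    rw [S.Z_of_ne hi, d_poly]
    simp [hi]

end ConormalRing

/-! ### Commutators as operations uniform over all conormal rings -/

open ConormalRing Polynomial

/-- Operations `A → A` given uniformly over all conormal rings. -/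
abbrev LinOp : Type 1 := ∀ (A : Type) [CommRing A] [Algebra ℝ A], ConormalRing A → A → A

/-- Sums of terms `P(w) Z^δ ∂_z v` with `|δ| < n`. -/
inductive LinLower (n : ℕ) : LinOp → Prop
  | mono (P : ℝ[X]) (δ : Fin 3 → ℕ) (h : ∑ i, δ i < n) :
      LinLower n fun _ _ _ S v => aeval S.w P * S.Zpow δ (S.d 2 v)
  | zero : LinLower n fun _ _ _ _ _ => 0
  | add {F G : LinOp} (hF : LinLower n F) (hG : LinLower n G) :
      LinLower n fun A _ _ S v => F A S v + G A S v

/-- Operations `A → A → A` given uniformly over all conormal rings. -/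
abbrev BilinOp : Type 1 := ∀ (A : Type) [CommRing A] [Algebra ℝ A], ConormalRing A → A → A → A

/-- Sums of terms `P(w) Z^γ v ∂ⱼ Z^δ g` with `|γ| + |δ| ≤ n` and `|δ| < n`. -/
inductive BilinLower (j : Fin 3) (n : ℕ) : BilinOp → Prop
  | mono (P : ℝ[X]) (γ δ : Fin 3 → ℕ) (h : ∑ i, γ i + ∑ i, δ i ≤ n) (hδ : ∑ i, δ i < n) :
      BilinLower j n fun _ _ _ S v g => aeval S.w P * (S.Zpow γ v * S.d j (S.Zpow δ g))
  | zero : BilinLower j n fun _ _ _ _ _ _ => 0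
  | add {F G : BilinOp} (hF : BilinLower j n F) (hG : BilinLower j n G) :
      BilinLower j n fun A _ _ S v g => F A S v g + G A S v g

namespace LinLower

lemma congr {n : ℕ} {F G : LinOp} (hF : LinLower n F)
    (h : ∀ (A : Type) [CommRing A] [Algebra ℝ A] (S : ConormalRing A) (v : A), G A S v = F A S v) :
    LinLower n G := by
  have : G = F := by
    funext A _ _ S v
    exact h A S v
  rwa [this]

lemma weaken {n m : ℕ} (hnm : n ≤ m) {F : LinOp} (hF : LinLower n F) : LinLower m F := by
  induction hF with
  | mono P δ h => exact mono P δ (h.trans_le hnm)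
  | zero => exact zero
  | add _ _ h1 h2 => exact add h1 h2

lemma poly_mul {n : ℕ} (Q : ℝ[X]) {F : LinOp} (hF : LinLower n F) :
    LinLower n fun A _ _ S v => aeval S.w Q * F A S v := by
  induction hF with
  | mono P δ h =>
    refine (mono (Q * P) δ h).congr ?_
    intro A _ _ S v
    simp [mul_assoc]
  | zero => exact zero.congr (by intros; simp)
  | add _ _ h1 h2 => exact (add h1 h2).congr (by intros; simp [mul_add])

lemma Z {n : ℕ} (i : Fin 3) {F : LinOp} (hF : LinLower n F) :
    LinLower (n + 1) fun A _ _ S v => S.Z i (F A S v) := by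
  induction hF with
  | mono P δ h =>
    obtain ⟨Q, hQ⟩ := Z_poly i P
    refine (add (mono (n := n + 1) P (δ + Pi.single i 1) (by rw [sum_add_single]; omega))
      (mono (n := n + 1) Q δ (by omega))).congr ?_
    intro A _ _ S v
    rw [Derivation.leibniz, hQ, Zpow_add_single]
    simp [mul_comm]
  | zero => exact zero.congr (by intros; simp)
  | add _ _ h1 h2 => exact (add h1 h2).congr (by intros; simp)

end LinLower

/-- `∂_z Z^α v` is a combination of the `Z^δ ∂_z v` with `|δ| ≤ |α|`. -/
lemma linLower_d_Zpow (α : Fin 3 → ℕ) :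
    LinLower (∑ i, α i + 1) fun _ _ _ S v => S.d 2 (S.Zpow α v) := by
  induction α using multiIndex_induction with
  | h0 =>
    refine (LinLower.mono 1 0 (by simp)).congr ?_
    intro A _ _ S v
    simp [Zpow_zero]
  | hs α i ih =>
    rw [sum_add_single]
    refine (LinLower.add (ih.Z i)
      ((ih.poly_mul (if i = 2 then X ^ 2 else 0)).weaken (Nat.le_succ _))).congr ?_
    intro A _ _ S v
    rw [Zpow_add_single, Z_d]
    by_cases hi : i = 2 <;> simp [hi]

/-- The commutator of `Z^α` with `∂_z²`, in divergence form. -/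
lemma exists_commutator_dzz (α : Fin 3 → ℕ) :
    ∃ a b : LinOp, LinLower (∑ i, α i) a ∧ LinLower (∑ i, α i) b ∧
      (α 2 = 0 → (∀ (A : Type) [CommRing A] [Algebra ℝ A] (S : ConormalRing A) (v : A),
        a A S v = 0)) ∧
      ∀ (A : Type) [CommRing A] [Algebra ℝ A] (S : ConormalRing A) (v : A),
        S.Zpow α (S.d 2 (S.d 2 v)) = S.d 2 (S.d 2 (S.Zpow α v)) + S.d 2 (a A S v) + b A S v := by
  induction α using multiIndex_induction with
  | h0 =>
    exact ⟨fun _ _ _ _ _ => 0, fun _ _ _ _ _ => 0, LinLower.zero, LinLower.zero,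
      by intros; rfl, by intros; simp [Zpow_zero]⟩
  | hs α i ih =>
    obtain ⟨a, b, ha, hb, h0, h⟩ := ih
    rw [sum_add_single]
    by_cases hi : i = 2
    · subst hi
      -- Moving Z₃ past each outer ∂_z costs -w² times that derivative. The resulting w²∂_z²V and
      -- w²∂_z a are written as exact ∂_z-derivatives, and ∂_z(w²) = -2w³ produces the new
      -- zeroth-order terms. The two copies of w²∂_z V come from the two ∂_z in ∂_z²V.
      refine ⟨fun A _ _ S v => S.Z 2 (a A S v) + (aeval S.w (-X ^ 2 : ℝ[X]) * a A S v +
          aeval S.w (-X ^ 2 - X ^ 2 : ℝ[X]) * S.d 2 (S.Zpow α v)),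
        fun A _ _ S v => S.Z 2 (b A S v) + (aeval S.w (-X ^ 3 - X ^ 3 : ℝ[X]) * a A S v +
          aeval S.w (-X ^ 3 - X ^ 3 : ℝ[X]) * S.d 2 (S.Zpow α v)), ?_, ?_, ?_, ?_⟩
      · exact (ha.Z 2).add (((ha.poly_mul _).weaken (Nat.le_succ _)).add
          ((linLower_d_Zpow α).poly_mul _))
      · exact (hb.Z 2).add (((ha.poly_mul _).weaken (Nat.le_succ _)).add
          ((linLower_d_Zpow α).poly_mul _))
      · intro hα
        simp at hα
      · intro A _ _ S v
        have hw : S.d 2 (S.w ^ 2) = -(S.w ^ 3 + S.w ^ 3) := by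
          rw [pow_two, Derivation.leibniz, S.d_w_two, smul_eq_mul]
          ring
        have e1 : S.d 2 (S.d 2 (S.Z 2 (S.Zpow α v)))
            = S.d 2 (S.Z 2 (S.d 2 (S.Zpow α v))) + S.d 2 (S.w ^ 2 * S.d 2 (S.Zpow α v)) := by
          rw [← map_add, S.Z_d]
          simp
        rw [Zpow_add_single, h, Zpow_add_single, map_add, map_add, e1,
          S.Z_d 2 2 (S.d 2 (S.Zpow α v)), S.Z_d 2 2 (a A S v)]
        simp only [map_add, map_sub, map_neg, map_pow, aeval_X, neg_mul, sub_mul,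
          Derivation.leibniz, hw, smul_eq_mul, and_self, if_true]
        ring
    · refine ⟨fun A _ _ S v => S.Z i (a A S v), fun A _ _ S v => S.Z i (b A S v), ha.Z i, hb.Z i,
        ?_, ?_⟩
      · intro hα A _ _ S v
        have := h0 (by simpa [hi, Ne.symm hi] using hα) A S v
        simp [this]
      · intro A _ _ S v
        rw [Zpow_add_single, h, Zpow_add_single, map_add, map_add, Z_d, Z_d, Z_d]
        simp [hi]

namespace BilinLower

lemma congr {j : Fin 3} {n : ℕ} {F G : BilinOp} (hF : BilinLower j n F)
    (h : ∀ (A : Type) [CommRing A] [Algebra ℝ A] (S : ConormalRing A) (v g : A),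
      G A S v g = F A S v g) :
    BilinLower j n G := by
  have : G = F := by
    funext A _ _ S v g
    exact h A S v g
  rwa [this]

lemma Z {j : Fin 3} {n : ℕ} (i : Fin 3) {F : BilinOp} (hF : BilinLower j n F) :
    BilinLower j (n + 1) fun A _ _ S v g => S.Z i (F A S v g) := by
  induction hF with
  | mono P γ δ h hδ =>
    obtain ⟨Q, hQ⟩ := Z_poly i P
    refine (add (mono (n := n + 1) Q γ δ (by omega) (by omega))
      (add (mono (n := n + 1) P (γ + Pi.single i 1) δ (by rw [sum_add_single]; omega) (by omega))
      (add (mono (n := n + 1) P γ (δ + Pi.single i 1) (by rw [sum_add_single]; omega)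
        (by rw [sum_add_single]; omega))
      (mono (n := n + 1) (if i = 2 ∧ j = 2 then -(P * X ^ 2) else 0) γ δ (by omega)
        (by omega))))).congr ?_
    intro A _ _ S v g
    rw [Derivation.leibniz, hQ, Derivation.leibniz, Zpow_add_single, Zpow_add_single, Z_d]
    by_cases hij : i = 2 ∧ j = 2
    · simp [hij]; ring
    · simp [hij]; ring
  | zero => exact zero.congr (by intros; simp)
  | add _ _ h1 h2 => exact (add h1 h2).congr (by intros; simp)

end BilinLower

/-- The commutator of `Z^α` with `v ∂ⱼ`. -/
lemma exists_commutator_transport (j : Fin 3) (α : Fin 3 → ℕ) :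
    ∃ R : BilinOp, BilinLower j (∑ i, α i) R ∧
      ∀ (A : Type) [CommRing A] [Algebra ℝ A] (S : ConormalRing A) (v g : A),
        S.Zpow α (v * S.d j g) = v * S.d j (S.Zpow α g) + R A S v g := by
  induction α using multiIndex_induction with
  | h0 => exact ⟨fun _ _ _ _ _ _ => 0, BilinLower.zero, by intros; simp [Zpow_zero]⟩
  | hs α i ih =>
    obtain ⟨R, hR, h⟩ := ih
    rw [sum_add_single]
    -- The two new terms arise when Zᵢ meets v ∂ⱼ Z^α g: either Zᵢ falls on v, or it is commuted
    -- past ∂ⱼ, which matters only for i = j = 2.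
    refine ⟨_, (hR.Z i).add ((BilinLower.mono 1 (Pi.single i 1) α (by simp [add_comm])
      (Nat.lt_succ_self _)).add
      (BilinLower.mono (if i = 2 ∧ j = 2 then -X ^ 2 else 0) 0 α (by simp)
        (Nat.lt_succ_self _))), ?_⟩
    intro A _ _ S v g
    rw [Zpow_add_single, h, Zpow_add_single, map_add, Derivation.leibniz, Z_d,
      ← zero_add (Pi.single i 1), Zpow_add_single]
    by_cases hij : i = 2 ∧ j = 2
    · simp [hij, Zpow_zero]; ring
    · simp [hij, Zpow_zero]; ring

/-! ### Pointwise bounds for the uniform operations -/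

lemma mem_multiIndices {m : ℕ} {α : Fin 3 → ℕ} : α ∈ multiIndices m ↔ ∑ i, α i ≤ m := by
  simp only [multiIndices, Finset.mem_filter, Fintype.mem_piFinset, Finset.mem_range,
    and_iff_right_iff_imp]
  intro h i
  have := Finset.single_le_sum (f := α) (fun _ _ => Nat.zero_le _) (Finset.mem_univ i)
  omega

lemma exists_bound_poly (P : ℝ[X]) :
    ∃ C : ℝ, 0 ≤ C ∧ ∀ (A : Type) [CommRing A] [Algebra ℝ A] (ev : A →ₐ[ℝ] ℝ) (w : A),
      ev w ∈ Icc (0 : ℝ) 1 → |ev (aeval w P)| ≤ C := by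
  obtain ⟨C, hC⟩ := (isCompact_Icc (a := (0 : ℝ)) (b := 1)).exists_bound_of_continuousOn
    (f := fun x => P.eval x) P.continuous.continuousOn
  refine ⟨max C 0, le_max_right _ _, ?_⟩
  intro A _ _ ev w hw
  have : ev (aeval w P) = P.eval (ev w) := by
    rw [← aeval_algHom_apply, coe_aeval_eq_eval]
  rw [this]
  exact (hC _ hw).trans (le_max_left _ _)

lemma LinLower.exists_bound {n : ℕ} {F : LinOp} (hF : LinLower (n + 1) F) :
    ∃ C : ℝ, 0 ≤ C ∧ ∀ (A : Type) [CommRing A] [Algebra ℝ A] (S : ConormalRing A)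
      (ev : A →ₐ[ℝ] ℝ), ev S.w ∈ Icc (0 : ℝ) 1 → ∀ v,
      |ev (F A S v)| ≤ C * ∑ δ ∈ multiIndices n, |ev (S.Zpow δ (S.d 2 v))| := by
  induction hF with
  | mono P δ h =>
    obtain ⟨C, hC, hP⟩ := exists_bound_poly P
    refine ⟨C, hC, ?_⟩
    intro A _ _ S ev hw v
    rw [map_mul, abs_mul]
    have := Finset.single_le_sum (f := fun δ => |ev (S.Zpow δ (S.d 2 v))|)
      (fun _ _ => abs_nonneg _) (mem_multiIndices.2 (Nat.lt_succ_iff.1 h))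
    exact mul_le_mul (hP A ev S.w hw) this (abs_nonneg _) hC
  | zero => exact ⟨0, le_rfl, by intros; simp⟩
  | add _ _ h1 h2 =>
    obtain ⟨C₁, hC₁, H₁⟩ := h1
    obtain ⟨C₂, hC₂, H₂⟩ := h2
    refine ⟨C₁ + C₂, by positivity, ?_⟩
    intro A _ _ S ev hw v
    rw [map_add, add_mul]
    exact (abs_add_le _ _).trans (add_le_add (H₁ A S ev hw v) (H₂ A S ev hw v))

/-- The common bound `M` on the individual products is left free: the analytic estimate of Z^γ v ∂ⱼ
Z^δ g depends on j and uses the solution, whereas the constant here is purely algebraic. -/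
lemma BilinLower.exists_bound {j : Fin 3} {n : ℕ} {F : BilinOp} (hF : BilinLower j n F) :
    ∃ C : ℝ, 0 ≤ C ∧ ∀ (A : Type) [CommRing A] [Algebra ℝ A] (S : ConormalRing A)
      (ev : A →ₐ[ℝ] ℝ), ev S.w ∈ Icc (0 : ℝ) 1 → ∀ v g (M : ℝ),
      (∀ γ δ : Fin 3 → ℕ, ∑ i, γ i + ∑ i, δ i ≤ n → ∑ i, δ i < n →
        |ev (S.Zpow γ v)| * |ev (S.d j (S.Zpow δ g))| ≤ M) →
      0 ≤ M → |ev (F A S v g)| ≤ C * M := by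
  induction hF with
  | mono P γ δ h hδ =>
    obtain ⟨C, hC, hP⟩ := exists_bound_poly P
    refine ⟨C, hC, ?_⟩
    intro A _ _ S ev hw v g M hM _
    rw [map_mul, abs_mul, map_mul, abs_mul]
    exact mul_le_mul (hP A ev S.w hw) (hM γ δ h hδ) (by positivity) hC
  | zero => exact ⟨0, le_rfl, by intros; simp⟩
  | add _ _ h1 h2 =>
    obtain ⟨C₁, hC₁, H₁⟩ := h1
    obtain ⟨C₂, hC₂, H₂⟩ := h2
    refine ⟨C₁ + C₂, by positivity, ?_⟩
    intro A _ _ S ev hw v g M hM hM0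
    rw [map_add, add_mul]
    exact (abs_add_le _ _).trans (add_le_add (H₁ A S ev hw v g M hM hM0) (H₂ A S ev hw v g M hM hM0))

end ConormalNS

namespace ConormalNS

/-! ### Smooth functions on the closed space-time slab -/

/-- The closed space-time slab `[0, T] × closure Ω`. -/
def slab (T : ℝ) : Set (ℝ × E3) := Icc 0 T ×ˢ closedHalfSpace

lemma continuous_apply_two : Continuous fun x : E3 => x 2 := by fun_prop

lemma isClosed_closedHalfSpace : IsClosed closedHalfSpace :=
  isClosed_le continuous_const continuous_apply_two

lemma isOpen_halfSpace : IsOpen halfSpace :=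
  isOpen_lt continuous_const continuous_apply_two

lemma measurableSet_halfSpace : MeasurableSet halfSpace := isOpen_halfSpace.measurableSet

lemma halfSpace_subset : halfSpace ⊆ closedHalfSpace := fun _ hx => le_of_lt (α := ℝ) hx

lemma convex_closedHalfSpace : Convex ℝ closedHalfSpace := by
  intro x hx y hy a b ha hb _
  simp only [closedHalfSpace, mem_ofPred_eq, PiLp.add_apply, PiLp.smul_apply, smul_eq_mul] at *
  positivity

lemma closedHalfSpace_subset_closure : closedHalfSpace ⊆ closure halfSpace := by
  intro x hx
  refine mem_closure_of_tendsto (f := fun n : ℕ => x + (1 / ((n : ℝ) + 1)) • basisVec 2)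
    (b := Filter.atTop) ?_ ?_
  · have h1 : Filter.Tendsto (fun n : ℕ => (1 / ((n : ℝ) + 1)) • basisVec 2) Filter.atTop
        (nhds ((0 : ℝ) • basisVec 2)) :=
      tendsto_one_div_add_atTop_nhds_zero_nat.smul_const _
    simpa using h1.const_add x
  · refine Filter.Eventually.of_forall fun n => ?_
    have : (0 : ℝ) < 1 / ((n : ℝ) + 1) := by positivity
    simp only [halfSpace, closedHalfSpace, mem_ofPred_eq, basisVec, PiLp.add_apply, PiLp.smul_apply,
      smul_eq_mul, PiLp.single_apply, if_true, mul_one] at *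
    linarith

lemma uniqueDiffOn_closedHalfSpace : UniqueDiffOn ℝ closedHalfSpace := by
  refine uniqueDiffOn_convex convex_closedHalfSpace ⟨basisVec 2, ?_⟩
  refine interior_maximal halfSpace_subset isOpen_halfSpace ?_
  simp [halfSpace, basisVec]

lemma isClosed_slab (T : ℝ) : IsClosed (slab T) := isClosed_Icc.prod isClosed_closedHalfSpace

lemma uniqueDiffOn_slab {T : ℝ} (hT : 0 < T) : UniqueDiffOn ℝ (slab T) :=
  (uniqueDiffOn_Icc hT).prod uniqueDiffOn_closedHalfSpace

lemma slab_subset_closure {T : ℝ} (hT : 0 < T) : slab T ⊆ closure (Ioo 0 T ×ˢ halfSpace) := by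
  rw [closure_prod_eq, closure_Ioo hT.ne]
  exact prod_mono le_rfl closedHalfSpace_subset_closure

lemma slab_subset_closure_interior {T : ℝ} (hT : 0 < T) : slab T ⊆ closure (interior (slab T)) :=
  (slab_subset_closure hT).trans (closure_mono (interior_maximal
    (prod_mono Ioo_subset_Icc_self halfSpace_subset) (isOpen_Ioo.prod isOpen_halfSpace)))

/-- The real functions that are smooth on the slab. -/
def smoothRing (T : ℝ) : Subalgebra ℝ (ℝ × E3 → ℝ) where
  carrier := {f | ContDiffOn ℝ ∞ f (slab T)}
  mul_mem' ha hb := ContDiffOn.mul ha hb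
  add_mem' ha hb := ContDiffOn.add ha hb
  algebraMap_mem' _ := contDiffOn_const

lemma differentiableWithinAt_of_smooth {T : ℝ} (f : smoothRing T) {y : ℝ × E3} (hy : y ∈ slab T) :
    DifferentiableWithinAt ℝ f.1 (slab T) y :=
  (ContDiffOn.differentiableOn f.2 (by simp)) y hy

lemma continuousOn_of_smooth {T : ℝ} (f : smoothRing T) : ContinuousOn f.1 (slab T) :=
  ContDiffOn.continuousOn f.2

/-- Elements of `smoothRing T` are functions on the whole space, so identities in the ring must also
hold off the slab. There all derivatives vanish, the slab being closed. -/
lemma fderivWithin_eq_zero_of_notMem {T : ℝ} {f : ℝ × E3 → ℝ} {y : ℝ × E3} (hy : y ∉ slab T) :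
    fderivWithin ℝ f (slab T) y = 0 :=
  fderivWithin_zero_of_notMem_closure (by rwa [(isClosed_slab T).closure_eq])

/-- The derivative in the direction `v`, as a derivation. -/
noncomputable def dirDeriv {T : ℝ} (hT : 0 < T) (v : ℝ × E3) :
    Derivation ℝ (smoothRing T) (smoothRing T) :=
  Derivation.mk'
    { toFun := fun f => ⟨fun y => fderivWithin ℝ f.1 (slab T) y v,
        (ContDiffOn.fderivWithin (m := ∞) f.2 (uniqueDiffOn_slab hT) (by simp)).clm_apply
          contDiffOn_const⟩
      map_add' := fun f g => Subtype.ext <| funext fun y => by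
        by_cases hy : y ∈ slab T
        · have := fderivWithin_add (uniqueDiffOn_slab hT y hy) (differentiableWithinAt_of_smooth f hy)
            (differentiableWithinAt_of_smooth g hy)
          exact congrArg (fun L : (ℝ × E3) →L[ℝ] ℝ => L v) this
        · simp [fderivWithin_eq_zero_of_notMem hy]
      map_smul' := fun c f => Subtype.ext <| funext fun y => by
        by_cases hy : y ∈ slab T
        · have := fderivWithin_const_smul (uniqueDiffOn_slab hT y hy)
            (differentiableWithinAt_of_smooth f hy) c
          exact congrArg (fun L : (ℝ × E3) →L[ℝ] ℝ => L v) this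
        · simp [fderivWithin_eq_zero_of_notMem hy] }
    fun f g => Subtype.ext <| funext fun y => by
      by_cases hy : y ∈ slab T
      · have := fderivWithin_mul (uniqueDiffOn_slab hT y hy) (differentiableWithinAt_of_smooth f hy)
          (differentiableWithinAt_of_smooth g hy)
        exact congrArg (fun L : (ℝ × E3) →L[ℝ] ℝ => L v) this
      · simp [fderivWithin_eq_zero_of_notMem hy]

lemma dirDeriv_apply {T : ℝ} (hT : 0 < T) (v : ℝ × E3) (f : smoothRing T) (y : ℝ × E3) :
    (dirDeriv hT v f).1 y = fderivWithin ℝ f.1 (slab T) y v := rfl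

lemma dirDeriv_eq_zero_of_notMem {T : ℝ} (hT : 0 < T) (v : ℝ × E3) (f : smoothRing T) {y : ℝ × E3}
    (hy : y ∉ slab T) : (dirDeriv hT v f).1 y = 0 := by
  rw [dirDeriv_apply, fderivWithin_eq_zero_of_notMem hy, zero_apply]

lemma dirDeriv_comm {T : ℝ} (hT : 0 < T) (v v' : ℝ × E3) (f : smoothRing T) :
    dirDeriv hT v (dirDeriv hT v' f) = dirDeriv hT v' (dirDeriv hT v f) := by
  refine Subtype.ext (funext fun y => ?_)
  by_cases hy : y ∈ slab T
  · have hd : DifferentiableWithinAt ℝ (fderivWithin ℝ f.1 (slab T)) (slab T) y :=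
      (ContDiffOn.fderivWithin (m := ∞) f.2 (uniqueDiffOn_slab hT)
        (by simp)).differentiableOn (by simp) y hy
    have key : ∀ a b : ℝ × E3, (dirDeriv hT a (dirDeriv hT b f)).1 y
        = fderivWithin ℝ (fderivWithin ℝ f.1 (slab T)) (slab T) y a b := by
      intro a b
      rw [dirDeriv_apply]
      have h1 : (dirDeriv hT b f).1 = fun y => fderivWithin ℝ f.1 (slab T) y b := rfl
      rw [h1, fderivWithin_clm_apply (uniqueDiffOn_slab hT y hy) hd
        (differentiableWithinAt_const b)]
      simp
    rw [key, key]
    -- Symmetry of second derivatives within a set also holds at boundary points that are limits of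
    -- interior points, which covers the whole slab.
    exact (ContDiffWithinAt.isSymmSndFDerivWithinAt (n := ∞) (f.2 y hy)
      (by rw [minSmoothness_of_isRCLikeNormedField]; exact WithTop.coe_le_coe.2 (le_top (a := (2 : ℕ∞))))
      (uniqueDiffOn_slab hT) (slab_subset_closure_interior hT hy) hy).eq v v'
  · rw [dirDeriv_eq_zero_of_notMem hT _ _ hy, dirDeriv_eq_zero_of_notMem hT _ _ hy]

open Classical in
/-- The function `1 / (1 + z)` on the slab. -/
noncomputable def smoothWeight (T : ℝ) : smoothRing T :=
  -- The value 0 off the slab makes ∂_z w = -w² an identity between total functions, as required by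
  -- `ConormalRing`.
  ⟨fun y => if y ∈ slab T then 1 / (1 + y.2 2) else 0, by
    have h : ContDiffOn ℝ ∞ (fun y : ℝ × E3 => 1 / (1 + y.2 2)) (slab T) := by
      refine ContDiffOn.div contDiffOn_const ?_ ?_
      · have : ContDiff ℝ ∞ fun y : ℝ × E3 => y.2 2 :=
          (contDiff_euclidean.1 contDiff_snd) 2
        exact (contDiff_const.add this).contDiffOn
      · intro y hy
        have : (0 : ℝ) ≤ y.2 2 := hy.2
        positivity
    exact h.congr fun y hy => by simp [hy]⟩

lemma smoothWeight_apply {T : ℝ} {y : ℝ × E3} (hy : y ∈ slab T) :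
    (smoothWeight T).1 y = 1 / (1 + y.2 2) := by simp [smoothWeight, hy]

lemma smoothWeight_of_notMem {T : ℝ} {y : ℝ × E3} (hy : y ∉ slab T) :
    (smoothWeight T).1 y = 0 := by simp [smoothWeight, hy]

lemma dirDeriv_smoothWeight {T : ℝ} (hT : 0 < T) (v : ℝ × E3) :
    dirDeriv hT v (smoothWeight T) = (-(v.2 2)) • smoothWeight T ^ 2 := by
  refine Subtype.ext (funext fun y => ?_)
  change (dirDeriv hT v (smoothWeight T)).1 y = (-(v.2 2)) * ((smoothWeight T).1 y) ^ 2
  by_cases hy : y ∈ slab T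
  · have hz : (0 : ℝ) ≤ y.2 2 := hy.2
    have hne : (1 + y.2 2 : ℝ) ≠ 0 := by positivity
    have h1 : HasFDerivAt (fun y : ℝ × E3 => y.2 2)
        ((EuclideanSpace.proj (2 : Fin 3) : E3 →L[ℝ] ℝ).comp (ContinuousLinearMap.snd ℝ ℝ E3)) y :=
      ((EuclideanSpace.proj (2 : Fin 3) : E3 →L[ℝ] ℝ).comp
        (ContinuousLinearMap.snd ℝ ℝ E3)).hasFDerivAt
    have h2 := ((hasDerivAt_inv hne).comp_hasFDerivAt y (h1.const_add 1)).hasFDerivWithinAt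
      (s := slab T)
    have h3 : HasFDerivWithinAt (smoothWeight T).1 _ (slab T) y :=
      h2.congr (fun z hz => by rw [smoothWeight_apply hz, one_div]; rfl)
        (by rw [smoothWeight_apply hy, one_div]; rfl)
    rw [dirDeriv_apply, h3.fderivWithin (uniqueDiffOn_slab hT y hy), smoothWeight_apply hy]
    simp
    ring
  · rw [dirDeriv_eq_zero_of_notMem hT _ _ hy, smoothWeight_of_notMem hy]
    simp

/-- The conormal structure on the functions smooth on the slab. -/
noncomputable def slabRing {T : ℝ} (hT : 0 < T) : ConormalRing (smoothRing T) where
  d i := dirDeriv hT (0, basisVec i)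
  dt := dirDeriv hT (1, 0)
  w := smoothWeight T
  comm i j a := dirDeriv_comm hT _ _ a
  comm_t i a := dirDeriv_comm hT _ _ a
  d_w i := by
    rw [dirDeriv_smoothWeight]
    fin_cases i <;> simp [basisVec]
  dt_w := by
    rw [dirDeriv_smoothWeight]
    simp

/-- Evaluation at a point. -/
def evalAt {T : ℝ} (y : ℝ × E3) : smoothRing T →ₐ[ℝ] ℝ :=
  (Pi.evalAlgHom ℝ (fun _ : ℝ × E3 => ℝ) y).comp (smoothRing T).val

lemma evalAt_apply {T : ℝ} (y : ℝ × E3) (f : smoothRing T) : evalAt y f = f.1 y := rfl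

lemma evalAt_w_mem {T : ℝ} (hT : 0 < T) (y : ℝ × E3) : evalAt y (slabRing hT).w ∈ Icc (0 : ℝ) 1 := by
  change (smoothWeight T).1 y ∈ Icc (0 : ℝ) 1
  by_cases hy : y ∈ slab T
  · have hz : (0 : ℝ) ≤ y.2 2 := hy.2
    rw [smoothWeight_apply hy]
    exact ⟨by positivity, by rw [div_le_one (by positivity)]; linarith⟩
  · rw [smoothWeight_of_notMem hy]
    simp

/-- The equations are assumed only in the open domain and at interior times; continuity carries them
to the closed slab. -/
lemma smoothRing_ext_interior {T : ℝ} (hT : 0 < T) {f g : smoothRing T}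
    (h : ∀ t ∈ Ioo 0 T, ∀ x ∈ halfSpace, f.1 (t, x) = g.1 (t, x)) {y : ℝ × E3} (hy : y ∈ slab T) :
    f.1 y = g.1 y := by
  have h1 : EqOn f.1 g.1 (Ioo 0 T ×ˢ halfSpace) := fun z hz => h z.1 hz.1 z.2 hz.2
  exact h1.of_subset_closure (continuousOn_of_smooth f) (continuousOn_of_smooth g)
    (prod_mono Ioo_subset_Icc_self halfSpace_subset) (slab_subset_closure hT) hy

/-- The functions vanishing on the boundary `z = 0`. -/
def VanishesAtBoundary {T : ℝ} (f : smoothRing T) : Prop :=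
  ∀ t ∈ Icc 0 T, ∀ x : E3, x 2 = 0 → f.1 (t, x) = 0

lemma VanishesAtBoundary.of_Ioo {T : ℝ} (hT : 0 < T) {f : smoothRing T}
    (h : ∀ t ∈ Ioo 0 T, ∀ x : E3, x 2 = 0 → f.1 (t, x) = 0) : VanishesAtBoundary f := by
  intro t ht x hx
  have hc : ContinuousOn (fun s => f.1 (s, x)) (Icc 0 T) :=
    (continuousOn_of_smooth f).comp (by fun_prop) fun s hs => ⟨hs, by simp [closedHalfSpace, hx]⟩
  have h1 : EqOn (fun s => f.1 (s, x)) (fun _ => 0) (Ioo 0 T) := fun s hs => h s hs x hx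
  exact h1.of_subset_closure hc continuousOn_const Ioo_subset_Icc_self
    (by rw [closure_Ioo hT.ne]) ht

/-! ### Time slices, boundary values and the classical conormal derivatives -/

section Slices

variable {T : ℝ} (hT : 0 < T)

lemma hasFDerivWithinAt_slice (f : smoothRing T) {t : ℝ} (ht : t ∈ Icc 0 T) {x : E3}
    (hx : x ∈ closedHalfSpace) :
    HasFDerivWithinAt (fun x => f.1 (t, x))
      ((fderivWithin ℝ f.1 (slab T) (t, x)).comp (ContinuousLinearMap.inr ℝ ℝ E3))
      closedHalfSpace x := by
  have h1 : HasFDerivWithinAt f.1 (fderivWithin ℝ f.1 (slab T) (t, x)) (slab T) (t, x) :=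
    (differentiableWithinAt_of_smooth f ⟨ht, hx⟩).hasFDerivWithinAt
  have h2 : HasFDerivWithinAt (fun x : E3 => (t, x)) (ContinuousLinearMap.inr ℝ ℝ E3)
      closedHalfSpace x := (hasFDerivAt_prodMk_right t x).hasFDerivWithinAt
  exact h1.comp x h2 fun z hz => ⟨ht, hz⟩

lemma hasFDerivAt_slice (f : smoothRing T) {t : ℝ} (ht : t ∈ Icc 0 T) {x : E3}
    (hx : x ∈ halfSpace) :
    HasFDerivAt (fun x => f.1 (t, x))
      ((fderivWithin ℝ f.1 (slab T) (t, x)).comp (ContinuousLinearMap.inr ℝ ℝ E3)) x :=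
  (hasFDerivWithinAt_slice f ht (halfSpace_subset hx)).hasFDerivAt
    (Filter.mem_of_superset (isOpen_halfSpace.mem_nhds hx) halfSpace_subset)

lemma hasDerivAt_time (f : smoothRing T) {t : ℝ} (ht : t ∈ Ioo 0 T) {x : E3}
    (hx : x ∈ closedHalfSpace) :
    HasDerivAt (fun s => f.1 (s, x)) (((slabRing hT).dt f).1 (t, x)) t := by
  have h1 : HasFDerivWithinAt f.1 (fderivWithin ℝ f.1 (slab T) (t, x)) (slab T) (t, x) :=
    (differentiableWithinAt_of_smooth f ⟨Ioo_subset_Icc_self ht, hx⟩).hasFDerivWithinAt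
  have h2 : HasDerivWithinAt (fun s : ℝ => (s, x)) ((1 : ℝ), (0 : E3)) (Icc 0 T) t :=
    ((hasDerivAt_id t).prodMk (hasDerivAt_const t x)).hasDerivWithinAt
  have h3 : MapsTo (fun s : ℝ => (s, x)) (Icc 0 T) (slab T) := fun z hz => ⟨hz, hx⟩
  exact (h1.comp_hasDerivWithinAt t h2 h3).hasDerivAt
    (Icc_mem_nhds ht.1 ht.2)

/-- The conormal fields are tangent to the wall: Z₁ and Z₂ differentiate along lines inside it, and
the weight of Z₃ vanishes on it. -/
lemma VanishesAtBoundary.Z {f : smoothRing T} (hf : VanishesAtBoundary f) (i : Fin 3) :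
    VanishesAtBoundary ((slabRing hT).Z i f) := by
  intro t ht x hx
  have hxc : x ∈ closedHalfSpace := by simp [closedHalfSpace, hx]
  by_cases hi : i = 2
  · subst hi
    rw [ConormalRing.Z_two]
    change (1 - (smoothWeight T).1 (t, x)) * _ = _
    rw [smoothWeight_apply ⟨ht, hxc⟩]
    simp [hx]
  · rw [ConormalRing.Z_of_ne _ hi]
    have hmem : ∀ r : ℝ, (x + r • basisVec i) 2 = 0 := by
      intro r
      simp [basisVec, hx, Ne.symm hi]
    have h2 : HasDerivAt (fun r : ℝ => x + r • basisVec i) (basisVec i) 0 := by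
      simpa using ((hasDerivAt_id (0 : ℝ)).smul_const (basisVec i)).const_add x
    have h1 : HasFDerivWithinAt (fun x => f.1 (t, x))
        ((fderivWithin ℝ f.1 (slab T) (t, x)).comp (ContinuousLinearMap.inr ℝ ℝ E3))
        closedHalfSpace (x + (0 : ℝ) • basisVec i) := by
      simpa using hasFDerivWithinAt_slice f ht hxc
    have h3 := h1.comp_hasDerivAt (0 : ℝ) h2
      (Filter.Eventually.of_forall fun r => by
        change (0 : ℝ) ≤ (x + r • basisVec i) 2
        rw [hmem])
    have h4 : HasDerivAt ((fun x => f.1 (t, x)) ∘ fun r : ℝ => x + r • basisVec i) 0 0 := by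
      have : ((fun x => f.1 (t, x)) ∘ fun r : ℝ => x + r • basisVec i) = fun _ => 0 :=
        funext fun r => hf t ht _ (hmem r)
      rw [this]
      exact hasDerivAt_const _ _
    exact h3.unique h4

lemma VanishesAtBoundary.Zpow {f : smoothRing T} (hf : VanishesAtBoundary f) (α : Fin 3 → ℕ) :
    VanishesAtBoundary ((slabRing hT).Zpow α f) := by
  induction α using ConormalRing.multiIndex_induction with
  | h0 => rwa [ConormalRing.Zpow_zero]
  | hs α i ih =>
    rw [ConormalRing.Zpow_add_single]
    exact ih.Z hT i

lemma vanishesAtBoundary_Z_two (f : smoothRing T) :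
    VanishesAtBoundary ((slabRing hT).Z 2 f) := by
  intro t ht x hx
  have hxc : x ∈ closedHalfSpace := by simp [closedHalfSpace, hx]
  rw [ConormalRing.Z_two]
  change (1 - (smoothWeight T).1 (t, x)) * _ = _
  rw [smoothWeight_apply ⟨ht, hxc⟩]
  simp [hx]

/-- One factor Z₃ is enough. It can be applied before the others because the fields commute; the
result vanishes on the wall, and the remaining fields preserve this. -/
lemma vanishesAtBoundary_Zpow (f : smoothRing T) {α : Fin 3 → ℕ} (hα : α 2 ≠ 0) :
    VanishesAtBoundary ((slabRing hT).Zpow α f) := by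
  have h : α = (α - Pi.single 2 1) + Pi.single 2 1 := by
    ext j
    by_cases hj : j = 2
    · subst hj; simp; omega
    · simp [hj]
  rw [h, ← ConormalRing.Zpow_Z]
  exact (vanishesAtBoundary_Z_two hT f).Zpow hT _

/-- The vector field `x ↦ (g₁(t, x), g₂(t, x), g₃(t, x))`. -/
def slice (g : Fin 3 → smoothRing T) (t : ℝ) (x : E3) : E3 :=
  WithLp.toLp 2 fun k => (g k).1 (t, x)

lemma slice_apply (g : Fin 3 → smoothRing T) (t : ℝ) (x : E3) (k : Fin 3) :
    slice g t x k = (g k).1 (t, x) := rfl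

lemma hasFDerivAt_slice_vec (g : Fin 3 → smoothRing T) {t : ℝ} (ht : t ∈ Icc 0 T) {x : E3}
    (hx : x ∈ halfSpace) :
    ∃ L : E3 →L[ℝ] E3, HasFDerivAt (slice g t) L x ∧
      ∀ i, L (basisVec i) = slice (fun k => (slabRing hT).d i (g k)) t x := by
  let L : E3 →L[ℝ] E3 := (PiLp.continuousLinearEquiv 2 ℝ (fun _ : Fin 3 => ℝ)).symm.toContinuousLinearMap.comp
    (ContinuousLinearMap.pi fun k =>
      (fderivWithin ℝ (g k).1 (slab T) (t, x)).comp (ContinuousLinearMap.inr ℝ ℝ E3))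
  refine ⟨L, ?_, ?_⟩
  · rw [← hasFDerivWithinAt_univ, hasFDerivWithinAt_euclidean]
    intro k
    rw [hasFDerivWithinAt_univ]
    exact hasFDerivAt_slice (g k) ht hx
  · intro i
    ext k
    rfl

/-- Agreement on the open half-space determines the derivatives there, so this form can be iterated,
and it suffices for every norm over Ω. -/
lemma pd_eqOn_slice {V : E3 → E3} {g : Fin 3 → smoothRing T} {t : ℝ} (ht : t ∈ Icc 0 T)
    (hV : EqOn V (slice g t) halfSpace) (i : Fin 3) :
    EqOn (pd i V) (slice (fun k => (slabRing hT).d i (g k)) t) halfSpace := by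
  intro x hx
  obtain ⟨L, hL, h⟩ := hasFDerivAt_slice_vec hT g ht hx
  have hVL : HasFDerivAt V L x :=
    hL.congr_of_eventuallyEq (Filter.eventuallyEq_of_mem (isOpen_halfSpace.mem_nhds hx) hV)
  rw [pd, hVL.fderiv, h]

lemma conormalField_eqOn_slice {V : E3 → E3} {g : Fin 3 → smoothRing T} {t : ℝ}
    (ht : t ∈ Icc 0 T) (hV : EqOn V (slice g t) halfSpace) (i : Fin 3) :
    EqOn (conormalField i V) (slice (fun k => (slabRing hT).Z i (g k)) t) halfSpace := by
  intro x hx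
  by_cases hi : i = 2
  · subst hi
    have hz : (0 : ℝ) < x 2 := hx
    simp only [conormalField, if_true]
    rw [pd_eqOn_slice hT ht hV 2 hx]
    ext k
    simp only [PiLp.smul_apply, slice_apply, smul_eq_mul, ConormalRing.Z_two]
    change _ = (1 - (smoothWeight T).1 (t, x)) * _
    rw [smoothWeight_apply ⟨ht, halfSpace_subset hx⟩, weight]
    congr 1
    field_simp
    ring
  · simp only [conormalField, hi, if_false, ConormalRing.Z_of_ne _ hi]
    exact pd_eqOn_slice hT ht hV i hx

lemma iterate_conormalField_eqOn_slice {V : E3 → E3} {g : Fin 3 → smoothRing T} {t : ℝ}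
    (ht : t ∈ Icc 0 T) (hV : EqOn V (slice g t) halfSpace) (i : Fin 3) (n : ℕ) :
    EqOn ((conormalField i)^[n] V) (slice (fun k => ((slabRing hT).Z i)^[n] (g k)) t) halfSpace := by
  induction n with
  | zero => simpa using hV
  | succ n ih =>
    simp only [Function.iterate_succ', Function.comp_def]
    exact conormalField_eqOn_slice hT ht ih i

lemma conormalDeriv_eqOn_slice {V : E3 → E3} {g : Fin 3 → smoothRing T} {t : ℝ}
    (ht : t ∈ Icc 0 T) (hV : EqOn V (slice g t) halfSpace) (α : Fin 3 → ℕ) :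
    EqOn (conormalDeriv α V) (slice (fun k => (slabRing hT).Zpow α (g k)) t) halfSpace := by
  simp only [conormalDeriv, ConormalRing.Zpow_apply]
  exact iterate_conormalField_eqOn_slice hT ht (iterate_conormalField_eqOn_slice hT ht
    (iterate_conormalField_eqOn_slice hT ht hV 2 _) 1 _) 0 _

end Slices

end ConormalNS

namespace ConormalNS

/-! ### The equations on the slab -/

lemma eq_sum_basisVec (v : E3) : v = ∑ j, v j • basisVec j := by
  ext k
  simp [Fin.sum_univ_three, basisVec]
  fin_cases k <;> simp

lemma laplacian_eq_sum_pd {V : E3 → E3} {x : E3} (hV : ContDiffAt ℝ 2 V x) :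
    Laplacian.laplacian V x = ∑ j, pd j (pd j V) x := by
  have hd : DifferentiableAt ℝ (fderiv ℝ V) x :=
    (hV.fderiv_right (m := 1) (by norm_num)).differentiableAt (by simp)
  rw [InnerProductSpace.laplacian_eq_iteratedFDeriv_orthonormalBasis V
    (EuclideanSpace.basisFun (Fin 3) ℝ)]
  refine Finset.sum_congr rfl fun j _ => ?_
  rw [iteratedFDeriv_two_apply]
  have h1 : pd j V = fun y => fderiv ℝ V y (basisVec j) := rfl
  rw [pd, h1, fderiv_clm_apply hd (differentiableAt_const _)]
  simp [basisVec]

lemma gradient_apply {f : E3 → ℝ} {x : E3} (i : Fin 3) :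
    gradient f x i = fderiv ℝ f x (basisVec i) := by
  rw [← inner_gradient_left, basisVec, EuclideanSpace.inner_single_right]
  simp

namespace IsSmoothSolution

variable {ν μ T : ℝ} {u₀ : E3 → E3} {u : ℝ → E3 → E3} {q : ℝ → E3 → ℝ}

/-- The velocity components as smooth functions on the slab. -/
def velocity (h : IsSmoothSolution ν μ T u₀ u q) (i : Fin 3) : smoothRing T :=
  ⟨fun y => u y.1 y.2 i, (contDiffOn_euclidean.1 h.smooth_u) i⟩

/-- The pressure as a smooth function on the slab. -/
def pressure (h : IsSmoothSolution ν μ T u₀ u q) : smoothRing T :=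
  ⟨fun y => q y.1 y.2, h.smooth_q⟩

lemma contDiffAt_slice (h : IsSmoothSolution ν μ T u₀ u q) {t : ℝ} (ht : t ∈ Icc 0 T) {x : E3} (hx : x ∈ halfSpace) :
    ContDiffAt ℝ 2 (u t) x := by
  have h1 : ContDiffOn ℝ ∞ (u t) closedHalfSpace :=
    h.smooth_u.comp (t := slab T) (f := fun x : E3 => (t, x))
      (contDiff_prodMk_right t).contDiffOn fun z hz => ⟨ht, hz⟩
  exact (h1.contDiffAt (Filter.mem_of_superset (isOpen_halfSpace.mem_nhds hx)
    halfSpace_subset)).of_le (WithTop.coe_le_coe.2 (le_top (a := (2 : ℕ∞))))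

variable (h : IsSmoothSolution ν μ T u₀ u q) (hT : 0 < T)

lemma gradient_eqOn_slice {t : ℝ} (ht : t ∈ Icc 0 T) :
    EqOn (gradient (q t)) (slice (fun k => (slabRing hT).d k h.pressure) t) halfSpace := by
  intro x hx
  ext k
  have := hasFDerivAt_slice h.pressure ht hx
  rw [gradient_apply]
  change fderiv ℝ (fun x => h.pressure.1 (t, x)) x (basisVec k) = _
  rw [this.fderiv]
  rfl

lemma initial_eqOn_slice : EqOn u₀ (slice h.velocity 0) halfSpace := fun x hx =>
  (h.initial x (halfSpace_subset hx)).symm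

lemma div_velocity : ∑ i, (slabRing hT).d i (h.velocity i) = 0 := by
  refine Subtype.ext (funext fun y => ?_)
  by_cases hy : y ∈ slab T
  · refine smoothRing_ext_interior hT ?_ hy
    intro t ht x hx
    have h1 := h.divFree t ht x hx
    have h2 : ∀ i, pd i (u t) x = slice (fun k => (slabRing hT).d i (h.velocity k)) t x := fun i =>
      pd_eqOn_slice hT (Ioo_subset_Icc_self ht) (g := h.velocity) (fun _ _ => rfl) i hx
    simp only [h2, slice_apply] at h1
    rw [Fin.sum_univ_three] at h1 ⊢
    exact h1
  · have : ∀ i, ((slabRing hT).d i (h.velocity i)).1 y = 0 := fun i =>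
      dirDeriv_eq_zero_of_notMem hT _ _ hy
    rw [Fin.sum_univ_three]
    change ((slabRing hT).d 0 (h.velocity 0)).1 y + ((slabRing hT).d 1 (h.velocity 1)).1 y
      + ((slabRing hT).d 2 (h.velocity 2)).1 y = 0
    rw [this, this, this]
    simp

lemma dt_velocity (i : Fin 3) : (slabRing hT).dt (h.velocity i)
    = ν • ∑ j, (slabRing hT).d j ((slabRing hT).d j (h.velocity i))
      - ∑ j, h.velocity j * (slabRing hT).d j (h.velocity i) - (slabRing hT).d i h.pressure := by
  refine Subtype.ext (funext fun y => ?_)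
  by_cases hy : y ∈ slab T
  · refine smoothRing_ext_interior hT ?_ hy
    intro t ht x hx
    have htc := Ioo_subset_Icc_self ht
    have h1 := congrArg (fun v : E3 => v i) (h.momentum t ht x hx)
    have e1 : ∀ j, pd j (u t) x = slice (fun k => (slabRing hT).d j (h.velocity k)) t x := fun j =>
      pd_eqOn_slice hT htc (g := h.velocity) (fun _ _ => rfl) j hx
    have e2 : ∀ j, pd j (pd j (u t)) x
        = slice (fun k => (slabRing hT).d j ((slabRing hT).d j (h.velocity k))) t x := fun j =>
      pd_eqOn_slice hT htc (pd_eqOn_slice hT htc (g := h.velocity) (fun _ _ => rfl) j) j hx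
    have e3 : deriv (fun s => u s x) t i = ((slabRing hT).dt (h.velocity i)).1 (t, x) := by
      have : HasFDerivAt (fun s => u s x) ((PiLp.continuousLinearEquiv 2 ℝ
          (fun _ : Fin 3 => ℝ)).symm.toContinuousLinearMap.comp (ContinuousLinearMap.pi fun k =>
          ContinuousLinearMap.toSpanSingleton ℝ
            (((slabRing hT).dt (h.velocity k)).1 (t, x)))) t := by
        rw [← hasFDerivWithinAt_univ, hasFDerivWithinAt_euclidean]
        intro k
        rw [hasFDerivWithinAt_univ]
        exact (hasDerivAt_time hT (h.velocity k) ht (halfSpace_subset hx)).hasFDerivAt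
      rw [this.hasDerivAt.deriv]
      exact one_smul ℝ _
    have e4 : fderiv ℝ (u t) x (u t x) = ∑ j, u t x j • pd j (u t) x := by
      conv_lhs => rw [eq_sum_basisVec (u t x)]
      simp [pd]
    have e5 := h.gradient_eqOn_slice hT htc hx
    rw [e4, e5, laplacian_eq_sum_pd (h.contDiffAt_slice htc hx)] at h1
    simp only [PiLp.add_apply, PiLp.sub_apply, PiLp.smul_apply, e3, e1, e2, Fin.sum_univ_three,
      slice_apply, smul_eq_mul, PiLp.zero_apply] at h1
    rw [Fin.sum_univ_three, Fin.sum_univ_three]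
    change ((slabRing hT).dt (h.velocity i)).1 (t, x) =
      ν * (((slabRing hT).d 0 ((slabRing hT).d 0 (h.velocity i))).1 (t, x)
        + ((slabRing hT).d 1 ((slabRing hT).d 1 (h.velocity i))).1 (t, x)
        + ((slabRing hT).d 2 ((slabRing hT).d 2 (h.velocity i))).1 (t, x))
      - (u t x 0 * ((slabRing hT).d 0 (h.velocity i)).1 (t, x)
        + u t x 1 * ((slabRing hT).d 1 (h.velocity i)).1 (t, x)
        + u t x 2 * ((slabRing hT).d 2 (h.velocity i)).1 (t, x))
      - ((slabRing hT).d i h.pressure).1 (t, x)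
    linarith
  · have e0 : ∀ v f, (dirDeriv hT v f).1 y = 0 := fun v f => dirDeriv_eq_zero_of_notMem hT v f hy
    rw [Fin.sum_univ_three, Fin.sum_univ_three]
    change ((slabRing hT).dt (h.velocity i)).1 y =
      ν * (((slabRing hT).d 0 ((slabRing hT).d 0 (h.velocity i))).1 y
        + ((slabRing hT).d 1 ((slabRing hT).d 1 (h.velocity i))).1 y
        + ((slabRing hT).d 2 ((slabRing hT).d 2 (h.velocity i))).1 y)
      - ((h.velocity 0).1 y * ((slabRing hT).d 0 (h.velocity i)).1 y
        + (h.velocity 1).1 y * ((slabRing hT).d 1 (h.velocity i)).1 y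
        + (h.velocity 2).1 y * ((slabRing hT).d 2 (h.velocity i)).1 y)
      - ((slabRing hT).d i h.pressure).1 y
    simp [slabRing, e0]

lemma vanishesAtBoundary_velocity (hT : 0 < T) : VanishesAtBoundary (h.velocity 2) :=
  VanishesAtBoundary.of_Ioo hT fun t ht x hx => h.noPenetration t ht x hx

lemma vanishesAtBoundary_slip (hν : 0 < ν) {i : Fin 3} (hi : i ≠ 2) :
    VanishesAtBoundary ((slabRing hT).d 2 (h.velocity i) - (2 * μ) • h.velocity i) := by
  refine VanishesAtBoundary.of_Ioo hT fun t ht x hx => ?_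
  have hxc : x ∈ closedHalfSpace := by simp [closedHalfSpace, hx]
  have h1 := h.navierSlip hν t ht x hx i hi
  have h2 : HasFDerivWithinAt (u t) ((PiLp.continuousLinearEquiv 2 ℝ
      (fun _ : Fin 3 => ℝ)).symm.toContinuousLinearMap.comp (ContinuousLinearMap.pi fun k =>
      (fderivWithin ℝ (h.velocity k).1 (slab T) (t, x)).comp (ContinuousLinearMap.inr ℝ ℝ E3)))
      closedHalfSpace x := by
    rw [hasFDerivWithinAt_euclidean]
    intro k
    exact hasFDerivWithinAt_slice (h.velocity k) (Ioo_subset_Icc_self ht) hxc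
  rw [h2.fderivWithin (uniqueDiffOn_closedHalfSpace x hxc)] at h1
  change ((slabRing hT).d 2 (h.velocity i)).1 (t, x) - (2 * μ) * u t x i = 0
  rw [← h1]
  exact sub_self _

end IsSmoothSolution

end ConormalNS

namespace ConormalNS

/-! ### The map `v ↦ |v|^s v` -/

section PowVec

variable {E : Type*} [NormedAddCommGroup E] [InnerProductSpace ℝ E]

/-- The map `v ↦ |v|^s v`. -/
noncomputable def powVec (s : ℝ) (v : E) : E := ‖v‖ ^ s • v

/-- The derivative of `v ↦ |v|^s v` at `v` in the direction `k`. -/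
noncomputable def powVecDeriv (s : ℝ) (v k : E) : E :=
  ‖v‖ ^ s • k + (s * ‖v‖ ^ (s - 2) * inner ℝ v k) • v

lemma norm_powVec {s : ℝ} (hs : 0 < s) (v : E) : ‖powVec s v‖ = ‖v‖ ^ (s + 1) := by
  rw [powVec, norm_smul, Real.norm_of_nonneg (by positivity),
    Real.rpow_add_one' (norm_nonneg v) (by positivity)]

/-- Negative exponents are admitted because the derivative of `powVec s` is expressed through the
exponent (s - 2)/2, which exceeds -1 when s > 0. -/
lemma continuous_powVec_of_neg_one_lt {s : ℝ} (hs : -1 < s) :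
    Continuous (powVec s : E → E) := by
  rw [continuous_iff_continuousAt]
  intro v
  by_cases hv : v = 0
  · subst hv
    rw [ContinuousAt, show powVec s (0 : E) = 0 by simp [powVec], tendsto_zero_iff_norm_tendsto_zero]
    have h : ∀ v : E, ‖powVec s v‖ = ‖v‖ ^ (s + 1) := fun v => by
      rw [powVec, norm_smul, Real.norm_of_nonneg (by positivity),
        Real.rpow_add_one' (norm_nonneg v) (by linarith)]
    simp only [h]
    have h2 : ContinuousAt (fun v : E => ‖v‖ ^ (s + 1)) 0 :=
      continuous_norm.continuousAt.rpow_const (Or.inr (by linarith))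
    simpa [ContinuousAt, Real.zero_rpow (show s + 1 ≠ 0 by linarith)] using h2
  · exact (continuous_norm.continuousAt.rpow_const (Or.inl (norm_ne_zero_iff.2 hv))).smul
      continuousAt_id

/-- The factor |v|^{s-2} is singular at the origin when s < 2. Sharing it equally between the two
copies of v gives an expression that is visibly continuous there. -/
lemma powVecDeriv_eq {s : ℝ} (v k : E) :
    powVecDeriv s v k = ‖v‖ ^ s • k
      + (s * inner ℝ (powVec ((s - 2) / 2) v) k) • powVec ((s - 2) / 2) v := by
  have h : (‖v‖ ^ ((s - 2) / 2)) * (‖v‖ ^ ((s - 2) / 2)) = ‖v‖ ^ (s - 2) := by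
    rw [← pow_two, ← Real.rpow_mul_natCast (norm_nonneg v)]
    congr 1
    push_cast
    ring
  rw [powVecDeriv, powVec, inner_smul_left, smul_smul, ← h]
  congr 2
  simp
  ring

lemma continuous_powVecDeriv {s : ℝ} (hs : 0 < s) :
    Continuous fun z : E × E => powVecDeriv s z.1 z.2 := by
  have h1 : Continuous (powVec ((s - 2) / 2) : E → E) :=
    continuous_powVec_of_neg_one_lt (by linarith)
  have h2 : Continuous fun z : E × E => ‖z.1‖ ^ s :=
    continuous_fst.norm.rpow_const fun _ => Or.inr hs.le
  simp only [powVecDeriv_eq]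
  have h3 : Continuous fun z : E × E => powVec ((s - 2) / 2) z.1 := h1.comp continuous_fst
  exact (h2.smul continuous_snd).add ((continuous_const.mul (h3.inner continuous_snd)).smul h3)

/-- At the origin |k|^s k = o(|k|), so the derivative exists and is zero. With s = p - 2 > 0 this is
where p > 2 makes |f|^{p-2}f an admissible test function without regularization. -/
lemma hasFDerivAt_powVec {s : ℝ} (hs : 0 < s) (v : E) :
    ∃ L : E →L[ℝ] E, HasFDerivAt (powVec s) L v ∧ ∀ k, L k = powVecDeriv s v k := by
  by_cases hv : v = 0
  · subst hv
    refine ⟨0, ?_, fun k => by simp [powVecDeriv, Real.zero_rpow hs.ne']⟩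
    refine .of_isLittleO ?_
    have h1 : (fun k : E => powVec s k - powVec s 0 - (0 : E →L[ℝ] E) (k - 0))
        = fun k => ‖k‖ ^ s • k := by
      ext k
      simp [powVec]
    rw [h1]
    have h2 : (fun k : E => ‖k‖ ^ s) =o[nhds 0] fun _ => (1 : ℝ) := by
      rw [Asymptotics.isLittleO_one_iff]
      have : ContinuousAt (fun k : E => ‖k‖ ^ s) 0 :=
        continuous_norm.continuousAt.rpow_const (Or.inr hs.le)
      simpa [ContinuousAt, Real.zero_rpow hs.ne'] using this
    simpa using h2.smul_isBigO (Asymptotics.isBigO_refl (fun k : E => k) (nhds 0))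
  · have hv' : ‖v‖ ≠ 0 := norm_ne_zero_iff.2 hv
    have h1 : HasFDerivAt (fun k : E => ‖k‖ ^ s) ((s * ‖v‖ ^ (s - 2)) • innerSL ℝ v) v := by
      have := ((hasStrictFDerivAt_norm_sq v).hasFDerivAt).rpow_const (p := s / 2)
        (Or.inl (by positivity))
      convert! this using 0
      simp_rw [← Real.rpow_natCast_mul (norm_nonneg _), ← Nat.cast_smul_eq_nsmul ℝ, smul_smul]
      ring_nf
    refine ⟨_, h1.smul (hasFDerivAt_id v), fun k => ?_⟩
    simp [powVecDeriv]

lemma abs_inner_powVec_le {s : ℝ} (hs : 0 < s) (v k : E) :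
    |inner ℝ (powVec s v) k| ≤ ‖v‖ ^ s * ‖v‖ * ‖k‖ := by
  refine (abs_real_inner_le_norm _ _).trans ?_
  rw [norm_powVec hs, Real.rpow_add_one' (norm_nonneg v) (by positivity)]

/-- Coercivity: the rank-one part of the derivative contributes a nonnegative square and can be
dropped. This inequality is the source of the dissipation. -/
lemma le_inner_powVecDeriv {s : ℝ} (hs : 0 < s) (v k : E) :
    ‖v‖ ^ s * ‖k‖ ^ 2 ≤ inner ℝ (powVecDeriv s v k) k := by
  rw [powVecDeriv, inner_add_left, inner_smul_left, inner_smul_left, real_inner_self_eq_norm_sq]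
  have : 0 ≤ s * ‖v‖ ^ (s - 2) * inner ℝ v k * inner ℝ v k := by
    rw [mul_assoc]
    exact mul_nonneg (by positivity) (mul_self_nonneg _)
  simpa using this

lemma norm_powVecDeriv_le {s : ℝ} (hs : 0 < s) (v k : E) :
    ‖powVecDeriv s v k‖ ≤ (1 + s) * (‖v‖ ^ s * ‖k‖) := by
  have h1 : ‖(s * ‖v‖ ^ (s - 2) * inner ℝ v k) • v‖ ≤ s * (‖v‖ ^ s * ‖k‖) := by
    by_cases hv : v = 0
    · subst hv
      simp only [smul_zero, norm_zero]
      positivity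
    · have hv' : 0 < ‖v‖ := norm_pos_iff.2 hv
      have h2 : ‖v‖ ^ s = ‖v‖ ^ (s - 2) * ‖v‖ ^ 2 := by
        rw [← Real.rpow_natCast, ← Real.rpow_add hv']
        norm_num
      rw [norm_smul, norm_mul, norm_mul, Real.norm_of_nonneg hs.le,
        Real.norm_of_nonneg (by positivity : 0 ≤ ‖v‖ ^ (s - 2)), h2]
      have := norm_inner_le_norm (𝕜 := ℝ) v k
      calc s * ‖v‖ ^ (s - 2) * ‖inner ℝ v k‖ * ‖v‖
          ≤ s * ‖v‖ ^ (s - 2) * (‖v‖ * ‖k‖) * ‖v‖ := by gcongr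
        _ = _ := by ring
  calc ‖powVecDeriv s v k‖ ≤ ‖‖v‖ ^ s • k‖ + ‖(s * ‖v‖ ^ (s - 2) * inner ℝ v k) • v‖ :=
        norm_add_le _ _
    _ ≤ ‖v‖ ^ s * ‖k‖ + s * (‖v‖ ^ s * ‖k‖) := by
        refine add_le_add (le_of_eq ?_) h1
        rw [norm_smul, Real.norm_of_nonneg (by positivity)]
    _ = _ := by ring

/-- With a = √ν g the left side is a²m^{p-2}, at most the p-th power of the larger of a and m. This
is how ν^{p/2} enters the theorem. -/
lemma mul_sq_mul_rpow_le {p : ℝ} (hp : 2 < p) {ν g m : ℝ} (hν : 0 ≤ ν) (hg : 0 ≤ g) (hm : 0 ≤ m) :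
    ν * g ^ 2 * m ^ (p - 2) ≤ ν ^ (p / 2) * g ^ p + m ^ p := by
  set a := Real.sqrt ν * g with ha
  have ha0 : 0 ≤ a := by positivity
  have h1 : ν * g ^ 2 = a ^ 2 := by rw [ha, mul_pow, Real.sq_sqrt hν]
  have h2 : ν ^ (p / 2) * g ^ p = a ^ p := by
    rw [ha, Real.mul_rpow (by positivity) hg, Real.sqrt_eq_rpow, ← Real.rpow_mul hν]
    congr 2
    ring
  have h3 : ∀ b : ℝ, 0 ≤ b → b ^ 2 * b ^ (p - 2) = b ^ p := by
    intro b hb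
    rw [← Real.rpow_natCast, ← Real.rpow_add_of_nonneg hb (by norm_num) (by linarith)]
    norm_num
  rw [h1, h2]
  rcases le_total a m with h | h
  · calc a ^ 2 * m ^ (p - 2) ≤ m ^ 2 * m ^ (p - 2) := by gcongr
      _ = m ^ p := h3 m hm
      _ ≤ _ := le_add_of_nonneg_left (by positivity)
  · calc a ^ 2 * m ^ (p - 2) ≤ a ^ 2 * a ^ (p - 2) := by
          gcongr
      _ = a ^ p := h3 a ha0
      _ ≤ _ := le_add_of_nonneg_right (by positivity)

/-- Here m = |f|, y_j = |∂_j f|, g bounds the commutators and η² is the cutoff. Half of the good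
term η²∑y_j² is kept for the dissipation. Each cross term pairs y_j with at least one factor η and
takes at most η²y_j²/8; the normal derivative occurs in three of them, and 3/8 < 1/2. -/
lemma quadratic_absorption {K s η m g : ℝ} {y : Fin 3 → ℝ} (hK : 0 ≤ K) (hs : 0 < s)
    (hη : 0 ≤ η) (hη1 : η ≤ 1) (hm : 0 ≤ m) (hg : 0 ≤ g) (_ : ∀ j, 0 ≤ y j) :
    ∑ j, 4 * η * (m * y j) - η ^ 2 * ∑ j, y j ^ 2 + 1 / 2 * (η ^ 2 * ∑ j, y j ^ 2)
      + (4 * η * (m * (K * (g + m))) + η ^ 2 * ((1 + s) * (y 2 * (K * (g + m)))))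
      + η ^ 2 * (m * (K * (g + m + y 2)))
      ≤ (200 + 20 * K + 20 * (1 + s) ^ 2 * K ^ 2) * (m ^ 2 + g ^ 2) := by
  have hη2 : η ^ 2 ≤ 1 := pow_le_one₀ hη hη1
  have a : ∀ j, 4 * η * (m * y j) ≤ 1 / 8 * (η ^ 2 * y j ^ 2) + 32 * m ^ 2 := fun j => by
    nlinarith [sq_nonneg (η * y j - 16 * m)]
  have hgm : (g + m) ^ 2 ≤ 2 * (m ^ 2 + g ^ 2) := by nlinarith [sq_nonneg (g - m)]
  have b : η ^ 2 * ((1 + s) * (y 2 * (K * (g + m))))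
      ≤ 1 / 8 * (η ^ 2 * y 2 ^ 2) + 4 * ((1 + s) ^ 2 * K ^ 2) * (m ^ 2 + g ^ 2) := by
    have h1 : (1 + s) * (y 2 * (K * (g + m)))
        ≤ 1 / 8 * y 2 ^ 2 + 2 * ((1 + s) ^ 2 * K ^ 2) * (g + m) ^ 2 := by
      nlinarith [sq_nonneg (y 2 - 4 * ((1 + s) * K * (g + m)))]
    calc η ^ 2 * ((1 + s) * (y 2 * (K * (g + m))))
        ≤ η ^ 2 * (1 / 8 * y 2 ^ 2 + 2 * ((1 + s) ^ 2 * K ^ 2) * (g + m) ^ 2) := by gcongr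
      _ = 1 / 8 * (η ^ 2 * y 2 ^ 2) + η ^ 2 * (2 * ((1 + s) ^ 2 * K ^ 2) * (g + m) ^ 2) := by ring
      _ ≤ 1 / 8 * (η ^ 2 * y 2 ^ 2) + 1 * (2 * ((1 + s) ^ 2 * K ^ 2) * (2 * (m ^ 2 + g ^ 2))) := by
          gcongr
      _ = _ := by ring
  have c : η ^ 2 * (m * (K * (g + m + y 2)))
      ≤ 1 / 8 * (η ^ 2 * y 2 ^ 2) + 2 * K ^ 2 * m ^ 2 + 2 * K * (m ^ 2 + g ^ 2) := by
    have h1 : m * (K * y 2) ≤ 1 / 8 * y 2 ^ 2 + 2 * K ^ 2 * m ^ 2 := by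
      nlinarith [sq_nonneg (y 2 - 4 * (K * m))]
    have h2 : m * (K * (g + m)) ≤ 2 * K * (m ^ 2 + g ^ 2) := by
      have : m * (g + m) ≤ 2 * (m ^ 2 + g ^ 2) := by nlinarith [sq_nonneg (g - m)]
      nlinarith
    calc η ^ 2 * (m * (K * (g + m + y 2)))
        = η ^ 2 * (m * (K * y 2)) + η ^ 2 * (m * (K * (g + m))) := by ring
      _ ≤ η ^ 2 * (1 / 8 * y 2 ^ 2 + 2 * K ^ 2 * m ^ 2) + η ^ 2 * (2 * K * (m ^ 2 + g ^ 2)) := by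
          gcongr
      _ = 1 / 8 * (η ^ 2 * y 2 ^ 2) + η ^ 2 * (2 * K ^ 2 * m ^ 2)
          + η ^ 2 * (2 * K * (m ^ 2 + g ^ 2)) := by ring
      _ ≤ 1 / 8 * (η ^ 2 * y 2 ^ 2) + 1 * (2 * K ^ 2 * m ^ 2) + 1 * (2 * K * (m ^ 2 + g ^ 2)) := by
          gcongr
      _ = _ := by ring
  have d : 4 * η * (m * (K * (g + m))) ≤ 8 * K * (m ^ 2 + g ^ 2) := by
    have : m * (g + m) ≤ 2 * (m ^ 2 + g ^ 2) := by nlinarith [sq_nonneg (g - m)]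
    calc 4 * η * (m * (K * (g + m))) = 4 * η * (K * (m * (g + m))) := by ring
      _ ≤ 4 * 1 * (K * (2 * (m ^ 2 + g ^ 2))) := by gcongr
      _ = _ := by ring
  have e : K ^ 2 ≤ (1 + s) ^ 2 * K ^ 2 := by
    have : (1 : ℝ) ≤ (1 + s) ^ 2 := by nlinarith
    exact le_mul_of_one_le_left (sq_nonneg K) this
  have f : K ^ 2 * m ^ 2 ≤ (1 + s) ^ 2 * K ^ 2 * (m ^ 2 + g ^ 2) := by
    calc K ^ 2 * m ^ 2 ≤ ((1 + s) ^ 2 * K ^ 2) * (m ^ 2 + g ^ 2) := by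
          gcongr
          nlinarith [sq_nonneg g]
      _ = _ := by ring
  have hP : 0 ≤ (1 + s) ^ 2 * K ^ 2 * (m ^ 2 + g ^ 2) := by positivity
  have hQ : 0 ≤ K * (m ^ 2 + g ^ 2) := by positivity
  have q : ∀ j, 0 ≤ η ^ 2 * y j ^ 2 := fun j => by positivity
  simp only [Fin.sum_univ_three]
  have hr : (200 + 20 * K + 20 * (1 + s) ^ 2 * K ^ 2) * (m ^ 2 + g ^ 2)
      = 200 * m ^ 2 + 200 * g ^ 2 + 20 * (K * (m ^ 2 + g ^ 2))
        + 20 * ((1 + s) ^ 2 * K ^ 2 * (m ^ 2 + g ^ 2)) := by ring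
  rw [hr]
  linarith [a 0, a 1, a 2, q 0, q 1, q 2, sq_nonneg g, sq_nonneg m]

/-- The pointwise estimate behind the `L^p` energy inequality. -/
lemma exists_energy_density_bound {p νbar K : ℝ} (hp : 2 < p) (hν' : 0 ≤ νbar) (hK : 0 ≤ K) :
    ∃ C : ℝ, 0 ≤ C ∧ ∀ (ν : ℝ), 0 ≤ ν → ν ≤ νbar → ∀ (f A B r : E) (F : Fin 3 → E) (u : Fin 3 → ℝ)
      (η g : ℝ) (dχ : Fin 3 → ℝ), 0 ≤ η → η ≤ 1 → 0 ≤ g → (∀ j, |dχ j| ≤ 4 * η) →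
      (0 < ν → ‖A‖ ≤ K * (g + ‖f‖)) → (0 < ν → ‖B‖ ≤ K * (g + ‖f‖ + ‖F 2‖)) →
      (‖f‖ ^ p * ∑ j, u j * dχ j
        - ν * p * ∑ j, (dχ j * inner ℝ (powVec (p - 2) f) (F j)
            + η ^ 2 * inner ℝ (powVecDeriv (p - 2) f (F j)) (F j))
        - ν * p * (dχ 2 * inner ℝ (powVec (p - 2) f) A
            + η ^ 2 * inner ℝ (powVecDeriv (p - 2) f (F 2)) A)
        + ν * p * (η ^ 2 * inner ℝ (powVec (p - 2) f) B)
        + p * (η ^ 2 * inner ℝ (powVec (p - 2) f) r))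
        + ν * (p / 2) * (η ^ 2 * (‖f‖ ^ (p - 2) * ∑ j, ‖F j‖ ^ 2))
      ≤ C * (‖f‖ ^ p * (1 + ∑ j, |u j|)) + C * (ν ^ (p / 2) * g ^ p)
        + p * (‖f‖ ^ (p - 1) * ‖r‖) := by
  have hs : 0 < p - 2 := by linarith
  set C₁ := 200 + 20 * K + 20 * (1 + (p - 2)) ^ 2 * K ^ 2 with hC₁
  have hC₁0 : 0 ≤ C₁ := by positivity
  -- The 4 pays for the gradient of the cutoff in the convection term. The rest comes from Young's
  -- inequality, with ν|f|^p bounded by νbar |f|^p.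
  refine ⟨p * C₁ * (1 + νbar) + 4, by positivity, ?_⟩
  intro ν hν hνb f A B r F u η g dχ hη hη1 hg hχ hA hB
  set h := ‖f‖ ^ (p - 2) with hh
  set m := ‖f‖ with hm
  have hm0 : 0 ≤ m := norm_nonneg f
  have hh0 : 0 ≤ h := by positivity
  have hhm : h * m ^ 2 = m ^ p := by
    rw [hh, ← Real.rpow_natCast, ← Real.rpow_add_of_nonneg hm0 hs.le (by norm_num)]
    norm_num
  have hhm1 : h * m = m ^ (p - 1) := by
    rw [hh, ← Real.rpow_add_one' hm0 (by linarith)]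
    congr 1
    ring
  have hη2 : η ^ 2 ≤ 1 := pow_le_one₀ hη hη1
  have t1 : m ^ p * ∑ j, u j * dχ j ≤ 4 * (m ^ p * ∑ j, |u j|) := by
    have : ∑ j, u j * dχ j ≤ ∑ j, 4 * |u j| := by
      refine Finset.sum_le_sum fun j _ => ?_
      calc u j * dχ j ≤ |u j| * |dχ j| := by rw [← abs_mul]; exact le_abs_self _
        _ ≤ |u j| * (4 * 1) := by gcongr; exact (hχ j).trans (by gcongr)
        _ = _ := by ring
    rw [← Finset.mul_sum] at this
    calc m ^ p * ∑ j, u j * dχ j ≤ m ^ p * (4 * ∑ j, |u j|) := by gcongr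
      _ = _ := by ring
  have t5 : p * (η ^ 2 * inner ℝ (powVec (p - 2) f) r) ≤ p * (m ^ (p - 1) * ‖r‖) := by
    have h1 := (le_abs_self _).trans (abs_inner_powVec_le hs f r)
    rw [← hm, ← hh, hhm1] at h1
    refine mul_le_mul_of_nonneg_left ?_ (by linarith)
    calc η ^ 2 * inner ℝ (powVec (p - 2) f) r ≤ η ^ 2 * (m ^ (p - 1) * ‖r‖) := by gcongr
      _ ≤ 1 * (m ^ (p - 1) * ‖r‖) := by gcongr
      _ = _ := one_mul _
  have visc : - ν * p * ∑ j, (dχ j * inner ℝ (powVec (p - 2) f) (F j)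
            + η ^ 2 * inner ℝ (powVecDeriv (p - 2) f (F j)) (F j))
        - ν * p * (dχ 2 * inner ℝ (powVec (p - 2) f) A
            + η ^ 2 * inner ℝ (powVecDeriv (p - 2) f (F 2)) A)
        + ν * p * (η ^ 2 * inner ℝ (powVec (p - 2) f) B)
        + ν * (p / 2) * (η ^ 2 * (h * ∑ j, ‖F j‖ ^ 2)) ≤
      ν * p * (h * (C₁ * (m ^ 2 + g ^ 2))) := by
    -- For ν = 0 nothing is assumed on `A` and `B`, but every viscous term carries the factor ν.
    rcases hν.eq_or_lt with hν0 | hν0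
    · simp [← hν0]
    replace hA := hA hν0
    replace hB := hB hν0
    have b1 : ∀ j, -(dχ j * inner ℝ (powVec (p - 2) f) (F j)) ≤ h * (4 * η * (m * ‖F j‖)) := by
      intro j
      calc -(dχ j * inner ℝ (powVec (p - 2) f) (F j))
          ≤ |dχ j| * |inner ℝ (powVec (p - 2) f) (F j)| := by
            rw [← abs_mul]; exact neg_le_abs _
        _ ≤ (4 * η) * (h * m * ‖F j‖) := by
            gcongr
            · exact hχ j
            · exact abs_inner_powVec_le hs f (F j)
        _ = _ := by ring
    have b2 : ∀ j, -(η ^ 2 * inner ℝ (powVecDeriv (p - 2) f (F j)) (F j))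
        ≤ h * (-(η ^ 2 * ‖F j‖ ^ 2)) := by
      intro j
      have := le_inner_powVecDeriv hs f (F j)
      calc -(η ^ 2 * inner ℝ (powVecDeriv (p - 2) f (F j)) (F j))
          ≤ -(η ^ 2 * (h * ‖F j‖ ^ 2)) := by gcongr
        _ = _ := by ring
    have b3 : -(dχ 2 * inner ℝ (powVec (p - 2) f) A) ≤ h * (4 * η * (m * (K * (g + m)))) := by
      calc -(dχ 2 * inner ℝ (powVec (p - 2) f) A)
          ≤ |dχ 2| * |inner ℝ (powVec (p - 2) f) A| := by
            rw [← abs_mul]; exact neg_le_abs _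
        _ ≤ (4 * η) * (h * m * (K * (g + m))) := by
            gcongr
            · exact hχ 2
            · exact (abs_inner_powVec_le hs f A).trans (by gcongr)
        _ = _ := by ring
    have b4 : -(η ^ 2 * inner ℝ (powVecDeriv (p - 2) f (F 2)) A)
        ≤ h * (η ^ 2 * ((1 + (p - 2)) * (‖F 2‖ * (K * (g + m))))) := by
      have h1 : -inner ℝ (powVecDeriv (p - 2) f (F 2)) A
          ≤ (1 + (p - 2)) * (h * ‖F 2‖) * (K * (g + m)) :=
        ((neg_le_abs _).trans (abs_real_inner_le_norm _ _)).trans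
          (mul_le_mul (norm_powVecDeriv_le hs f (F 2)) hA (norm_nonneg _) (by positivity))
      calc -(η ^ 2 * inner ℝ (powVecDeriv (p - 2) f (F 2)) A)
          = η ^ 2 * -inner ℝ (powVecDeriv (p - 2) f (F 2)) A := by ring
        _ ≤ η ^ 2 * ((1 + (p - 2)) * (h * ‖F 2‖) * (K * (g + m))) := by gcongr
        _ = _ := by ring
    have b5 : η ^ 2 * inner ℝ (powVec (p - 2) f) B
        ≤ h * (η ^ 2 * (m * (K * (g + m + ‖F 2‖)))) := by
      have h1 : inner ℝ (powVec (p - 2) f) B ≤ h * m * (K * (g + m + ‖F 2‖)) :=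
        ((le_abs_self _).trans (abs_inner_powVec_le hs f B)).trans (by gcongr)
      calc η ^ 2 * inner ℝ (powVec (p - 2) f) B
          ≤ η ^ 2 * (h * m * (K * (g + m + ‖F 2‖))) := by gcongr
        _ = _ := by ring
    have key := quadratic_absorption (y := fun j => ‖F j‖) hK hs hη hη1 hm0 hg
      fun j => norm_nonneg (F j)
    have key2 := mul_le_mul_of_nonneg_left key hh0
    rw [← hC₁] at key2
    have tot : -∑ j, (dχ j * inner ℝ (powVec (p - 2) f) (F j)
            + η ^ 2 * inner ℝ (powVecDeriv (p - 2) f (F j)) (F j))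
        - (dχ 2 * inner ℝ (powVec (p - 2) f) A
            + η ^ 2 * inner ℝ (powVecDeriv (p - 2) f (F 2)) A)
        + (η ^ 2 * inner ℝ (powVec (p - 2) f) B)
        + (1 / 2) * (η ^ 2 * (h * ∑ j, ‖F j‖ ^ 2)) ≤ h * (C₁ * (m ^ 2 + g ^ 2)) := by
      refine le_trans ?_ key2
      simp only [Fin.sum_univ_three]
      linarith [b1 0, b1 1, b1 2, b2 0, b2 1, b2 2]
    have := mul_le_mul_of_nonneg_left tot (by positivity : 0 ≤ ν * p)
    refine le_trans (le_of_eq ?_) this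
    ring
  have young := mul_sq_mul_rpow_le hp hν hg hm0
  rw [← hh] at young
  have fin : ν * p * (h * (C₁ * (m ^ 2 + g ^ 2)))
      ≤ p * C₁ * (1 + νbar) * m ^ p + p * C₁ * (1 + νbar) * (ν ^ (p / 2) * g ^ p) := by
    have e1 : ν * p * (h * (C₁ * (m ^ 2 + g ^ 2))) = p * C₁ * (ν * m ^ p + ν * g ^ 2 * h) := by
      rw [← hhm]; ring
    rw [e1]
    have e2 : ν * m ^ p ≤ νbar * m ^ p := by gcongr
    have e3 : 0 ≤ νbar * (ν ^ (p / 2) * g ^ p) := by positivity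
    calc p * C₁ * (ν * m ^ p + ν * g ^ 2 * h)
        ≤ p * C₁ * (νbar * m ^ p + (ν ^ (p / 2) * g ^ p + m ^ p)
          + νbar * (ν ^ (p / 2) * g ^ p)) := by
          exact mul_le_mul_of_nonneg_left (by linarith) (by positivity)
      _ = _ := by ring
  have h4 : 0 ≤ p * C₁ * (1 + νbar) * (m ^ p * ∑ j, |u j|) := by
    have : 0 ≤ ∑ j, |u j| := Finset.sum_nonneg fun _ _ => abs_nonneg _
    positivity
  have h5 : 0 ≤ m ^ p := by positivity
  have h6 : 0 ≤ ν ^ (p / 2) * g ^ p := by positivity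
  have h7 : 0 ≤ p * C₁ * (1 + νbar) := by positivity
  have e1 : (p * C₁ * (1 + νbar) + 4) * (m ^ p * (1 + ∑ j, |u j|))
      = p * C₁ * (1 + νbar) * m ^ p + p * C₁ * (1 + νbar) * (m ^ p * ∑ j, |u j|)
        + 4 * m ^ p + 4 * (m ^ p * ∑ j, |u j|) := by ring
  have e2 : (p * C₁ * (1 + νbar) + 4) * (ν ^ (p / 2) * g ^ p)
      = p * C₁ * (1 + νbar) * (ν ^ (p / 2) * g ^ p) + 4 * (ν ^ (p / 2) * g ^ p) := by ring
  rw [e1, e2]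
  linarith [t1, t5, visc, fin]

end PowVec

end ConormalNS

namespace ConormalNS

/-! ### Partial derivatives, cutoff and integration by parts -/

/-- `G` is differentiable at `x` and its `j`-th partial derivative is `d`. -/
def HasPD {F : Type*} [NormedAddCommGroup F] [NormedSpace ℝ F] (j : Fin 3) (G : E3 → F) (d : F)
    (x : E3) : Prop :=
  ∃ L : E3 →L[ℝ] F, HasFDerivAt G L x ∧ L (basisVec j) = d

namespace HasPD

variable {F : Type*} [NormedAddCommGroup F] [NormedSpace ℝ F] {j : Fin 3} {x : E3}

lemma sub {G G' : E3 → F} {d d' : F} (h : HasPD j G d x) (h' : HasPD j G' d' x) :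
    HasPD j (fun y => G y - G' y) (d - d') x := by
  obtain ⟨L, hL, rfl⟩ := h
  obtain ⟨L', hL', rfl⟩ := h'
  exact ⟨_, hL.sub hL', rfl⟩

lemma const_mul {G : E3 → ℝ} {d : ℝ} (h : HasPD j G d x) (c : ℝ) :
    HasPD j (fun y => c * G y) (c * d) x := by
  obtain ⟨L, hL, rfl⟩ := h
  exact ⟨_, hL.const_mul c, rfl⟩

lemma mul {G G' : E3 → ℝ} {d d' : ℝ} (h : HasPD j G d x) (h' : HasPD j G' d' x) :
    HasPD j (fun y => G y * G' y) (d * G' x + G x * d') x := by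
  obtain ⟨L, hL, rfl⟩ := h
  obtain ⟨L', hL', rfl⟩ := h'
  refine ⟨_, hL.mul hL', ?_⟩
  simp
  ring

lemma inner {G G' : E3 → E3} {d d' : E3} (h : HasPD j G d x) (h' : HasPD j G' d' x) :
    HasPD j (fun y => inner ℝ (G y) (G' y)) (inner ℝ d (G' x) + inner ℝ (G x) d') x := by
  obtain ⟨L, hL, rfl⟩ := h
  obtain ⟨L', hL', rfl⟩ := h'
  refine ⟨_, hL.inner ℝ hL', ?_⟩
  simp [add_comm]

lemma powVec {G : E3 → E3} {d : E3} {s : ℝ} (hs : 0 < s) (h : HasPD j G d x) :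
    HasPD j (fun y => powVec s (G y)) (powVecDeriv s (G x) d) x := by
  obtain ⟨L, hL, rfl⟩ := h
  obtain ⟨L', hL', h'⟩ := hasFDerivAt_powVec hs (G x)
  exact ⟨_, hL'.comp x hL, by simp [h']⟩

lemma norm_rpow {G : E3 → E3} {d : E3} {p : ℝ} (hp : 2 < p) (h : HasPD j G d x) :
    HasPD j (fun y => ‖G y‖ ^ p) (p * Inner.inner ℝ (ConormalNS.powVec (p - 2) (G x)) d) x := by
  obtain ⟨L, hL, rfl⟩ := h
  refine ⟨_, (hasFDerivAt_norm_rpow (G x) (by linarith)).comp x hL, ?_⟩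
  simp [ConormalNS.powVec, inner_smul_left, mul_assoc]

lemma of_slice {T : ℝ} (hT : 0 < T) (g : Fin 3 → smoothRing T) {t : ℝ} (ht : t ∈ Icc 0 T)
    (hx : x ∈ halfSpace) (j : Fin 3) :
    HasPD j (slice g t) (slice (fun k => (slabRing hT).d j (g k)) t x) x := by
  obtain ⟨L, hL, h⟩ := hasFDerivAt_slice_vec hT g ht hx
  exact ⟨L, hL, h j⟩

lemma of_smooth {T : ℝ} (hT : 0 < T) (g : smoothRing T) {t : ℝ} (ht : t ∈ Icc 0 T)
    (hx : x ∈ halfSpace) (j : Fin 3) :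
    HasPD j (fun y => g.1 (t, y)) (((slabRing hT).d j g).1 (t, x)) x :=
  ⟨_, hasFDerivAt_slice g ht hx, rfl⟩

end HasPD

/-- Squaring removes the kink of the positive part. The cutoff is such a square, hence
differentiable, with gradient controlled by its own root. -/
lemma hasDerivAt_max_sq (s : ℝ) :
    HasDerivAt (fun s : ℝ => max 0 s ^ 2) (2 * max 0 s) s := by
  rcases lt_trichotomy s 0 with h | h | h
  · rw [max_eq_left h.le, mul_zero]
    refine (hasDerivAt_const s (0 : ℝ)).congr_of_eventuallyEq ?_
    filter_upwards [Iio_mem_nhds h] with r hr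
    simp [max_eq_left (mem_Iio.1 hr).le]
  · subst h
    simp only [max_self, mul_zero]
    rw [hasDerivAt_iff_isLittleO]
    have h1 : (fun r : ℝ => max 0 r ^ 2 - max 0 (0 : ℝ) ^ 2 - (r - 0) • (0 : ℝ))
        = fun r => max 0 r ^ 2 := by
      ext r
      simp
    rw [h1]
    refine Asymptotics.IsBigO.trans_isLittleO (g := fun r : ℝ => r ^ 2) ?_ ?_
    · refine Asymptotics.IsBigO.of_bound 1 (Filter.Eventually.of_forall fun r => ?_)
      rw [one_mul, norm_pow, norm_pow, Real.norm_eq_abs, Real.norm_eq_abs]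
      refine pow_le_pow_left₀ (abs_nonneg _) ?_ 2
      rw [abs_of_nonneg (le_max_left _ _)]
      exact max_le (abs_nonneg _) (le_abs_self _)
    · simpa using Asymptotics.isLittleO_pow_id (𝕜 := ℝ) one_lt_two
  · rw [max_eq_right h.le]
    have h1 : HasDerivAt (fun s : ℝ => s ^ 2) (2 * s) s := by simpa using hasDerivAt_pow 2 s
    refine h1.congr_of_eventuallyEq ?_
    filter_upwards [Ioi_mem_nhds h] with r hr
    simp [max_eq_right (mem_Ioi.1 hr).le]

/-- The square root `(1 - |x|² / n²)₊` of the cutoff function. -/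
noncomputable def cutoffRoot (n : ℕ) (x : E3) : ℝ := max 0 (1 - ‖x‖ ^ 2 / (n + 1 : ℝ) ^ 2)

/-- The `j`-th partial derivative of the square of `cutoffRoot n`. -/
noncomputable def cutoffDeriv (n : ℕ) (j : Fin 3) (x : E3) : ℝ :=
  -(4 / (n + 1 : ℝ) ^ 2) * (cutoffRoot n x * x j)

lemma cutoffRoot_nonneg (n : ℕ) (x : E3) : 0 ≤ cutoffRoot n x := le_max_left _ _

lemma cutoffRoot_le_one (n : ℕ) (x : E3) : cutoffRoot n x ≤ 1 :=
  max_le zero_le_one (sub_le_self _ (by positivity))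

lemma cutoffRoot_eq_zero {n : ℕ} {x : E3} (hx : (n + 1 : ℝ) ≤ ‖x‖) : cutoffRoot n x = 0 := by
  refine max_eq_left ?_
  rw [sub_nonpos, one_le_div (by positivity)]
  gcongr

lemma continuous_cutoffRoot (n : ℕ) : Continuous (cutoffRoot n) := by
  unfold cutoffRoot
  fun_prop

lemma continuous_cutoffDeriv (n : ℕ) (j : Fin 3) : Continuous (cutoffDeriv n j) := by
  unfold cutoffDeriv
  have := continuous_cutoffRoot n
  fun_prop

lemma cutoffDeriv_eq_zero {n : ℕ} {j : Fin 3} {x : E3} (hx : (n + 1 : ℝ) ≤ ‖x‖) :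
    cutoffDeriv n j x = 0 := by simp [cutoffDeriv, cutoffRoot_eq_zero hx]

lemma abs_apply_le_norm (x : E3) (j : Fin 3) : |x j| ≤ ‖x‖ := PiLp.norm_apply_le x j

/-- The factor η on the right lets the viscous cutoff terms be absorbed into η²|∇f|². No decay in n
is needed: the convective cutoff error |f|^p ∑|u_j| is itself an admissible source term. -/
lemma abs_cutoffDeriv_le (n : ℕ) (j : Fin 3) (x : E3) :
    |cutoffDeriv n j x| ≤ 4 * cutoffRoot n x := by
  rcases le_total (n + 1 : ℝ) ‖x‖ with h | h
  · rw [cutoffDeriv_eq_zero h, cutoffRoot_eq_zero h]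
    simp
  · rw [cutoffDeriv, abs_mul, abs_neg, abs_mul, abs_of_nonneg (cutoffRoot_nonneg n x),
      abs_of_nonneg (by positivity)]
    have h1 : |x j| ≤ (n + 1 : ℝ) ^ 2 := by
      have : (1 : ℝ) ≤ n + 1 := by simp
      exact (abs_apply_le_norm x j).trans (h.trans (by nlinarith))
    calc 4 / (n + 1 : ℝ) ^ 2 * (cutoffRoot n x * |x j|)
        ≤ 4 / (n + 1 : ℝ) ^ 2 * (cutoffRoot n x * (n + 1 : ℝ) ^ 2) := by
          have := cutoffRoot_nonneg n x
          gcongr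
      _ = _ := by field_simp

lemma hasPD_cutoff (n : ℕ) (j : Fin 3) (x : E3) :
    HasPD j (fun y => cutoffRoot n y ^ 2) (cutoffDeriv n j x) x := by
  have h1 : HasFDerivAt (fun y : E3 => 1 - ‖y‖ ^ 2 / (n + 1 : ℝ) ^ 2) _ x :=
    ((hasStrictFDerivAt_norm_sq x).hasFDerivAt.mul_const (((n + 1 : ℝ) ^ 2)⁻¹)).const_sub 1
  refine ⟨_, (hasDerivAt_max_sq _).comp_hasFDerivAt x h1, ?_⟩
  simp [cutoffDeriv, cutoffRoot, basisVec, EuclideanSpace.inner_single_right]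
  ring

lemma cutoffRoot_mono {n m : ℕ} (h : n ≤ m) (x : E3) : cutoffRoot n x ≤ cutoffRoot m x := by
  unfold cutoffRoot
  have : (n : ℝ) ≤ m := by exact_mod_cast h
  gcongr

lemma tendsto_cutoffRoot (x : E3) :
    Filter.Tendsto (fun n => cutoffRoot n x) Filter.atTop (nhds 1) := by
  have h1 : Filter.Tendsto (fun n : ℕ => ((n + 1 : ℝ) ^ 2)) Filter.atTop Filter.atTop :=
    (Filter.tendsto_pow_atTop two_ne_zero).comp
      (Filter.tendsto_atTop_add_const_right _ 1 tendsto_natCast_atTop_atTop)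
  have h2 := (h1.const_div_atTop (‖x‖ ^ 2)).const_sub 1
  have h3 := (tendsto_const_nhds (x := (0 : ℝ))).max h2
  simpa [cutoffRoot] using h3

/-- A compactly supported function on the closed half-space has a `j`-th partial derivative of
integral zero, provided it vanishes on the boundary if `j` is the normal direction. -/
lemma integral_pd_eq_zero {j : Fin 3} {G D : E3 → ℝ} {R : ℝ} (hR : 0 < R)
    (hG : ContinuousOn G closedHalfSpace) (hD : ContinuousOn D closedHalfSpace)
    (hGD : ∀ x ∈ halfSpace, HasPD j G (D x) x) (hGR : ∀ x, R ≤ ‖x‖ → G x = 0)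
    (hDR : ∀ x, R ≤ ‖x‖ → D x = 0) (hb : j = 2 → ∀ x : E3, x 2 = 0 → G x = 0) :
    ∫ x in halfSpace, D x = 0 := by
  classical
  -- The box has its bottom face on the wall; points on the other five faces have norm at least R,
  -- so `G` vanishes there.
  let a : Fin 3 → ℝ := fun i => if i = 2 then 0 else -R
  let b : Fin 3 → ℝ := fun _ => R
  have hle : a ≤ b := by
    intro i
    by_cases hi : i = 2 <;> simp [a, b, hi] <;> linarith
  let e := (PiLp.continuousLinearEquiv 2 ℝ (fun _ : Fin 3 => ℝ)).symm
  have he : ∀ y i, e y i = y i := fun _ _ => rfl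
  have hIcc : MapsTo e (Icc a b) closedHalfSpace := by
    intro y hy
    have := hy.1 2
    simpa [a, closedHalfSpace, he] using this
  let B := Set.pi univ fun i => Ioo (a i) (b i)
  have hB : ∀ y ∈ B, e y ∈ halfSpace := by
    intro y hy
    have := (hy 2 (mem_univ _)).1
    simpa [a, halfSpace, he] using this
  -- The divergence theorem is applied to the field whose only nonzero component is the j-th, equal
  -- to `G`.
  let f : Fin 3 → (Fin 3 → ℝ) → ℝ := fun i y => if i = j then G (e y) else 0
  have hfc : ∀ i, ContinuousOn (f i) (Icc a b) := by
    intro i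
    by_cases hi : i = j
    · simp only [f, hi, if_true]
      exact hG.comp e.continuous.continuousOn hIcc
    · simp only [f, hi, if_false]
      exact continuousOn_const
  have hdiff : ∀ y ∈ B, HasFDerivAt (fun y => G (e y)) (fderiv ℝ (fun y => G (e y)) y) y ∧
      fderiv ℝ (fun y => G (e y)) y (Pi.single j 1) = D (e y) := by
    intro y hy
    obtain ⟨L, hL, hLj⟩ := hGD (e y) (hB y hy)
    have h1 : HasFDerivAt (fun y => G (e y)) (L.comp (e : (Fin 3 → ℝ) →L[ℝ] E3)) y :=
      hL.comp y e.hasFDerivAt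
    rw [h1.fderiv]
    refine ⟨h1, ?_⟩
    rw [← hLj]
    rfl
  have hae : B =ᵐ[volume] Icc a b := Measure.univ_pi_Ioo_ae_eq_Icc
  have hsum : ∀ y ∈ B, ∑ i, (fun i y => fderiv ℝ (f i) y) i y (Pi.single i 1) = D (e y) := by
    intro y hy
    rw [Finset.sum_eq_single j]
    · simp only [f, if_true]
      exact (hdiff y hy).2
    · intro i _ hi
      simp [f, hi]
    · simp
  have hDc : ContinuousOn (fun y => D (e y)) (Icc a b) := hD.comp e.continuous.continuousOn hIcc
  have hBm : MeasurableSet B := MeasurableSet.univ_pi fun i => measurableSet_Ioo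
  have hint : IntegrableOn (fun y => D (e y)) (Icc a b) := hDc.integrableOn_compact isCompact_Icc
  have hint' : IntegrableOn
      (fun y => ∑ i, (fun i y => fderiv ℝ (f i) y) i y (Pi.single i 1)) (Icc a b) := by
    rw [← integrableOn_congr_set_ae hae] at hint ⊢
    exact hint.congr_fun (fun y hy => (hsum y hy).symm) hBm
  have key := integral_divergence_of_hasFDerivAt_off_countable' a b hle f
    (fun i y => fderiv ℝ (f i) y) ∅ countable_empty hfc (by
      intro y hy i
      by_cases hi : i = j
      · simp only [f, hi, if_true]
        exact (hdiff y hy.1).1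
      · simp only [f, hi, if_false]
        simpa using hasFDerivAt_const (0 : ℝ) y) hint'
  have hnorm : ∀ (y : Fin 3 → ℝ) (i : Fin 3), |y i| ≤ ‖e y‖ := fun y i => abs_apply_le_norm (e y) i
  have hfaces : ∀ i : Fin 3, (∫ x in Icc (a ∘ i.succAbove) (b ∘ i.succAbove),
        f i (i.insertNth (b i) x)) -
      ∫ x in Icc (a ∘ i.succAbove) (b ∘ i.succAbove), f i (i.insertNth (a i) x) = 0 := by
    intro i
    by_cases hi : i = j
    · subst hi
      have h1 : ∀ x, f i (i.insertNth (b i) x) = 0 := by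
        intro x
        simp only [f, if_true]
        refine hGR _ (le_trans ?_ (hnorm _ i))
        simp only [Fin.insertNth_apply_same, b]
        exact le_abs_self R
      have h2 : ∀ x, f i (i.insertNth (a i) x) = 0 := by
        intro x
        simp only [f, if_true]
        by_cases hi2 : i = 2
        · refine hb hi2 _ ?_
          subst hi2
          rw [he, Fin.insertNth_apply_same]
          simp [a]
        · refine hGR _ (le_trans ?_ (hnorm _ i))
          simp only [Fin.insertNth_apply_same, a, hi2, if_false, abs_neg]
          exact le_abs_self R
      simp [h1, h2]
    · simp [f, hi]
  have key2 : ∫ y in B, D (e y) = 0 := by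
    rw [← setIntegral_congr_fun hBm hsum, setIntegral_congr_set hae, key]
    exact Finset.sum_eq_zero fun i _ => hfaces i
  have hmp := (PiLp.volume_preserving_toLp (Fin 3))
  have h3 : ∫ x in halfSpace, D x = ∫ y in e ⁻¹' halfSpace, D (e y) :=
    (hmp.setIntegral_preimage_emb (MeasurableEquiv.toLp 2 (Fin 3 → ℝ)).measurableEmbedding D
      halfSpace).symm
  rw [h3, ← key2]
  symm
  have hm : MeasurableSet (e ⁻¹' halfSpace) :=
    (isOpen_halfSpace.preimage e.continuous).measurableSet
  refine (setIntegral_eq_of_subset_of_forall_sdiff_eq_zero hm hB ?_).symm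
  intro y hy
  refine hDR _ ?_
  by_contra! hlt
  refine hy.2 fun i _ => ?_
  have h4 := (hnorm y i).trans_lt hlt
  rw [abs_lt] at h4
  refine ⟨?_, h4.2⟩
  by_cases hi : i = 2
  · have : (0 : ℝ) < y 2 := hy.1
    simp [a, hi, this]
  · simp [a, hi, h4.1]

end ConormalNS

namespace ConormalNS

/-! ### The `L^p` energy inequality -/

/-- `f` solves `∂ₜ f + U·∇f = ν (Δf + ∂_z A + B) + r` with `U` divergence free and tangent to the
boundary, and the flux `∂_z f + A` is orthogonal to `f` on the boundary. -/
structure IsTransportDiffusion {T : ℝ} (hT : 0 < T) (ν K : ℝ) (f A B r U : Fin 3 → smoothRing T)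
    (g : ℝ × E3 → ℝ) : Prop where
  eq : ∀ k, (slabRing hT).dt (f k) = ν • (∑ j, (slabRing hT).d j ((slabRing hT).d j (f k))
    + (slabRing hT).d 2 (A k) + B k) - ∑ j, U j * (slabRing hT).d j (f k) + r k
  div : ∑ j, (slabRing hT).d j (U j) = 0
  tangent : VanishesAtBoundary (U 2)
  flux : 0 < ν → VanishesAtBoundary (∑ k, f k * ((slabRing hT).d 2 (f k) + A k))
  g_nonneg : ∀ y, 0 ≤ g y
  bound_A : 0 < ν → ∀ y, ‖slice A y.1 y.2‖ ≤ K * (g y + ‖slice f y.1 y.2‖)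
  bound_B : 0 < ν → ∀ y, ‖slice B y.1 y.2‖ ≤ K * (g y + ‖slice f y.1 y.2‖
    + ‖slice (fun k => (slabRing hT).d 2 (f k)) y.1 y.2‖)

lemma continuousOn_slice_prod {T : ℝ} (g : Fin 3 → smoothRing T) :
    ContinuousOn (fun y : ℝ × E3 => slice g y.1 y.2) (slab T) := by
  have h : ContinuousOn (fun (y : ℝ × E3) (k : Fin 3) => (g k).1 y) (slab T) :=
    continuousOn_pi.2 fun k => continuousOn_of_smooth (g k)
  exact (PiLp.continuous_toLp 2 (fun _ : Fin 3 => ℝ)).comp_continuousOn h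

lemma continuousOn_slice {T : ℝ} (g : Fin 3 → smoothRing T) {t : ℝ} (ht : t ∈ Icc 0 T) :
    ContinuousOn (slice g t) closedHalfSpace :=
  (continuousOn_slice_prod g).comp (f := fun x : E3 => (t, x)) (by fun_prop) fun _ hx => ⟨ht, hx⟩

lemma continuousOn_apply {T : ℝ} (g : smoothRing T) {t : ℝ} (ht : t ∈ Icc 0 T) :
    ContinuousOn (fun x => g.1 (t, x)) closedHalfSpace :=
  (continuousOn_of_smooth g).comp (f := fun x : E3 => (t, x)) (by fun_prop) fun _ hx => ⟨ht, hx⟩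

/-- No integrability or measurability is required, since the Bochner integral of a non-integrable
function is zero. The source terms may therefore have infinite integral. -/
lemma ofReal_integral_le {α : Type*} [MeasurableSpace α] {m : Measure α} (f : α → ℝ) :
    ENNReal.ofReal (∫ x, f x ∂m) ≤ ∫⁻ x, ENNReal.ofReal (f x) ∂m := by
  by_cases hf : Integrable f m
  · rw [integral_eq_lintegral_pos_part_sub_lintegral_neg_part hf]
    exact (ENNReal.ofReal_le_ofReal (sub_le_self _ ENNReal.toReal_nonneg)).trans
      ENNReal.ofReal_toReal_le
  · simp [integral_undef hf]

lemma integrableOn_halfSpace {W : E3 → ℝ} {R : ℝ} (hW : ContinuousOn W closedHalfSpace)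
    (hR : ∀ x, R ≤ ‖x‖ → W x = 0) : IntegrableOn W halfSpace := by
  have h1 : IntegrableOn W (closedHalfSpace ∩ Metric.closedBall 0 R) :=
    (hW.mono inter_subset_left).integrableOn_compact
      ((isCompact_closedBall 0 R).inter_left isClosed_closedHalfSpace)
  have h2 : IntegrableOn W closedHalfSpace := by
    refine h1.of_forall_sdiff_eq_zero isClosed_closedHalfSpace.measurableSet ?_
    intro x hx
    refine hR x ?_
    by_contra! h
    exact hx.2 ⟨hx.1, by simpa using h.le⟩
  exact h2.mono_set halfSpace_subset

instance : SFinite vol := inferInstanceAs (SFinite (volume.restrict halfSpace))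

lemma prod_restrict_eq (t : ℝ) : ((volume : Measure ℝ).restrict (Icc 0 t)).prod vol
    = (volume : Measure (ℝ × E3)).restrict (Icc 0 t ×ˢ halfSpace) := by
  rw [vol, Measure.prod_restrict]
  rfl

lemma integrable_prod {T t : ℝ} (ht : t ≤ T) {W : ℝ × E3 → ℝ} {R : ℝ}
    (hW : ContinuousOn W (slab T)) (hR : ∀ y : ℝ × E3, R ≤ ‖y.2‖ → W y = 0) :
    Integrable W (((volume : Measure ℝ).restrict (Icc 0 t)).prod vol) := by
  rw [prod_restrict_eq]
  change IntegrableOn W _ _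
  have hsub : Icc 0 t ×ˢ closedHalfSpace ⊆ slab T := prod_mono (Icc_subset_Icc_right ht) le_rfl
  have h1 : IntegrableOn W (Icc 0 t ×ˢ (closedHalfSpace ∩ Metric.closedBall 0 R)) :=
    (hW.mono ((prod_mono le_rfl inter_subset_left).trans hsub)).integrableOn_compact
      (isCompact_Icc.prod ((isCompact_closedBall 0 R).inter_left isClosed_closedHalfSpace))
  have h2 : IntegrableOn W (Icc 0 t ×ˢ closedHalfSpace) := by
    refine h1.of_forall_sdiff_eq_zero
      (measurableSet_Icc.prod isClosed_closedHalfSpace.measurableSet) ?_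
    intro y hy
    refine hR y ?_
    by_contra! h
    exact hy.2 ⟨hy.1.1, hy.1.2, by simpa using h.le⟩
  exact h2.mono_set (prod_mono le_rfl halfSpace_subset)

lemma aemeasurable_prod {T t : ℝ} (ht : t ≤ T) {W : ℝ × E3 → ℝ} (hW : ContinuousOn W (slab T)) :
    AEMeasurable W (((volume : Measure ℝ).restrict (Icc 0 t)).prod vol) := by
  rw [prod_restrict_eq]
  exact (hW.mono (prod_mono (Icc_subset_Icc_right ht) halfSpace_subset)).aemeasurable
    (measurableSet_Icc.prod measurableSet_halfSpace)

section

variable {T : ℝ} {hT : 0 < T} {ν K p : ℝ} {f A B r U : Fin 3 → smoothRing T} {g : ℝ × E3 → ℝ}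

lemma slice_dt_eq (h : IsTransportDiffusion hT ν K f A B r U g) (s : ℝ) (x : E3) :
    slice (fun k => (slabRing hT).dt (f k)) s x
      = ν • (∑ j, slice (fun k => (slabRing hT).d j ((slabRing hT).d j (f k))) s x
          + slice (fun k => (slabRing hT).d 2 (A k)) s x + slice B s x)
        - ∑ j, (U j).1 (s, x) • slice (fun k => (slabRing hT).d j (f k)) s x + slice r s x := by
  ext k
  have h1 := congrArg (evalAt (s, x)) (h.eq k)
  simp only [map_add, map_sub, map_smul, map_sum, map_mul, evalAt_apply, smul_eq_mul] at h1
  simp only [slice_apply, PiLp.add_apply, PiLp.sub_apply, PiLp.smul_apply, Fin.sum_univ_three,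
    smul_eq_mul] at h1 ⊢
  exact h1

lemma div_apply (h : IsTransportDiffusion hT ν K f A B r U g) (y : ℝ × E3) :
    ∑ j, ((slabRing hT).d j (U j)).1 y = 0 := by
  have h1 := congrArg (evalAt y) h.div
  simpa only [map_sum, evalAt_apply, map_zero] using h1

/-- The time derivative of the localized energy density. -/
noncomputable def energyRate (hT : 0 < T) (p : ℝ) (f : Fin 3 → smoothRing T) (n : ℕ)
    (y : ℝ × E3) : ℝ :=
  p * (cutoffRoot n y.2 ^ 2 * inner ℝ (powVec (p - 2) (slice f y.1 y.2))
    (slice (fun k => (slabRing hT).dt (f k)) y.1 y.2))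

/-- The density `|f|^(p-2) |∇f|²`. -/
noncomputable def dissipation (hT : 0 < T) (p : ℝ) (f : Fin 3 → smoothRing T) (y : ℝ × E3) : ℝ :=
  ‖slice f y.1 y.2‖ ^ (p - 2) * ∑ j, ‖slice (fun k => (slabRing hT).d j (f k)) y.1 y.2‖ ^ 2

/-- The right-hand side of the pointwise energy estimate. -/
noncomputable def energySource (p C ν : ℝ) (f r U : Fin 3 → smoothRing T) (g : ℝ × E3 → ℝ)
    (y : ℝ × E3) : ℝ :=
  C * (‖slice f y.1 y.2‖ ^ p * (1 + ∑ j, |(U j).1 y|)) + C * (ν ^ (p / 2) * g y ^ p)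
    + p * (‖slice f y.1 y.2‖ ^ (p - 1) * ‖slice r y.1 y.2‖)

lemma continuousOn_energyRate (hp : 2 < p) (n : ℕ) :
    ContinuousOn (energyRate hT p f n) (slab T) := by
  have h1 : Continuous fun y : ℝ × E3 => cutoffRoot n y.2 ^ 2 :=
    ((continuous_cutoffRoot n).comp continuous_snd).pow 2
  have h2 : Continuous (powVec (p - 2) : E3 → E3) :=
    continuous_powVec_of_neg_one_lt (by linarith)
  exact continuousOn_const.mul (h1.continuousOn.mul
    ((h2.comp_continuousOn (continuousOn_slice_prod f)).inner (continuousOn_slice_prod _)))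

lemma energyRate_eq_zero {n : ℕ} {y : ℝ × E3} (hy : (n + 1 : ℝ) ≤ ‖y.2‖) :
    energyRate hT p f n y = 0 := by simp [energyRate, cutoffRoot_eq_zero hy]

lemma dissipation_nonneg (y : ℝ × E3) : 0 ≤ dissipation hT p f y :=
  mul_nonneg (by positivity) (Finset.sum_nonneg fun _ _ => by positivity)

lemma continuousOn_dissipation (hp : 2 < p) : ContinuousOn (dissipation hT p f) (slab T) := by
  refine ContinuousOn.mul ?_ ?_
  · exact (continuousOn_slice_prod f).norm.rpow_const fun _ _ => Or.inr (by linarith)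
  · exact continuousOn_finsetSum _ fun j _ => ((continuousOn_slice_prod _).norm).pow 2

/-- The localized flux. -/
noncomputable def localFlux (hT : 0 < T) (ν p : ℝ) (f A U : Fin 3 → smoothRing T) (n : ℕ) (s : ℝ)
    (j : Fin 3) (x : E3) : ℝ :=
  (U j).1 (s, x) * (‖slice f s x‖ ^ p * cutoffRoot n x ^ 2)
    - ν * p * (cutoffRoot n x ^ 2 * inner ℝ (powVec (p - 2) (slice f s x))
        (slice (fun k => (slabRing hT).d j (f k)) s x))
    - (if j = 2 then ν * p else 0) *
        (cutoffRoot n x ^ 2 * inner ℝ (powVec (p - 2) (slice f s x)) (slice A s x))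

/-- The `j`-th partial derivative of the `j`-th component of the localized flux. -/
noncomputable def localFluxDeriv (hT : 0 < T) (ν p : ℝ) (f A U : Fin 3 → smoothRing T) (n : ℕ)
    (s : ℝ) (j : Fin 3) (x : E3) : ℝ :=
  (((slabRing hT).d j (U j)).1 (s, x) * (‖slice f s x‖ ^ p * cutoffRoot n x ^ 2)
      + (U j).1 (s, x) * (p * inner ℝ (powVec (p - 2) (slice f s x))
          (slice (fun k => (slabRing hT).d j (f k)) s x) * cutoffRoot n x ^ 2
        + ‖slice f s x‖ ^ p * cutoffDeriv n j x))
    - ν * p * (cutoffDeriv n j x * inner ℝ (powVec (p - 2) (slice f s x))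
          (slice (fun k => (slabRing hT).d j (f k)) s x)
      + cutoffRoot n x ^ 2 *
        (inner ℝ (powVecDeriv (p - 2) (slice f s x) (slice (fun k => (slabRing hT).d j (f k)) s x))
          (slice (fun k => (slabRing hT).d j (f k)) s x)
        + inner ℝ (powVec (p - 2) (slice f s x))
          (slice (fun k => (slabRing hT).d j ((slabRing hT).d j (f k))) s x)))
    - (if j = 2 then ν * p else 0) *
      (cutoffDeriv n j x * inner ℝ (powVec (p - 2) (slice f s x)) (slice A s x)
      + cutoffRoot n x ^ 2 *
        (inner ℝ (powVecDeriv (p - 2) (slice f s x) (slice (fun k => (slabRing hT).d j (f k)) s x))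
          (slice A s x)
        + inner ℝ (powVec (p - 2) (slice f s x)) (slice (fun k => (slabRing hT).d j (A k)) s x)))

lemma continuousOn_localFlux (hp : 2 < p) {s : ℝ} (hs : s ∈ Icc 0 T) (n : ℕ) (j : Fin 3) :
    ContinuousOn (localFlux hT ν p f A U n s j) closedHalfSpace := by
  have cf : ContinuousOn (slice f s) closedHalfSpace := continuousOn_slice f hs
  have cF : ContinuousOn (slice (fun k => (slabRing hT).d j (f k)) s) closedHalfSpace :=
    continuousOn_slice _ hs
  have cA : ContinuousOn (slice A s) closedHalfSpace := continuousOn_slice _ hs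
  have cφ : ContinuousOn (fun x => powVec (p - 2) (slice f s x)) closedHalfSpace :=
    (continuous_powVec_of_neg_one_lt (by linarith)).comp_continuousOn cf
  have cχ : ContinuousOn (fun x => cutoffRoot n x ^ 2) closedHalfSpace :=
    ((continuous_cutoffRoot n).pow 2).continuousOn
  have cn : ContinuousOn (fun x => ‖slice f s x‖ ^ p) closedHalfSpace :=
    cf.norm.rpow_const fun _ _ => Or.inr (by linarith)
  have cU : ContinuousOn (fun x => (U j).1 (s, x)) closedHalfSpace := continuousOn_apply _ hs
  exact ((cU.mul (cn.mul cχ)).sub (continuousOn_const.mul (cχ.mul (cφ.inner cF)))).sub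
      (continuousOn_const.mul (cχ.mul (cφ.inner cA)))

lemma continuousOn_localFluxDeriv (hp : 2 < p) {s : ℝ} (hs : s ∈ Icc 0 T) (n : ℕ) (j : Fin 3) :
    ContinuousOn (localFluxDeriv hT ν p f A U n s j) closedHalfSpace := by
  have cf : ContinuousOn (slice f s) closedHalfSpace := continuousOn_slice f hs
  have cF : ContinuousOn (slice (fun k => (slabRing hT).d j (f k)) s) closedHalfSpace :=
    continuousOn_slice _ hs
  have cF2 : ContinuousOn (slice (fun k => (slabRing hT).d j ((slabRing hT).d j (f k))) s)
      closedHalfSpace := continuousOn_slice _ hs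
  have cA : ContinuousOn (slice A s) closedHalfSpace := continuousOn_slice _ hs
  have cdA : ContinuousOn (slice (fun k => (slabRing hT).d j (A k)) s) closedHalfSpace :=
    continuousOn_slice _ hs
  have cφ : ContinuousOn (fun x => powVec (p - 2) (slice f s x)) closedHalfSpace :=
    (continuous_powVec_of_neg_one_lt (by linarith)).comp_continuousOn cf
  have cdφ : ContinuousOn (fun x => powVecDeriv (p - 2) (slice f s x)
      (slice (fun k => (slabRing hT).d j (f k)) s x)) closedHalfSpace := by
    have := (continuous_powVecDeriv (E := E3) (by linarith : 0 < p - 2)).comp_continuousOn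
      (cf.prodMk cF)
    exact this
  have cχ : ContinuousOn (fun x => cutoffRoot n x ^ 2) closedHalfSpace :=
    ((continuous_cutoffRoot n).pow 2).continuousOn
  have cdχ : ContinuousOn (cutoffDeriv n j) closedHalfSpace :=
    (continuous_cutoffDeriv n j).continuousOn
  have cn : ContinuousOn (fun x => ‖slice f s x‖ ^ p) closedHalfSpace :=
    cf.norm.rpow_const fun _ _ => Or.inr (by linarith)
  have cU : ContinuousOn (fun x => (U j).1 (s, x)) closedHalfSpace := continuousOn_apply _ hs
  have cdU : ContinuousOn (fun x => ((slabRing hT).d j (U j)).1 (s, x)) closedHalfSpace :=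
    continuousOn_apply _ hs
  unfold localFluxDeriv
  refine ContinuousOn.sub (ContinuousOn.sub (ContinuousOn.add (cdU.mul (cn.mul cχ)) (cU.mul
    (((continuousOn_const.mul (cφ.inner cF)).mul cχ).add (cn.mul cdχ)))) ?_) ?_
  · exact continuousOn_const.mul ((cdχ.mul (cφ.inner cF)).add
        (cχ.mul ((cdφ.inner cF).add (cφ.inner cF2))))
  · exact continuousOn_const.mul ((cdχ.mul (cφ.inner cA)).add
        (cχ.mul ((cdφ.inner cA).add (cφ.inner cdA))))

lemma hasPD_localFlux (hp : 2 < p) {s : ℝ} (hs : s ∈ Icc 0 T) (n : ℕ) (j : Fin 3) {x : E3}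
    (hx : x ∈ halfSpace) :
    HasPD j (localFlux hT ν p f A U n s j) (localFluxDeriv hT ν p f A U n s j x) x := by
  have pf := HasPD.of_slice hT f hs hx j
  have pφ := pf.powVec (by linarith : 0 < p - 2)
  have pF := HasPD.of_slice hT (fun k => (slabRing hT).d j (f k)) hs hx j
  have pA := HasPD.of_slice hT A hs hx j
  have pn := pf.norm_rpow hp
  have pχ := hasPD_cutoff n j x
  have pU := HasPD.of_smooth hT (U j) hs hx j
  exact ((pU.mul (pn.mul pχ)).sub ((pχ.mul (pφ.inner pF)).const_mul (ν * p))).sub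
    ((pχ.mul (pφ.inner pA)).const_mul (if j = 2 then ν * p else 0))

/-- Tangency of U removes the convective flux. The viscous flux is a multiple of |f|^{p-2} f·(∂_z f
+ A), which vanishes by the orthogonality in `IsTransportDiffusion`. -/
lemma localFlux_boundary (h : IsTransportDiffusion hT ν K f A B r U g) (hν : 0 ≤ ν) {s : ℝ}
    (hs : s ∈ Icc 0 T) (n : ℕ) {x : E3} (hx : x 2 = 0) : localFlux hT ν p f A U n s 2 x = 0 := by
  have h1 := h.tangent s hs x hx
  simp only [localFlux, h1, if_true]
  rcases hν.eq_or_lt with h0 | h0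
  · simp [← h0]
  · have h2 := h.flux h0 s hs x hx
    have h3 : inner ℝ (slice f s x)
        (slice (fun k => (slabRing hT).d 2 (f k)) s x + slice A s x) = 0 := by
      refine Eq.trans ?_ h2
      simp [PiLp.inner_apply, slice_apply, mul_comm]
    have h4 : inner ℝ (powVec (p - 2) (slice f s x)) (slice (fun k => (slabRing hT).d 2 (f k)) s x)
        + inner ℝ (powVec (p - 2) (slice f s x)) (slice A s x) = 0 := by
      rw [← inner_add_right]
      simp only [powVec, inner_smul_left, h3, mul_zero]
    linear_combination (-(ν * p * cutoffRoot n x ^ 2)) * h4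

lemma localFluxDeriv_eq_zero {s : ℝ} {n : ℕ} {j : Fin 3} {x : E3} (hx : (n + 1 : ℝ) ≤ ‖x‖) :
    localFluxDeriv hT ν p f A U n s j x = 0 := by
  simp only [localFluxDeriv, cutoffRoot_eq_zero hx, cutoffDeriv_eq_zero hx]
  ring

lemma localFlux_eq_zero {s : ℝ} {n : ℕ} {j : Fin 3} {x : E3} (hx : (n + 1 : ℝ) ≤ ‖x‖) :
    localFlux hT ν p f A U n s j x = 0 := by
  simp only [localFlux, cutoffRoot_eq_zero hx]
  ring

lemma integral_localFluxDeriv (hp : 2 < p) (h : IsTransportDiffusion hT ν K f A B r U g)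
    (hν : 0 ≤ ν) {s : ℝ} (hs : s ∈ Icc 0 T) (n : ℕ) (j : Fin 3) :
    ∫ x in halfSpace, localFluxDeriv hT ν p f A U n s j x = 0 :=
  integral_pd_eq_zero (R := n + 1) (by positivity) (continuousOn_localFlux hp hs n j)
    (continuousOn_localFluxDeriv hp hs n j) (fun _ hx => hasPD_localFlux hp hs n j hx)
    (fun _ hx => localFlux_eq_zero hx) (fun _ hx => localFluxDeriv_eq_zero hx)
    (by rintro rfl x hx; exact localFlux_boundary h hν hs n hx)

/-- Integration by parts done pointwise: adding the divergence of the flux cancels the second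
derivatives of f, the derivative of A and the transport term. What remains is exactly the expression
bounded by `EnergyDensityBound`; div U = 0 is the only relation used besides the equation. -/
lemma energyRate_add_sum_localFluxDeriv (h : IsTransportDiffusion hT ν K f A B r U g) (s : ℝ)
    (n : ℕ) (x : E3) :
    energyRate hT p f n (s, x) + ∑ j, localFluxDeriv hT ν p f A U n s j x
      = ‖slice f s x‖ ^ p * ∑ j, (U j).1 (s, x) * cutoffDeriv n j x
        - ν * p * ∑ j, (cutoffDeriv n j x * inner ℝ (powVec (p - 2) (slice f s x))
              (slice (fun k => (slabRing hT).d j (f k)) s x)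
            + cutoffRoot n x ^ 2 * inner ℝ (powVecDeriv (p - 2) (slice f s x)
                (slice (fun k => (slabRing hT).d j (f k)) s x))
              (slice (fun k => (slabRing hT).d j (f k)) s x))
        - ν * p * (cutoffDeriv n 2 x * inner ℝ (powVec (p - 2) (slice f s x)) (slice A s x)
            + cutoffRoot n x ^ 2 * inner ℝ (powVecDeriv (p - 2) (slice f s x)
              (slice (fun k => (slabRing hT).d 2 (f k)) s x)) (slice A s x))
        + ν * p * (cutoffRoot n x ^ 2 * inner ℝ (powVec (p - 2) (slice f s x)) (slice B s x))
        + p * (cutoffRoot n x ^ 2 * inner ℝ (powVec (p - 2) (slice f s x)) (slice r s x)) := by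
  have hdiv := div_apply h (s, x)
  have hdt := slice_dt_eq h s x
  rw [energyRate, hdt]
  simp only [localFluxDeriv, inner_add_right, inner_sub_right, inner_smul_right,
    Fin.sum_univ_three, Fin.reduceEq, if_true, if_false] at hdiv ⊢
  linear_combination (‖slice f s x‖ ^ p * cutoffRoot n x ^ 2) * hdiv

/-- The constants for which the pointwise energy estimate holds. -/
def EnergyDensityBound (p νbar K C : ℝ) : Prop :=
  ∀ (ν : ℝ), 0 ≤ ν → ν ≤ νbar → ∀ (f A B r : E3) (F : Fin 3 → E3) (u : Fin 3 → ℝ)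
      (η g : ℝ) (dχ : Fin 3 → ℝ), 0 ≤ η → η ≤ 1 → 0 ≤ g → (∀ j, |dχ j| ≤ 4 * η) →
      (0 < ν → ‖A‖ ≤ K * (g + ‖f‖)) → (0 < ν → ‖B‖ ≤ K * (g + ‖f‖ + ‖F 2‖)) →
      (‖f‖ ^ p * ∑ j, u j * dχ j
        - ν * p * ∑ j, (dχ j * inner ℝ (powVec (p - 2) f) (F j)
            + η ^ 2 * inner ℝ (powVecDeriv (p - 2) f (F j)) (F j))
        - ν * p * (dχ 2 * inner ℝ (powVec (p - 2) f) A
            + η ^ 2 * inner ℝ (powVecDeriv (p - 2) f (F 2)) A)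
        + ν * p * (η ^ 2 * inner ℝ (powVec (p - 2) f) B)
        + p * (η ^ 2 * inner ℝ (powVec (p - 2) f) r))
        + ν * (p / 2) * (η ^ 2 * (‖f‖ ^ (p - 2) * ∑ j, ‖F j‖ ^ 2))
      ≤ C * (‖f‖ ^ p * (1 + ∑ j, |u j|)) + C * (ν ^ (p / 2) * g ^ p)
        + p * (‖f‖ ^ (p - 1) * ‖r‖)

lemma integrableOn_energyRate_add (hp : 2 < p) {s : ℝ} (hs : s ∈ Icc 0 T) (n : ℕ) :
    IntegrableOn (fun x => energyRate hT p f n (s, x)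
        + ν * (p / 2) * (cutoffRoot n x ^ 2 * dissipation hT p f (s, x))) halfSpace := by
  have hm : MapsTo (fun x : E3 => (s, x)) closedHalfSpace (slab T) := fun x hx => ⟨hs, hx⟩
  have cχ : ContinuousOn (fun x => cutoffRoot n x ^ 2) closedHalfSpace :=
    ((continuous_cutoffRoot n).pow 2).continuousOn
  have h1 : ContinuousOn (fun x => energyRate hT p f n (s, x)) closedHalfSpace :=
    (continuousOn_energyRate hp n).comp (f := fun x : E3 => (s, x)) (by fun_prop) hm
  have h2 : ContinuousOn (fun x => dissipation hT p f (s, x)) closedHalfSpace :=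
    (continuousOn_dissipation hp).comp (f := fun x : E3 => (s, x)) (by fun_prop) hm
  have h3 : ContinuousOn (fun x => energyRate hT p f n (s, x)
      + ν * (p / 2) * (cutoffRoot n x ^ 2 * dissipation hT p f (s, x))) closedHalfSpace := by
    have h4 := continuousOn_const (c := ν * (p / 2)).mul (cχ.mul h2)
    exact h1.add h4
  refine integrableOn_halfSpace (R := n + 1) h3 fun x hx => ?_
  rw [energyRate_eq_zero (y := (s, x)) hx, cutoffRoot_eq_zero hx]
  ring

lemma integral_energyRate_le (hp : 2 < p) (h : IsTransportDiffusion hT ν K f A B r U g) {C νbar : ℝ}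
    (hν : 0 ≤ ν) (hνb : ν ≤ νbar) (hC : EnergyDensityBound p νbar K C)
    {s : ℝ} (hs : s ∈ Icc 0 T) (n : ℕ) :
    ENNReal.ofReal (∫ x in halfSpace, (energyRate hT p f n (s, x)
        + ν * (p / 2) * (cutoffRoot n x ^ 2 * dissipation hT p f (s, x))))
      ≤ ∫⁻ x in halfSpace, ENNReal.ofReal (energySource p C ν f r U g (s, x)) := by
  have hDint : ∀ j, IntegrableOn (localFluxDeriv hT ν p f A U n s j) halfSpace := fun j =>
    integrableOn_halfSpace (continuousOn_localFluxDeriv hp hs n j)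
      fun x hx => localFluxDeriv_eq_zero hx
  have e1 : ∫ x in halfSpace, (energyRate hT p f n (s, x)
        + ν * (p / 2) * (cutoffRoot n x ^ 2 * dissipation hT p f (s, x)))
      = ∫ x in halfSpace, ((energyRate hT p f n (s, x)
        + ν * (p / 2) * (cutoffRoot n x ^ 2 * dissipation hT p f (s, x)))
        + ∑ j, localFluxDeriv hT ν p f A U n s j x) := by
    rw [integral_add (integrableOn_energyRate_add hp hs n)
      (integrable_finsetSum _ fun j _ => hDint j),
      integral_finsetSum _ fun j _ => hDint j]
    simp [integral_localFluxDeriv hp h hν hs n]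
  rw [e1]
  refine (ofReal_integral_le _).trans (lintegral_mono fun x => ENNReal.ofReal_le_ofReal ?_)
  have hb := hC ν hν hνb (slice f s x) (slice A s x) (slice B s x) (slice r s x)
    (fun j => slice (fun k => (slabRing hT).d j (f k)) s x)
    (fun j => (U j).1 (s, x)) (cutoffRoot n x) (g (s, x)) (fun j => cutoffDeriv n j x)
    (cutoffRoot_nonneg n x) (cutoffRoot_le_one n x) (h.g_nonneg _)
    (fun j => abs_cutoffDeriv_le n j x) (fun h0 => h.bound_A h0 (s, x))
    (fun h0 => h.bound_B h0 (s, x))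
  refine le_trans (le_of_eq ?_) hb
  rw [← energyRate_add_sum_localFluxDeriv h s n x, dissipation]
  ring

/-- The localized energy inequality. -/
lemma localized_energy_inequality (hp : 2 < p) (h : IsTransportDiffusion hT ν K f A B r U g)
    {C νbar : ℝ} (hν : 0 ≤ ν) (hνb : ν ≤ νbar) (hC : EnergyDensityBound p νbar K C)
    {t : ℝ} (ht : t ∈ Icc 0 T) (n : ℕ) :
    ∫⁻ x, ENNReal.ofReal (cutoffRoot n x ^ 2 * ‖slice f t x‖ ^ p) ∂vol
      + ENNReal.ofReal (ν * (p / 2)) * ∫⁻ y, ENNReal.ofReal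
          (cutoffRoot n y.2 ^ 2 * dissipation hT p f y) ∂((volume.restrict (Icc 0 t)).prod vol)
      ≤ ∫⁻ x, ENNReal.ofReal (‖slice f 0 x‖ ^ p) ∂vol
        + ∫⁻ s in Icc 0 t, ∫⁻ x, ENNReal.ofReal (energySource p C ν f r U g (s, x)) ∂vol := by
  have h0 : (0 : ℝ) ∈ Icc 0 T := left_mem_Icc.2 hT.le
  have hsub : Icc 0 t ⊆ Icc 0 T := Icc_subset_Icc_right ht.2
  have cχ : Continuous fun y : ℝ × E3 => cutoffRoot n y.2 ^ 2 :=
    ((continuous_cutoffRoot n).comp continuous_snd).pow 2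
  have cχ' : Continuous fun y : E3 => cutoffRoot n y ^ 2 := (continuous_cutoffRoot n).pow 2
  have iX : Integrable (energyRate hT p f n) ((volume.restrict (Icc 0 t)).prod vol) :=
    integrable_prod ht.2 (continuousOn_energyRate hp n) fun y hy => energyRate_eq_zero hy
  have iD : Integrable (fun y : ℝ × E3 => cutoffRoot n y.2 ^ 2 * dissipation hT p f y)
      ((volume.restrict (Icc 0 t)).prod vol) :=
    integrable_prod (R := n + 1) ht.2 (cχ.continuousOn.mul (continuousOn_dissipation hp))
      fun y hy => by simp [cutoffRoot_eq_zero hy]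
  have iE : ∀ s ∈ Icc 0 T,
      Integrable (fun x => cutoffRoot n x ^ 2 * ‖slice f s x‖ ^ p) vol := fun s hs =>
    integrableOn_halfSpace (R := n + 1) (cχ'.continuousOn.mul
      ((continuousOn_slice f hs).norm.rpow_const fun _ _ => Or.inr (by linarith)))
      fun y hy => by simp [cutoffRoot_eq_zero hy]
  -- The energy is differentiated in time for fixed x only. Fubini's theorem, available because the
  -- cutoff gives compact support in x, then replaces differentiation under the integral sign.
  have ftc : ∀ x ∈ halfSpace, ∫ s in Icc 0 t, energyRate hT p f n (s, x)
      = cutoffRoot n x ^ 2 * ‖slice f t x‖ ^ p - cutoffRoot n x ^ 2 * ‖slice f 0 x‖ ^ p := by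
    intro x hx
    have hxc := halfSpace_subset hx
    have hm : MapsTo (fun s : ℝ => (s, x)) (Icc 0 t) (slab T) := fun s hs => ⟨hsub hs, hxc⟩
    have c1 : ContinuousOn (fun s => slice f s x) (Icc 0 t) :=
      (continuousOn_slice_prod f).comp (f := fun s : ℝ => (s, x)) (by fun_prop) hm
    have c2 : ContinuousOn (fun s => energyRate hT p f n (s, x)) (Icc 0 t) :=
      (continuousOn_energyRate hp n).comp (f := fun s : ℝ => (s, x)) (by fun_prop) hm
    rw [integral_Icc_eq_integral_Ioc, ← intervalIntegral.integral_of_le ht.1]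
    refine intervalIntegral.integral_eq_sub_of_hasDerivAt_of_le ht.1
      (f := fun s => cutoffRoot n x ^ 2 * ‖slice f s x‖ ^ p)
      (continuousOn_const.mul (c1.norm.rpow_const fun _ _ => Or.inr (by linarith))) ?_
      (c2.intervalIntegrable_of_Icc ht.1)
    intro s hs
    have hs' : s ∈ Ioo 0 T := ⟨hs.1, hs.2.trans_le ht.2⟩
    have d1 : HasDerivAt (fun s => slice f s x)
        (slice (fun k => (slabRing hT).dt (f k)) s x) s := by
      have : HasFDerivAt (fun s => slice f s x) ((PiLp.continuousLinearEquiv 2 ℝ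
          (fun _ : Fin 3 => ℝ)).symm.toContinuousLinearMap.comp (ContinuousLinearMap.pi fun k =>
          ContinuousLinearMap.toSpanSingleton ℝ
            (((slabRing hT).dt (f k)).1 (s, x)))) s := by
        rw [← hasFDerivWithinAt_univ, hasFDerivWithinAt_euclidean]
        intro k
        rw [hasFDerivWithinAt_univ]
        exact (hasDerivAt_time hT (f k) hs' hxc).hasFDerivAt
      convert this.hasDerivAt using 1
      ext k
      exact (one_smul ℝ _).symm
    have d2 := ((hasFDerivAt_norm_rpow (slice f s x) (by linarith : 1 < p)).comp_hasDerivAt s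
      d1).const_mul (cutoffRoot n x ^ 2)
    refine d2.congr_deriv ?_
    simp only [energyRate, powVec, inner_smul_left, smul_apply, innerSL_apply_apply, smul_eq_mul,
      conj_trivial]
    ring
  have swap : ∫ s in Icc 0 t, ∫ x, energyRate hT p f n (s, x) ∂vol
      = ∫ x, cutoffRoot n x ^ 2 * ‖slice f t x‖ ^ p ∂vol
        - ∫ x, cutoffRoot n x ^ 2 * ‖slice f 0 x‖ ^ p ∂vol := by
    rw [integral_integral_swap (f := fun s x => energyRate hT p f n (s, x)) iX,
      ← integral_sub (iE t ht) (iE 0 h0)]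
    exact setIntegral_congr_fun measurableSet_halfSpace ftc
  have nnE : ∀ (s : ℝ) (x : E3), 0 ≤ cutoffRoot n x ^ 2 * ‖slice f s x‖ ^ p := fun s x => by
    positivity
  have nnD : ∀ y : ℝ × E3, 0 ≤ cutoffRoot n y.2 ^ 2 * dissipation hT p f y := fun y =>
    mul_nonneg (by positivity) (dissipation_nonneg y)
  have tot : ENNReal.ofReal (∫ x, cutoffRoot n x ^ 2 * ‖slice f t x‖ ^ p ∂vol
        - ∫ x, cutoffRoot n x ^ 2 * ‖slice f 0 x‖ ^ p ∂vol
        + ν * (p / 2) * ∫ y, cutoffRoot n y.2 ^ 2 * dissipation hT p f y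
            ∂((volume.restrict (Icc 0 t)).prod vol))
      ≤ ∫⁻ s in Icc 0 t, ∫⁻ x, ENNReal.ofReal (energySource p C ν f r U g (s, x)) ∂vol := by
    have e : ∫ x, cutoffRoot n x ^ 2 * ‖slice f t x‖ ^ p ∂vol
        - ∫ x, cutoffRoot n x ^ 2 * ‖slice f 0 x‖ ^ p ∂vol
        + ν * (p / 2) * ∫ y, cutoffRoot n y.2 ^ 2 * dissipation hT p f y
            ∂((volume.restrict (Icc 0 t)).prod vol)
        = ∫ s in Icc 0 t, ∫ x, (energyRate hT p f n (s, x)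
          + ν * (p / 2) * (cutoffRoot n x ^ 2 * dissipation hT p f (s, x))) ∂vol := by
      rw [← swap, ← integral_const_mul]
      have i2 := iD.const_mul (ν * (p / 2))
      rw [integral_prod _ i2, ← integral_add iX.integral_prod_left i2.integral_prod_left]
      refine setIntegral_congr_fun measurableSet_Icc fun s hs => ?_
      have c1 : ContinuousOn (fun x => energyRate hT p f n (s, x)) closedHalfSpace :=
        (continuousOn_energyRate hp n).comp (f := fun x : E3 => (s, x)) (by fun_prop)
          fun x hx => ⟨hsub hs, hx⟩
      have c2 : ContinuousOn (fun x => dissipation hT p f (s, x)) closedHalfSpace :=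
        (continuousOn_dissipation hp).comp (f := fun x : E3 => (s, x)) (by fun_prop)
          fun x hx => ⟨hsub hs, hx⟩
      exact (integral_add (integrableOn_halfSpace (R := n + 1) c1 fun x hx => energyRate_eq_zero hx)
        (integrableOn_halfSpace (R := n + 1) (continuousOn_const.mul (cχ'.continuousOn.mul c2))
          fun x hx => by simp [cutoffRoot_eq_zero hx])).symm
    rw [e]
    refine (ofReal_integral_le _).trans (setLIntegral_mono' measurableSet_Icc fun s hs => ?_)
    exact integral_energyRate_le hp h hν hνb hC (hsub hs) n
  have hp0 : 0 ≤ ν * (p / 2) := mul_nonneg hν (by linarith)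
  rw [← ofReal_integral_eq_lintegral_ofReal (iE t ht) (ae_of_all _ (nnE t)),
    ← ofReal_integral_eq_lintegral_ofReal iD (ae_of_all _ nnD), ← ENNReal.ofReal_mul hp0,
    ← ENNReal.ofReal_add (integral_nonneg (nnE t)) (mul_nonneg hp0 (integral_nonneg nnD))]
  have le0 : ENNReal.ofReal (∫ x, cutoffRoot n x ^ 2 * ‖slice f 0 x‖ ^ p ∂vol)
      ≤ ∫⁻ x, ENNReal.ofReal (‖slice f 0 x‖ ^ p) ∂vol := by
    refine (ofReal_integral_le _).trans (lintegral_mono fun x => ENNReal.ofReal_le_ofReal ?_)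
    exact mul_le_of_le_one_left (by positivity)
      (pow_le_one₀ (cutoffRoot_nonneg n x) (cutoffRoot_le_one n x))
  refine le_trans ?_ (add_le_add le0 tot)
  refine le_trans (ENNReal.ofReal_le_ofReal (le_of_eq ?_)) ENNReal.ofReal_add_le
  ring

end

end ConormalNS

namespace ConormalNS

/-! ### Removal of the cutoff -/

section

variable {T : ℝ} {hT : 0 < T} {ν K p : ℝ} {f A B r U : Fin 3 → smoothRing T} {g : ℝ × E3 → ℝ}

/-- The cutoffs increase with n, so monotone convergence applies even when the limit is infinite. -/
lemma tendsto_lintegral_cutoff {α : Type*} [MeasurableSpace α] {m : Measure α} {W : α → ℝ}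
    {X : α → E3} (hX : Measurable X) (hW : AEMeasurable W m) (hW0 : ∀ a, 0 ≤ W a) :
    Filter.Tendsto (fun n : ℕ => ∫⁻ a, ENNReal.ofReal (cutoffRoot n (X a) ^ 2 * W a) ∂m)
      Filter.atTop (nhds (∫⁻ a, ENNReal.ofReal (W a) ∂m)) := by
  refine lintegral_tendsto_of_tendsto_of_monotone ?_ ?_ ?_
  · intro n
    exact ((((continuous_cutoffRoot n).pow 2).measurable.comp hX).aemeasurable.mul hW).ennreal_ofReal
  · refine ae_of_all _ fun a i j hij => ENNReal.ofReal_le_ofReal ?_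
    exact mul_le_mul_of_nonneg_right
      (pow_le_pow_left₀ (cutoffRoot_nonneg _ _) (cutoffRoot_mono hij _) 2) (hW0 a)
  · refine ae_of_all _ fun a => ENNReal.tendsto_ofReal ?_
    simpa using ((tendsto_cutoffRoot (X a)).pow 2).mul_const (W a)

/-- The energy inequality. -/
lemma energy_inequality (hp : 2 < p) (h : IsTransportDiffusion hT ν K f A B r U g)
    {C νbar : ℝ} (hν : 0 ≤ ν) (hνb : ν ≤ νbar) (hC : EnergyDensityBound p νbar K C)
    {t : ℝ} (ht : t ∈ Icc 0 T) :
    ∫⁻ x, ENNReal.ofReal (‖slice f t x‖ ^ p) ∂vol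
      + ENNReal.ofReal (ν * (p / 2)) * ∫⁻ s in Icc 0 t, ∫⁻ x, ENNReal.ofReal
          (dissipation hT p f (s, x)) ∂vol
      ≤ ∫⁻ x, ENNReal.ofReal (‖slice f 0 x‖ ^ p) ∂vol
        + ∫⁻ s in Icc 0 t, ∫⁻ x, ENNReal.ofReal (energySource p C ν f r U g (s, x)) ∂vol := by
  have m1 : AEMeasurable (fun x => ‖slice f t x‖ ^ p) vol :=
    (((continuousOn_slice f ht).norm.rpow_const fun _ _ => Or.inr (by linarith)).mono
      halfSpace_subset).aemeasurable measurableSet_halfSpace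
  have m2 := aemeasurable_prod ht.2 (continuousOn_dissipation (hT := hT) (f := f) hp)
  have t1 := tendsto_lintegral_cutoff measurable_id m1 fun x => by positivity
  have t2 := tendsto_lintegral_cutoff measurable_snd m2 fun y => dissipation_nonneg y
  rw [lintegral_prod _ m2.ennreal_ofReal] at t2
  exact le_of_tendsto' (t1.add (ENNReal.Tendsto.const_mul t2 (Or.inr ENNReal.ofReal_ne_top)))
    fun n => localized_energy_inequality hp h hν hνb hC ht n

end

/-! ### Norms on slices -/

lemma lintegral_vol_congr {F G : E3 → ℝ≥0∞} (h : EqOn F G halfSpace) :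
    ∫⁻ x, F x ∂vol = ∫⁻ x, G x ∂vol := setLIntegral_congr_fun measurableSet_halfSpace h

lemma lintegral_vol_mono {F G : E3 → ℝ≥0∞} (h : ∀ x ∈ halfSpace, F x ≤ G x) :
    ∫⁻ x, F x ∂vol ≤ ∫⁻ x, G x ∂vol := setLIntegral_mono' measurableSet_halfSpace h

lemma conormalNorm_rpow {T : ℝ} (hT : 0 < T) {p : ℝ} (hp : 2 < p) {V : E3 → E3}
    {g : Fin 3 → smoothRing T} {t : ℝ} (ht : t ∈ Icc 0 T) (hV : EqOn V (slice g t) halfSpace)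
    (m : ℕ) :
    conormalNorm m p V ^ p = ∑ α ∈ multiIndices m,
      ∫⁻ x, ENNReal.ofReal (‖slice (fun k => (slabRing hT).Zpow α (g k)) t x‖ ^ p) ∂vol := by
  have hp0 : (0 : ℝ) < p := by linarith
  rw [conormalNorm, ← ENNReal.rpow_mul, one_div_mul_cancel hp0.ne', ENNReal.rpow_one]
  refine Finset.sum_congr rfl fun α _ => ?_
  rw [eLpNorm_eq_lintegral_rpow_enorm_toReal (by simpa using hp0) ENNReal.ofReal_ne_top,
    ENNReal.toReal_ofReal hp0.le, ← ENNReal.rpow_mul, one_div_mul_cancel hp0.ne', ENNReal.rpow_one]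
  refine lintegral_vol_congr fun x hx => ?_
  rw [conormalDeriv_eqOn_slice hT ht hV α hx, ← ofReal_norm,
    ENNReal.ofReal_rpow_of_nonneg (norm_nonneg _) hp0.le]

/-- For a continuous function the essential supremum bounds every value: the set where it is
exceeded is open, and nonempty open sets have positive measure. -/
lemma enorm_le_eLpNorm_top {F : Type*} [NormedAddCommGroup F] {V : E3 → F}
    (hV : ContinuousOn V halfSpace) {x : E3} (hx : x ∈ halfSpace) : ‖V x‖ₑ ≤ eLpNorm V ∞ vol := by
  by_contra! hlt
  rw [eLpNorm_exponent_top] at hlt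
  have h1 : ∀ᵐ y ∂vol, ‖V y‖ₑ ≤ eLpNormEssSup V vol := enorm_ae_le_eLpNormEssSup V vol
  have hopen : IsOpen (halfSpace ∩ (fun y => ‖V y‖ₑ) ⁻¹' Ioi (eLpNormEssSup V vol)) :=
    hV.enorm.isOpen_inter_preimage isOpen_halfSpace isOpen_Ioi
  have h2 : 0 < volume (halfSpace ∩ (fun y => ‖V y‖ₑ) ⁻¹' Ioi (eLpNormEssSup V vol)) :=
    hopen.measure_pos volume ⟨x, hx, hlt⟩
  rw [vol, ae_restrict_iff' measurableSet_halfSpace] at h1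
  refine h2.ne' (measure_mono_null ?_ h1)
  intro y hy hy2
  exact absurd (hy2 hy.1) (not_le.2 hy.2)

lemma enorm_slice_le {T : ℝ} {V : E3 → E3} {g : Fin 3 → smoothRing T} {t : ℝ}
    (ht : t ∈ Icc 0 T) (hV : EqOn V (slice g t) halfSpace) {x : E3} (hx : x ∈ halfSpace) :
    ENNReal.ofReal ‖slice g t x‖ ≤ eLpNorm V ∞ vol := by
  rw [ofReal_norm, ← hV hx]
  exact enorm_le_eLpNorm_top (((continuousOn_slice g ht).mono halfSpace_subset).congr hV) hx

/-! ### Hardy's inequality in the normal direction -/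

/-- The dilation `(x₁, x₂, z) ↦ (x₁, x₂, c z)`. -/
noncomputable def scaleZ (c : ℝ) : E3 →ₗ[ℝ] E3 :=
  Matrix.toEuclideanLin (Matrix.diagonal fun i : Fin 3 => if i = 2 then c else 1)

lemma scaleZ_apply (c : ℝ) (x : E3) (i : Fin 3) : scaleZ c x i = (if i = 2 then c else 1) * x i := by
  simp [scaleZ, Matrix.mulVec_diagonal]

lemma scaleZ_eq (c : ℝ) (x : E3) : scaleZ c x = x + ((c - 1) * x 2) • basisVec 2 := by
  ext i
  rw [scaleZ_apply]
  by_cases hi : i = 2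
  · subst hi; simp [basisVec]; ring
  · simp [hi, basisVec]

lemma det_scaleZ (c : ℝ) : LinearMap.det (scaleZ c) = c := by
  change LinearMap.det (Matrix.toLpLin 2 2 _) = c
  rw [Matrix.toLpLin_eq_toLin, LinearMap.det_toLin, Matrix.det_diagonal]
  simp

lemma scaleZ_mem {c : ℝ} (hc : 0 < c) {x : E3} : scaleZ c x ∈ halfSpace ↔ x ∈ halfSpace := by
  simp only [halfSpace, mem_ofPred_eq, scaleZ_apply, if_true]
  exact mul_pos_iff_of_pos_left hc

lemma continuous_scaleZ (c : ℝ) : Continuous (scaleZ c) := LinearMap.continuous_of_finiteDimensional _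

lemma map_scaleZ_vol {c : ℝ} (hc : 0 < c) :
    Measure.map (scaleZ c) vol = ENNReal.ofReal c⁻¹ • vol := by
  have h1 : vol = volume.restrict (scaleZ c ⁻¹' halfSpace) := by
    rw [vol]
    congr 1
    ext x
    exact (scaleZ_mem hc).symm
  have h2 : LinearMap.det (scaleZ c) ≠ 0 := by rw [det_scaleZ]; exact hc.ne'
  conv_lhs => rw [h1]
  rw [← Measure.restrict_map (continuous_scaleZ c).measurable measurableSet_halfSpace,
    Measure.map_linearMap_addHaar_eq_smul_addHaar volume h2, det_scaleZ, Measure.restrict_smul,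
    abs_of_pos (inv_pos.2 hc)]
  rfl

lemma lintegral_scaleZ {c : ℝ} (hc : 0 < c) {W : E3 → ℝ≥0∞} (hW : AEMeasurable W vol) :
    ∫⁻ x, W (scaleZ c x) ∂vol = ENNReal.ofReal c⁻¹ * ∫⁻ x, W x ∂vol := by
  have hW' : AEMeasurable W (Measure.map (scaleZ c) vol) := by
    rw [map_scaleZ_vol hc]
    exact hW.smul_measure _
  rw [← lintegral_map' hW' (continuous_scaleZ c).measurable.aemeasurable, map_scaleZ_vol hc,
    lintegral_smul_measure, smul_eq_mul]

/-- Jensen's inequality on an interval of length one, obtained from Hölder's inequality against the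
constant 1. -/
lemma rpow_lintegral_Ioc_le {p : ℝ} (hp : 1 < p) {W : ℝ → ℝ≥0∞}
    (hW : AEMeasurable W (volume.restrict (Ioc 0 1))) :
    (∫⁻ τ in Ioc (0 : ℝ) 1, W τ) ^ p ≤ ∫⁻ τ in Ioc (0 : ℝ) 1, W τ ^ p := by
  have hpq : p.HolderConjugate (p / (p - 1)) := Real.HolderConjugate.conjExponent hp
  have h1 := ENNReal.lintegral_mul_le_Lp_mul_Lq (volume.restrict (Ioc (0 : ℝ) 1)) hpq hW
    (aemeasurable_const (b := (1 : ℝ≥0∞)))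
  have h2 : ∫⁻ τ in Ioc (0 : ℝ) 1, W τ ≤ (∫⁻ τ in Ioc (0 : ℝ) 1, W τ ^ p) ^ (1 / p) := by
    simpa using h1
  calc (∫⁻ τ in Ioc (0 : ℝ) 1, W τ) ^ p
      ≤ ((∫⁻ τ in Ioc (0 : ℝ) 1, W τ ^ p) ^ (1 / p)) ^ p :=
        ENNReal.rpow_le_rpow h2 (by linarith)
    _ = _ := by rw [← ENNReal.rpow_mul, one_div_mul_cancel (by linarith), ENNReal.rpow_one]

/-- A function vanishing on the boundary is controlled by an average of its normal derivative. -/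
lemma abs_div_le_lintegral {T : ℝ} (hT : 0 < T) {f : smoothRing T} (hf : VanishesAtBoundary f)
    {s : ℝ} (hs : s ∈ Icc 0 T) {x : E3} (hx : x ∈ halfSpace) :
    ENNReal.ofReal (|f.1 (s, x)| / x 2) ≤ ∫⁻ τ in Ioc (0 : ℝ) 1,
      ENNReal.ofReal (2 * τ * |((slabRing hT).d 2 f).1 (s, scaleZ (τ ^ 2) x)|) := by
  have hz : (0 : ℝ) < x 2 := hx
  have hmem : ∀ τ : ℝ, scaleZ (τ ^ 2) x ∈ closedHalfSpace := by
    intro τ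
    simp only [closedHalfSpace, mem_ofPred_eq, scaleZ_apply, if_true]
    positivity
  have hcont : Continuous fun τ : ℝ => scaleZ (τ ^ 2) x := by
    simp only [scaleZ_eq]
    fun_prop
  have c1 : Continuous fun τ : ℝ => f.1 (s, scaleZ (τ ^ 2) x) := by
    have := (continuousOn_apply f hs).comp_continuous hcont hmem
    exact this
  have c2 : Continuous fun τ : ℝ => ((slabRing hT).d 2 f).1 (s, scaleZ (τ ^ 2) x) := by
    have := (continuousOn_apply ((slabRing hT).d 2 f) hs).comp_continuous hcont hmem
    exact this
  have c3 : Continuous fun τ : ℝ => 2 * τ * ((slabRing hT).d 2 f).1 (s, scaleZ (τ ^ 2) x) :=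
    (continuous_const.mul continuous_id).mul c2
  have hderiv : ∀ τ ∈ Ioo (0 : ℝ) 1, HasDerivAt (fun τ : ℝ => f.1 (s, scaleZ (τ ^ 2) x))
      (x 2 * (2 * τ * ((slabRing hT).d 2 f).1 (s, scaleZ (τ ^ 2) x))) τ := by
    intro τ hτ
    have h1 : scaleZ (τ ^ 2) x ∈ halfSpace := (scaleZ_mem (pow_pos hτ.1 2)).2 hx
    have h2 : HasDerivAt (fun τ : ℝ => scaleZ (τ ^ 2) x) ((2 * τ * x 2) • basisVec 2) τ := by
      simp only [scaleZ_eq]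
      have : HasDerivAt (fun τ : ℝ => (τ ^ 2 - 1) * x 2) (2 * τ * x 2) τ := by
        simpa using ((hasDerivAt_pow 2 τ).sub_const 1).mul_const (x 2)
      exact (this.smul_const (basisVec 2)).const_add x
    have h3 := (hasFDerivAt_slice f hs h1).comp_hasDerivAt τ h2
    refine h3.congr_deriv ?_
    rw [map_smul]
    change (2 * τ * x 2) * ((slabRing hT).d 2 f).1 (s, scaleZ (τ ^ 2) x) = _
    ring
  have h0 : f.1 (s, scaleZ (0 ^ 2) x) = 0 := hf s hs _ (by simp [scaleZ_apply])
  have h1 : scaleZ (1 ^ 2) x = x := by simp [scaleZ_eq]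
  -- The segment to the wall is parametrized by τ²z rather than τz: the weight 2τ gained in this way
  -- compensates the Jacobian of the dilation in Hardy's inequality.
  have ftc := intervalIntegral.integral_eq_sub_of_hasDerivAt_of_le zero_le_one
    (f := fun τ : ℝ => f.1 (s, scaleZ (τ ^ 2) x)) c1.continuousOn hderiv
    ((continuous_const.mul c3).intervalIntegrable 0 1)
  rw [intervalIntegral.integral_const_mul] at ftc
  simp only [h0, h1, sub_zero] at ftc
  rw [← ftc, abs_mul, abs_of_pos hz, mul_div_cancel_left₀ _ hz.ne',
    intervalIntegral.integral_of_le zero_le_one, ← Real.norm_eq_abs]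
  calc ENNReal.ofReal ‖∫ τ in Ioc (0 : ℝ) 1, 2 * τ * ((slabRing hT).d 2 f).1 (s, scaleZ (τ ^ 2) x)‖
      ≤ ∫⁻ τ in Ioc (0 : ℝ) 1, ‖2 * τ * ((slabRing hT).d 2 f).1 (s, scaleZ (τ ^ 2) x)‖ₑ := by
        rw [ofReal_norm]
        exact enorm_integral_le_lintegral_enorm _
    _ = _ := by
        refine setLIntegral_congr_fun measurableSet_Ioc fun τ hτ => ?_
        have hτ0 : (0 : ℝ) < τ := hτ.1
        beta_reduce
        rw [← ofReal_norm, norm_mul, Real.norm_of_nonneg (by positivity),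
          Real.norm_eq_abs]

/-- Hardy's inequality. -/
lemma hardy_inequality {T : ℝ} (hT : 0 < T) {p : ℝ} (hp : 2 < p) {f : smoothRing T}
    (hf : VanishesAtBoundary f) {s : ℝ} (hs : s ∈ Icc 0 T) :
    ∫⁻ x, ENNReal.ofReal ((|f.1 (s, x)| / x 2) ^ p) ∂vol
      ≤ ENNReal.ofReal (2 ^ p) *
        ∫⁻ x, ENNReal.ofReal (|((slabRing hT).d 2 f).1 (s, x)| ^ p) ∂vol := by
  have hp0 : 0 < p := by linarith
  set D : E3 → ℝ := fun x => |((slabRing hT).d 2 f).1 (s, x)| with hD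
  have cD : ContinuousOn D closedHalfSpace := (continuousOn_apply _ hs).abs
  let N : ℝ → E3 → ℝ≥0∞ := fun τ x => ENNReal.ofReal (2 * τ * D (scaleZ (τ ^ 2) x))
  have hmeas : AEMeasurable (fun y : ℝ × E3 => N y.1 y.2)
      ((volume.restrict (Ioc (0 : ℝ) 1)).prod vol) := by
    have h1 : ContinuousOn (fun y : ℝ × E3 => 2 * y.1 * D (scaleZ (y.1 ^ 2) y.2))
        (Ioc 0 1 ×ˢ halfSpace) := by
      have h2 : Continuous fun y : ℝ × E3 => scaleZ (y.1 ^ 2) y.2 := by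
        simp only [scaleZ_eq]
        fun_prop
      have h3 : ContinuousOn (fun y : ℝ × E3 => D (scaleZ (y.1 ^ 2) y.2))
          (Ioc 0 1 ×ˢ halfSpace) := by
        have := cD.comp h2.continuousOn (s := Ioc 0 1 ×ˢ halfSpace) (fun y hy =>
          halfSpace_subset ((scaleZ_mem (pow_pos hy.1.1 2)).2 hy.2))
        exact this
      have h4 : ContinuousOn (fun y : ℝ × E3 => 2 * y.1) (Ioc 0 1 ×ˢ halfSpace) := by fun_prop
      exact h4.mul h3
    have h5 := h1.aemeasurable (μ := volume) (measurableSet_Ioc.prod measurableSet_halfSpace)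
    rw [vol, Measure.prod_restrict]
    exact h5.ennreal_ofReal
  calc ∫⁻ x, ENNReal.ofReal ((|f.1 (s, x)| / x 2) ^ p) ∂vol
      ≤ ∫⁻ x, (∫⁻ τ in Ioc (0 : ℝ) 1, N τ x ^ p) ∂vol := by
        refine lintegral_vol_mono fun x hx => ?_
        have hz : (0 : ℝ) < x 2 := hx
        have hx0 : Continuous fun τ : ℝ => scaleZ (τ ^ 2) x := by
          simp only [scaleZ_eq]
          fun_prop
        have hxD : Continuous fun τ : ℝ => D (scaleZ (τ ^ 2) x) := by
          have := cD.comp_continuous hx0 (fun τ => by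
            simp only [closedHalfSpace, mem_ofPred_eq, scaleZ_apply, if_true]
            positivity)
          exact this
        have hx1 : AEMeasurable (fun τ => N τ x) (volume.restrict (Ioc (0 : ℝ) 1)) :=
          ((continuous_const.mul continuous_id).mul hxD).measurable.ennreal_ofReal.aemeasurable
        rw [← ENNReal.ofReal_rpow_of_nonneg (by positivity) hp0.le]
        exact (ENNReal.rpow_le_rpow (abs_div_le_lintegral hT hf hs hx) hp0.le).trans
          (rpow_lintegral_Ioc_le (by linarith) hx1)
    _ = ∫⁻ τ in Ioc (0 : ℝ) 1, ∫⁻ x, N τ x ^ p ∂vol :=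
        (lintegral_lintegral_swap (f := fun τ x => N τ x ^ p) (hmeas.pow_const p)).symm
    _ ≤ ∫⁻ _ in Ioc (0 : ℝ) 1, ENNReal.ofReal (2 ^ p) * ∫⁻ x, ENNReal.ofReal (D x ^ p) ∂vol := by
        refine setLIntegral_mono' measurableSet_Ioc fun τ hτ => ?_
        have hτ0 : 0 < τ := hτ.1
        have e1 : ∀ x, N τ x ^ p = ENNReal.ofReal ((2 * τ) ^ p)
            * (fun x => ENNReal.ofReal (D x ^ p)) (scaleZ (τ ^ 2) x) := by
          intro x
          have hD0 : ∀ x, 0 ≤ D x := fun x => abs_nonneg _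
          simp only [N]
          rw [ENNReal.ofReal_rpow_of_nonneg (mul_nonneg (by positivity) (hD0 _)) hp0.le,
            Real.mul_rpow (by positivity) (hD0 _), ENNReal.ofReal_mul (by positivity)]
        have hWm : AEMeasurable (fun x => ENNReal.ofReal (D x ^ p)) vol :=
          (((cD.rpow_const fun _ _ => Or.inr hp0.le).mono halfSpace_subset).aemeasurable
            measurableSet_halfSpace).ennreal_ofReal
        simp only [e1]
        rw [lintegral_const_mul' _ _ ENNReal.ofReal_ne_top, lintegral_scaleZ (pow_pos hτ0 2) hWm,
          ← mul_assoc, ← ENNReal.ofReal_mul (by positivity)]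
        refine mul_le_mul_left (ENNReal.ofReal_le_ofReal ?_) _
        -- The dilation by τ² contributes τ^{-2}, and (2τ)^p τ^{-2} ≤ 2^p because p > 2 and τ ≤ 1.
        -- With the linear parametrization the weight would be the non-integrable τ^{-1}.
        rw [Real.mul_rpow (by norm_num) hτ0.le, mul_assoc]
        refine mul_le_of_le_one_right (by positivity) ?_
        rw [← div_eq_mul_inv, div_le_one (by positivity), ← Real.rpow_natCast]
        exact Real.rpow_le_rpow_of_exponent_ge hτ0 hτ.2 (by norm_num; linarith)
    _ = _ := by simp [hD]

end ConormalNS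

namespace ConormalNS

/-! ### The equation for the conormal derivatives of the velocity -/

lemma ConormalRing.Zpow_d_two {A : Type} [CommRing A] [Algebra ℝ A] (S : ConormalRing A)
    (α : Fin 3 → ℕ) (hα : α 2 = 0) (a : A) : S.Zpow α (S.d 2 a) = S.d 2 (S.Zpow α a) := by
  induction α using multiIndex_induction with
  | h0 => simp [Zpow_zero]
  | hs α i ih =>
    by_cases hi : i = 2
    · subst hi
      simp at hα
    · rw [Zpow_add_single, ih (by simpa [hi, Ne.symm hi] using hα), Z_d, Zpow_add_single]
      simp [hi]

lemma norm_slice_le_sum {T : ℝ} (v : Fin 3 → smoothRing T) (s : ℝ) (x : E3) :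
    ‖slice v s x‖ ≤ ∑ k, |(v k).1 (s, x)| := by
  rw [EuclideanSpace.norm_eq]
  refine Real.sqrt_le_iff.2 ⟨Finset.sum_nonneg fun _ _ => abs_nonneg _, ?_⟩
  simp only [slice_apply, Real.norm_eq_abs]
  exact Finset.sum_sq_le_sq_sum_of_nonneg fun _ _ => abs_nonneg _

lemma abs_apply_le_norm_slice {T : ℝ} (v : Fin 3 → smoothRing T) (y : ℝ × E3) (k : Fin 3) :
    |(v k).1 y| ≤ ‖slice v y.1 y.2‖ := abs_apply_le_norm (slice v y.1 y.2) k

/-- The size of the conormal derivatives of order at most `m` of a field. -/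
noncomputable def conormalSum {T : ℝ} (hT : 0 < T) (m : ℕ) (U : Fin 3 → smoothRing T)
    (y : ℝ × E3) : ℝ :=
  ∑ δ ∈ multiIndices m, ‖slice (fun k => (slabRing hT).Zpow δ (U k)) y.1 y.2‖

lemma conormalSum_nonneg {T : ℝ} (hT : 0 < T) (m : ℕ) (U : Fin 3 → smoothRing T) (y : ℝ × E3) :
    0 ≤ conormalSum hT m U y := Finset.sum_nonneg fun _ _ => norm_nonneg _

lemma norm_slice_le_conormalSum {T : ℝ} (hT : 0 < T) {m : ℕ} (U : Fin 3 → smoothRing T)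
    (s : ℝ) (x : E3) {δ : Fin 3 → ℕ} (hδ : ∑ i, δ i ≤ m) :
    ‖slice (fun k => (slabRing hT).Zpow δ (U k)) s x‖ ≤ conormalSum hT m U (s, x) :=
  Finset.single_le_sum
    (f := fun δ => ‖slice (fun k => (slabRing hT).Zpow δ (U k)) s x‖)
    (fun _ _ => norm_nonneg _) (mem_multiIndices.2 hδ)

lemma sum_abs_Zpow_le_conormalSum {T : ℝ} (hT : 0 < T) (m : ℕ) (U : Fin 3 → smoothRing T)
    (y : ℝ × E3) (k : Fin 3) :
    ∑ δ ∈ multiIndices m, |((slabRing hT).Zpow δ (U k)).1 y| ≤ conormalSum hT m U y :=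
  Finset.sum_le_sum fun δ _ =>
    abs_apply_le_norm_slice (fun k => (slabRing hT).Zpow δ (U k)) y k

/-- The conormal derivatives of a solution satisfy transport-diffusion equations. -/
lemma exists_isTransportDiffusion (μ : ℝ) {α : Fin 3 → ℕ} (hα : ∑ i, α i ≤ 3) :
    ∃ (K : ℝ) (R : Fin 3 → BilinOp), 0 ≤ K ∧ (∀ j, BilinLower j (∑ i, α i) (R j)) ∧
      ∀ {ν T : ℝ} {u₀ : E3 → E3} {u : ℝ → E3 → E3} {q : ℝ → E3 → ℝ} (hT : 0 < T)
        (h : IsSmoothSolution ν μ T u₀ u q), ∃ A B : Fin 3 → smoothRing T,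
        IsTransportDiffusion hT ν K (fun k => (slabRing hT).Zpow α (h.velocity k)) A B
          (fun k => -(∑ j, R j _ (slabRing hT) (h.velocity j) (h.velocity k))
            - (slabRing hT).Zpow α ((slabRing hT).d k h.pressure)) h.velocity
          (conormalSum hT 2 fun k => (slabRing hT).d 2 (h.velocity k)) := by
  choose R hR hRe using fun j => exists_commutator_transport j α
  obtain ⟨a, b, ha, hb, ha0, hab⟩ := exists_commutator_dzz α
  obtain ⟨Ca, hCa, Ha⟩ := (ha.weaken (m := 2 + 1) hα).exists_bound
  obtain ⟨Cb, hCb, Hb⟩ := (hb.weaken (m := 2 + 1) hα).exists_bound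
  refine ⟨3 * (Ca + Cb + 2 * |μ|), R, by positivity, hR, ?_⟩
  intro ν T u₀ u q hT h
  set S := slabRing hT with hS
  set U := h.velocity with hU
  set f : Fin 3 → smoothRing T := fun k => S.Zpow α (U k) with hf
  set g := conormalSum hT 2 fun k => S.d 2 (U k) with hg
  have hw : ∀ y, 0 ≤ S.w.1 y ∧ S.w.1 y ≤ 1 := fun y => evalAt_w_mem hT y
  have g0 : ∀ y, 0 ≤ g y := fun y => conormalSum_nonneg hT 2 _ y
  have fle : ∀ y k, |(f k).1 y| ≤ ‖slice f y.1 y.2‖ := fun y k => abs_apply_le_norm_slice f y k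
  have Fle : ∀ y k, |(S.d 2 (f k)).1 y| ≤ ‖slice (fun k => S.d 2 (f k)) y.1 y.2‖ := fun y k =>
    abs_apply_le_norm_slice (fun k => S.d 2 (f k)) y k
  have hale : ∀ y k, |(a _ S (U k)).1 y| ≤ Ca * g y := fun y k =>
    (Ha _ S (evalAt y) (evalAt_w_mem hT y) (U k)).trans (mul_le_mul_of_nonneg_left
      (sum_abs_Zpow_le_conormalSum hT 2 (fun k => S.d 2 (U k)) y k) hCa)
  have hble : ∀ y k, |(b _ S (U k)).1 y| ≤ Cb * g y := fun y k =>
    (Hb _ S (evalAt y) (evalAt_w_mem hT y) (U k)).trans (mul_le_mul_of_nonneg_left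
      (sum_abs_Zpow_le_conormalSum hT 2 (fun k => S.d 2 (U k)) y k) hCb)
  -- The terms with 2μ cancel in ∂_z A + B. On the wall w = 1, so the flux becomes ∂_z f - 2μf + a
  -- and the Navier condition makes it vanish where needed; the factor w also makes the correction
  -- conform to the algebra, with bounded derivative.
  refine ⟨fun k => a _ S (U k) - (2 * μ) • (S.w * f k),
    fun k => b _ S (U k) + S.d 2 ((2 * μ) • (S.w * f k)), ?_⟩
  refine ⟨?_, h.div_velocity hT, h.vanishesAtBoundary_velocity hT, ?_, g0, ?_, ?_⟩
  · intro k
    have e0 : S.Zpow α (S.d 0 (S.d 0 (U k))) = S.d 0 (S.d 0 (f k)) := by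
      rw [S.Zpow_d_of_ne (by decide), S.Zpow_d_of_ne (by decide)]
    have e1 : S.Zpow α (S.d 1 (S.d 1 (U k))) = S.d 1 (S.d 1 (f k)) := by
      rw [S.Zpow_d_of_ne (by decide), S.Zpow_d_of_ne (by decide)]
    have e2 := hab _ S (U k)
    simp only [hf]
    rw [S.dt_Zpow, h.dt_velocity hT k]
    simp only [map_sub, map_smul, map_sum, hRe, ← hS, ← hU]
    simp only [Fin.sum_univ_three, e0, e1, e2, hf, smul_add, smul_sub]
    ring
  · intro hν s hs x hx
    have hxc : x ∈ closedHalfSpace := by simp [closedHalfSpace, hx]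
    have hw1 : S.w.1 (s, x) = 1 :=
      (smoothWeight_apply (T := T) (y := (s, x)) ⟨hs, hxc⟩).trans (by simp [hx])
    change evalAt (s, x) (∑ k, f k * (S.d 2 (f k) + (a _ S (U k) - (2 * μ) • (S.w * f k)))) = 0
    rw [map_sum]
    refine Finset.sum_eq_zero fun k _ => ?_
    rw [map_mul]
    -- Each product vanishes separately. The normal component Z^α u₃ is zero on the wall, and so is
    -- every Z^α u_k containing a factor Z₃. If α involves only tangential derivatives, then a = 0
    -- and Z^α preserves the Navier condition.
    by_cases hk : k = 2
    · subst hk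
      have := (h.vanishesAtBoundary_velocity hT).Zpow hT α s hs x hx
      rw [evalAt_apply, this, zero_mul]
    by_cases hα2 : α 2 = 0
    · have h1 := (h.vanishesAtBoundary_slip hT hν hk).Zpow hT α s hs x hx
      rw [map_sub, map_smul, S.Zpow_d_two α hα2] at h1
      rw [ha0 hα2, zero_sub, ← sub_eq_add_neg, map_sub, map_smul, map_mul]
      simp only [evalAt_apply, hw1, one_mul]
      refine mul_eq_zero_of_right _ h1
    · have := vanishesAtBoundary_Zpow hT (U k) hα2 s hs x hx
      rw [evalAt_apply, this, zero_mul]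
  · intro _ y
    refine (norm_slice_le_sum _ _ _).trans ?_
    have key : ∀ k, |(a _ S (U k) - (2 * μ) • (S.w * f k)).1 y|
        ≤ (Ca + Cb + 2 * |μ|) * (g y + ‖slice f y.1 y.2‖) := by
      intro k
      change |(a _ S (U k)).1 y - (2 * μ) * (S.w.1 y * (f k).1 y)| ≤ _
      have h1 : |(2 * μ) * (S.w.1 y * (f k).1 y)| ≤ 2 * |μ| * ‖slice f y.1 y.2‖ := by
        rw [abs_mul, abs_mul, abs_mul, abs_two, abs_of_nonneg (hw y).1]
        exact mul_le_mul_of_nonneg_left ((mul_le_of_le_one_left (abs_nonneg _) (hw y).2).trans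
          (fle y k)) (by positivity)
      have h2 := abs_sub ((a _ S (U k)).1 y) ((2 * μ) * (S.w.1 y * (f k).1 y))
      nlinarith [hale y k, g0 y, norm_nonneg (slice f y.1 y.2), abs_nonneg μ,
        mul_nonneg hCb (g0 y), mul_nonneg hCa (norm_nonneg (slice f y.1 y.2)),
        mul_nonneg hCb (norm_nonneg (slice f y.1 y.2)), mul_nonneg (abs_nonneg μ) (g0 y)]
    calc _ ≤ ∑ _k : Fin 3, (Ca + Cb + 2 * |μ|) * (g y + ‖slice f y.1 y.2‖) :=
          Finset.sum_le_sum fun k _ => key k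
      _ = _ := by simp; ring
  · intro _ y
    refine (norm_slice_le_sum _ _ _).trans ?_
    set n1 := ‖slice f y.1 y.2‖
    set n2 := ‖slice (fun k => S.d 2 (f k)) y.1 y.2‖
    have n10 : 0 ≤ n1 := norm_nonneg _
    have n20 : 0 ≤ n2 := norm_nonneg _
    have key : ∀ k, |(b _ S (U k) + S.d 2 ((2 * μ) • (S.w * f k))).1 y|
        ≤ (Ca + Cb + 2 * |μ|) * (g y + n1 + n2) := by
      intro k
      have e : S.d 2 ((2 * μ) • (S.w * f k))
          = (2 * μ) • (S.w * S.d 2 (f k) - S.w ^ 2 * f k) := by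
        rw [Derivation.map_smul, Derivation.leibniz, S.d_w_two, smul_eq_mul, smul_eq_mul]
        ring_nf
      rw [e]
      change |(b _ S (U k)).1 y + (2 * μ) * (S.w.1 y * (S.d 2 (f k)).1 y
        - S.w.1 y ^ 2 * (f k).1 y)| ≤ _
      have h1 : |S.w.1 y * (S.d 2 (f k)).1 y| ≤ n2 := by
        rw [abs_mul, abs_of_nonneg (hw y).1]
        exact (mul_le_of_le_one_left (abs_nonneg _) (hw y).2).trans (Fle y k)
      have h2 : |S.w.1 y ^ 2 * (f k).1 y| ≤ n1 := by
        rw [abs_mul, abs_of_nonneg (pow_nonneg (hw y).1 2)]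
        exact (mul_le_of_le_one_left (abs_nonneg _) (pow_le_one₀ (hw y).1 (hw y).2)).trans (fle y k)
      have h3 : |(2 * μ) * (S.w.1 y * (S.d 2 (f k)).1 y - S.w.1 y ^ 2 * (f k).1 y)|
          ≤ 2 * |μ| * (n2 + n1) := by
        rw [abs_mul, abs_mul, abs_two]
        exact mul_le_mul_of_nonneg_left ((abs_sub _ _).trans (add_le_add h1 h2)) (by positivity)
      have h4 := abs_add_le ((b _ S (U k)).1 y)
        ((2 * μ) * (S.w.1 y * (S.d 2 (f k)).1 y - S.w.1 y ^ 2 * (f k).1 y))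
      have h5 := hble y k
      have h6 : 0 ≤ Ca * (g y + n1 + n2) := mul_nonneg hCa (by linarith [g0 y])
      have h7 : 0 ≤ Cb * (n1 + n2) := mul_nonneg hCb (by linarith)
      have h8 : 0 ≤ 2 * |μ| * g y := mul_nonneg (by positivity) (g0 y)
      linarith
    calc _ ≤ ∑ _k : Fin 3, (Ca + Cb + 2 * |μ|) * (g y + n1 + n2) :=
          Finset.sum_le_sum fun k _ => key k
      _ = _ := by simp; ring

end ConormalNS

namespace ConormalNS

/-! ### The convection terms -/

section

variable {T : ℝ} (hT : 0 < T) (U : Fin 3 → smoothRing T)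

/-- The sum of the `|Z^γ U₃| / z`. -/
noncomputable def wallSum (m : ℕ) (y : ℝ × E3) : ℝ :=
  ∑ γ ∈ multiIndices m, |((slabRing hT).Zpow γ (U 2)).1 y| / y.2 2

/-- A pointwise quantity controlled by the supremum norms. -/
noncomputable def supSize (y : ℝ × E3) : ℝ :=
  conormalSum hT 2 U y + ∑ j, ‖slice (fun k => (slabRing hT).d j (U k)) y.1 y.2‖ + wallSum hT U 1 y

/-- A pointwise quantity whose `L^p` norm is controlled by the conormal norm of order three. -/
noncomputable def energySize (y : ℝ × E3) : ℝ := conormalSum hT 3 U y + wallSum hT U 2 y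

variable {U} {s : ℝ} {x : E3}

lemma wallSum_nonneg (hx : x ∈ halfSpace) (m : ℕ) : 0 ≤ wallSum hT U m (s, x) :=
  Finset.sum_nonneg fun _ _ => div_nonneg (abs_nonneg _) (le_of_lt (α := ℝ) hx)

lemma le_wallSum (hx : x ∈ halfSpace) {m : ℕ} {γ : Fin 3 → ℕ} (hγ : ∑ i, γ i ≤ m) :
    |((slabRing hT).Zpow γ (U 2)).1 (s, x)| / x 2 ≤ wallSum hT U m (s, x) :=
  Finset.single_le_sum (f := fun γ => |((slabRing hT).Zpow γ (U 2)).1 (s, x)| / x 2)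
    (fun _ _ => div_nonneg (abs_nonneg _) (le_of_lt (α := ℝ) hx)) (mem_multiIndices.2 hγ)

lemma sum_norm_pd_nonneg (y : ℝ × E3) :
    0 ≤ ∑ j, ‖slice (fun k => (slabRing hT).d j (U k)) y.1 y.2‖ :=
  Finset.sum_nonneg fun _ _ => norm_nonneg _

lemma conormalSum_le_supSize (hx : x ∈ halfSpace) : conormalSum hT 2 U (s, x) ≤ supSize hT U (s, x) := by
  have h1 := wallSum_nonneg hT (U := U) (s := s) hx 1
  have h2 := sum_norm_pd_nonneg hT (U := U) (s, x)
  unfold supSize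
  linarith

lemma norm_pd_le_supSize (hx : x ∈ halfSpace) (j : Fin 3) :
    ‖slice (fun k => (slabRing hT).d j (U k)) s x‖ ≤ supSize hT U (s, x) := by
  have h1 := wallSum_nonneg hT (U := U) (s := s) hx 1
  have h2 := conormalSum_nonneg hT 2 U (s, x)
  have h3 := Finset.single_le_sum (f := fun j => ‖slice (fun k => (slabRing hT).d j (U k)) s x‖)
    (fun _ _ => norm_nonneg _) (Finset.mem_univ j)
  unfold supSize
  linarith

lemma supSize_nonneg (hx : x ∈ halfSpace) : 0 ≤ supSize hT U (s, x) :=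
  (conormalSum_nonneg hT 2 U (s, x)).trans (conormalSum_le_supSize hT hx)

lemma conormalSum_le_energySize (hx : x ∈ halfSpace) :
    conormalSum hT 3 U (s, x) ≤ energySize hT U (s, x) :=
  le_add_of_nonneg_right (wallSum_nonneg hT hx 2)

lemma energySize_nonneg (hx : x ∈ halfSpace) : 0 ≤ energySize hT U (s, x) :=
  (conormalSum_nonneg hT 3 U (s, x)).trans (conormalSum_le_energySize hT hx)

lemma abs_Zpow_le_conormalSum {m : ℕ} {δ : Fin 3 → ℕ} (hδ : ∑ i, δ i ≤ m) (y : ℝ × E3) (k : Fin 3) :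
    |((slabRing hT).Zpow δ (U k)).1 y| ≤ conormalSum hT m U y :=
  (abs_apply_le_norm_slice (fun k => (slabRing hT).Zpow δ (U k)) y k).trans
    (norm_slice_le_conormalSum hT U y.1 y.2 hδ)

/-- `z = (1 + z) φ` converts a normal derivative into a conormal one. -/
lemma abs_mul_abs_d_two (hs : s ∈ Icc 0 T) (hx : x ∈ halfSpace) (γ δ : Fin 3 → ℕ) (k : Fin 3) :
    |((slabRing hT).Zpow γ (U 2)).1 (s, x)| * |((slabRing hT).d 2 ((slabRing hT).Zpow δ (U k))).1 (s, x)|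
      = (|((slabRing hT).Zpow γ (U 2)).1 (s, x)| + |((slabRing hT).Zpow γ (U 2)).1 (s, x)| / x 2)
        * |((slabRing hT).Zpow (δ + Pi.single 2 1) (U k)).1 (s, x)| := by
  have hz : (0 : ℝ) < x 2 := hx
  have hw : (slabRing hT).w.1 (s, x) = 1 / (1 + x 2) :=
    smoothWeight_apply (T := T) (y := (s, x)) ⟨hs, halfSpace_subset hx⟩
  have h1 : ((slabRing hT).Zpow (δ + Pi.single 2 1) (U k)).1 (s, x)
      = (1 - 1 / (1 + x 2)) * ((slabRing hT).d 2 ((slabRing hT).Zpow δ (U k))).1 (s, x) := by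
    rw [ConormalRing.Zpow_add_single, ConormalRing.Z_two, ← hw]
    rfl
  have h2 : (1 : ℝ) - 1 / (1 + x 2) = x 2 / (1 + x 2) := by field_simp; ring
  rw [h1, h2, abs_mul, abs_of_pos (by positivity : 0 < x 2 / (1 + x 2))]
  field_simp
  ring

/-- For a tangential j the left factor is taken in the sup norm when |γ| ≤ 2; otherwise δ = 0 and
the right factor is conormal of order one. For the normal j and |γ| ≤ 2, ∂_z is converted into Z₃ at
the price of Z^γ u₃/z. This quotient is measured in the sup norm if |γ| ≤ 1; if |γ| = 2 then |δ| + 1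
≤ 2, and the roles are exchanged. -/
lemma abs_mul_abs_le {γ δ : Fin 3 → ℕ} (hγδ : ∑ i, γ i + ∑ i, δ i ≤ 3) (hδ : ∑ i, δ i < 3)
    (hs : s ∈ Icc 0 T) (hx : x ∈ halfSpace) (j k : Fin 3) :
    |((slabRing hT).Zpow γ (U j)).1 (s, x)| * |((slabRing hT).d j ((slabRing hT).Zpow δ (U k))).1 (s, x)|
      ≤ 2 * (supSize hT U (s, x) * energySize hT U (s, x)) := by
  have hσ := supSize_nonneg hT (U := U) (s := s) hx
  have hH := energySize_nonneg hT (U := U) (s := s) hx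
  have hσ2 := conormalSum_le_supSize hT (U := U) (s := s) hx
  have hH3 := conormalSum_le_energySize hT (U := U) (s := s) hx
  have key : ∀ a b : ℝ, 0 ≤ a → 0 ≤ b →
      (a ≤ 2 * supSize hT U (s, x) ∧ b ≤ energySize hT U (s, x) ∨
        a ≤ 2 * energySize hT U (s, x) ∧ b ≤ supSize hT U (s, x)) →
      a * b ≤ 2 * (supSize hT U (s, x) * energySize hT U (s, x)) := by
    rintro a b ha hb (⟨h1, h2⟩ | ⟨h1, h2⟩)
    · calc a * b ≤ (2 * supSize hT U (s, x)) * energySize hT U (s, x) :=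
            mul_le_mul h1 h2 hb (by positivity)
        _ = _ := by ring
    · calc a * b ≤ (2 * energySize hT U (s, x)) * supSize hT U (s, x) :=
            mul_le_mul h1 h2 hb (by positivity)
        _ = _ := by ring
  by_cases hj : j = 2
  · subst hj
    by_cases h3 : ∑ i, γ i ≤ 2
    · rw [abs_mul_abs_d_two hT hs hx]
      refine key _ _ (add_nonneg (abs_nonneg _) (div_nonneg (abs_nonneg _)
        (le_of_lt (α := ℝ) hx))) (abs_nonneg _) ?_
      by_cases h1 : ∑ i, γ i ≤ 1
      · left
        constructor
        · have e1 := abs_Zpow_le_conormalSum hT (U := U) (m := 2) (h1.trans one_le_two) (s, x) 2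
          have e2 := le_wallSum hT (U := U) (s := s) hx h1
          have e3 := sum_norm_pd_nonneg hT (U := U) (s, x)
          have e4 := wallSum_nonneg hT (U := U) (s := s) hx 1
          unfold supSize at *
          linarith [conormalSum_nonneg hT 2 U (s, x)]
        · exact (abs_Zpow_le_conormalSum hT (by rw [ConormalRing.sum_add_single]; omega) _ _).trans
            hH3
      · right
        constructor
        · have e1 := abs_Zpow_le_conormalSum hT (U := U) (m := 3) (h3.trans (by norm_num)) (s, x) 2
          have e2 := le_wallSum hT (U := U) (s := s) hx h3
          have e4 := wallSum_nonneg hT (U := U) (s := s) hx 2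
          unfold energySize at *
          linarith [conormalSum_nonneg hT 3 U (s, x)]
        · exact (abs_Zpow_le_conormalSum hT (by rw [ConormalRing.sum_add_single]; omega) _ _).trans
            hσ2
    -- Dividing Z^γ u₃ by z when |γ| = 3 would need conormal derivatives of order four. Instead δ =
    -- 0, and ∂_z u itself is taken in L^∞: this is why the Lipschitz norm appears in the theorem.
    · have hδ0 : δ = 0 := by
        have h4 : ∑ i, δ i = 0 := by omega
        funext i
        simpa using Finset.sum_eq_zero_iff.1 h4 i (Finset.mem_univ i)
      subst hδ0
      refine key _ _ (abs_nonneg _) (abs_nonneg _) (Or.inr ⟨?_, ?_⟩)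
      · have e1 := abs_Zpow_le_conormalSum hT (U := U) (m := 3) (by omega : ∑ i, γ i ≤ 3) (s, x) 2
        linarith
      · rw [ConormalRing.Zpow_zero]
        exact (abs_apply_le_norm_slice (fun k => (slabRing hT).d 2 (U k)) (s, x) k).trans
          (norm_pd_le_supSize hT hx 2)
  · have e : (slabRing hT).d j ((slabRing hT).Zpow δ (U k))
        = (slabRing hT).Zpow (δ + Pi.single j 1) (U k) := by
      rw [ConormalRing.Zpow_add_single, ConormalRing.Z_of_ne _ hj]
    rw [e]
    refine key _ _ (abs_nonneg _) (abs_nonneg _) ?_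
    by_cases h3 : ∑ i, γ i ≤ 2
    · left
      constructor
      · have := abs_Zpow_le_conormalSum hT (U := U) h3 (s, x) j
        linarith
      · exact (abs_Zpow_le_conormalSum hT (by rw [ConormalRing.sum_add_single]; omega) _ _).trans hH3
    · right
      constructor
      · have := abs_Zpow_le_conormalSum hT (U := U) (m := 3) (by omega : ∑ i, γ i ≤ 3) (s, x) j
        linarith
      · exact (abs_Zpow_le_conormalSum hT (by rw [ConormalRing.sum_add_single]; omega) _ _).trans hσ2

end

/-- The commutators with the convection operator are controlled by products. -/
lemma exists_convection_bound {n : ℕ} (hn : n ≤ 3) {R : Fin 3 → BilinOp}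
    (hR : ∀ j, BilinLower j n (R j)) :
    ∃ C : ℝ, 0 ≤ C ∧ ∀ {T : ℝ} (hT : 0 < T) (U r : Fin 3 → smoothRing T) {s : ℝ}, s ∈ Icc 0 T →
      ∀ {x : E3}, x ∈ halfSpace →
      ‖slice (fun k => -(∑ j, R j _ (slabRing hT) (U j) (U k)) - r k) s x‖
        ≤ C * (supSize hT U (s, x) * energySize hT U (s, x)) + ‖slice r s x‖ := by
  choose C hC0 hC using fun j => (hR j).exists_bound
  refine ⟨3 * ∑ j, C j * 2, mul_nonneg zero_le_three
    (Finset.sum_nonneg fun j _ => mul_nonneg (hC0 j) zero_le_two), ?_⟩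
  intro T hT U r s hs x hx
  set M := 2 * (supSize hT U (s, x) * energySize hT U (s, x)) with hM
  have hM0 : 0 ≤ M := mul_nonneg zero_le_two
    (mul_nonneg (supSize_nonneg hT hx) (energySize_nonneg hT hx))
  have h1 : ∀ k, |(∑ j, R j _ (slabRing hT) (U j) (U k)).1 (s, x)| ≤ ∑ j, C j * M := by
    intro k
    rw [← evalAt_apply, map_sum]
    refine (Finset.abs_sum_le_sum_abs _ _).trans (Finset.sum_le_sum fun j _ => ?_)
    exact hC j _ _ (evalAt (s, x)) (evalAt_w_mem hT _) (U j) (U k) M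
      (fun γ δ h1 h2 => abs_mul_abs_le hT (h1.trans hn) (h2.trans_le hn) hs hx j k) hM0
  have h2 : slice (fun k => -(∑ j, R j _ (slabRing hT) (U j) (U k)) - r k) s x
      = -slice (fun k => ∑ j, R j _ (slabRing hT) (U j) (U k)) s x - slice r s x := rfl
  rw [h2]
  refine (norm_sub_le _ _).trans (add_le_add ?_ le_rfl)
  rw [norm_neg]
  refine (norm_slice_le_sum _ _ _).trans ((Finset.sum_le_sum fun k _ => h1 k).trans (le_of_eq ?_))
  simp only [Finset.sum_const, Finset.card_univ, Fintype.card_fin, Fin.sum_univ_three, hM,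
    nsmul_eq_mul]
  push_cast
  ring

/-- Normal derivatives of the normal component are conormal, by incompressibility. -/
lemma exists_normal_bound (m : ℕ) :
    ∃ C : ℝ, 0 ≤ C ∧ ∀ {T : ℝ} (hT : 0 < T) (U : Fin 3 → smoothRing T),
      ∑ j, (slabRing hT).d j (U j) = 0 → ∀ γ ∈ multiIndices m, ∀ y : ℝ × E3,
      |((slabRing hT).d 2 ((slabRing hT).Zpow γ (U 2))).1 y| ≤ C * conormalSum hT (m + 1) U y := by
  have h0 : ∀ γ : Fin 3 → ℕ, ∃ C : ℝ, 0 ≤ C ∧ (γ ∈ multiIndices m →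
      ∀ (A : Type) [CommRing A] [Algebra ℝ A] (S : ConormalRing A) (ev : A →ₐ[ℝ] ℝ),
      ev S.w ∈ Icc (0 : ℝ) 1 → ∀ v, |ev (S.d 2 (S.Zpow γ v))|
        ≤ C * ∑ δ ∈ multiIndices m, |ev (S.Zpow δ (S.d 2 v))|) := by
    intro γ
    by_cases hγ : γ ∈ multiIndices m
    · obtain ⟨C, hC, h⟩ := ((linLower_d_Zpow γ).weaken (m := m + 1)
        (Nat.succ_le_succ (mem_multiIndices.1 hγ))).exists_bound
      exact ⟨C, hC, fun _ => h⟩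
    · exact ⟨0, le_rfl, fun h => absurd h hγ⟩
  choose C hC0 hC using h0
  refine ⟨(∑ γ ∈ multiIndices m, C γ) * ((multiIndices m).card * 2),
    mul_nonneg (Finset.sum_nonneg fun γ _ => hC0 γ) (by positivity), ?_⟩
  intro T hT U hdiv γ hγ y
  have hN := conormalSum_nonneg hT (m + 1) U y
  have h1 := hC γ hγ _ (slabRing hT) (evalAt y) (evalAt_w_mem hT y) (U 2)
  have h2 : ∀ δ ∈ multiIndices m, |((slabRing hT).Zpow δ ((slabRing hT).d 2 (U 2))).1 y|
      ≤ 2 * conormalSum hT (m + 1) U y := by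
    intro δ hδ
    have e : (slabRing hT).Zpow δ ((slabRing hT).d 2 (U 2))
        = -((slabRing hT).Zpow (δ + Pi.single 0 1) (U 0))
          - (slabRing hT).Zpow (δ + Pi.single 1 1) (U 1) := by
      rw [← ConormalRing.Zpow_Z, ← ConormalRing.Zpow_Z, ConormalRing.Z_of_ne _ (by decide),
        ConormalRing.Z_of_ne _ (by decide), ← map_neg, ← map_sub]
      congr 1
      rw [Fin.sum_univ_three] at hdiv
      linear_combination hdiv
    rw [e]
    have a0 := abs_Zpow_le_conormalSum hT (U := U) (m := m + 1) (δ := δ + Pi.single 0 1)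
      (by rw [ConormalRing.sum_add_single]; exact Nat.succ_le_succ (mem_multiIndices.1 hδ)) y 0
    have a1 := abs_Zpow_le_conormalSum hT (U := U) (m := m + 1) (δ := δ + Pi.single 1 1)
      (by rw [ConormalRing.sum_add_single]; exact Nat.succ_le_succ (mem_multiIndices.1 hδ)) y 1
    change |-((slabRing hT).Zpow (δ + Pi.single 0 1) (U 0)).1 y
      - ((slabRing hT).Zpow (δ + Pi.single 1 1) (U 1)).1 y| ≤ _
    refine (abs_sub _ _).trans ?_
    rw [abs_neg]
    linarith
  have h3 : ∑ δ ∈ multiIndices m, |evalAt y ((slabRing hT).Zpow δ ((slabRing hT).d 2 (U 2)))|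
      ≤ (multiIndices m).card * 2 * conormalSum hT (m + 1) U y := by
    refine (Finset.sum_le_sum h2).trans (le_of_eq ?_)
    rw [Finset.sum_const, nsmul_eq_mul, mul_assoc]
  refine h1.trans ?_
  rw [mul_assoc]
  exact mul_le_mul (Finset.single_le_sum (fun γ _ => hC0 γ) hγ) h3
    (Finset.sum_nonneg fun _ _ => abs_nonneg _) (Finset.sum_nonneg fun γ _ => hC0 γ)

/-- The L^∞ counterpart of Hardy's inequality, from the same representation as an average along the
segment to the wall. -/
lemma abs_div_le_of_forall {T : ℝ} (hT : 0 < T) {f : smoothRing T} (hf : VanishesAtBoundary f)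
    {s : ℝ} (hs : s ∈ Icc 0 T) {N : ℝ} (hN : ∀ x ∈ halfSpace, |((slabRing hT).d 2 f).1 (s, x)| ≤ N)
    {x : E3} (hx : x ∈ halfSpace) : |f.1 (s, x)| / x 2 ≤ 2 * N := by
  have hN0 : 0 ≤ N := (abs_nonneg _).trans (hN x hx)
  have h1 := abs_div_le_lintegral hT hf hs hx
  have h2 : ∫⁻ τ in Ioc (0 : ℝ) 1,
      ENNReal.ofReal (2 * τ * |((slabRing hT).d 2 f).1 (s, scaleZ (τ ^ 2) x)|)
      ≤ ∫⁻ _ in Ioc (0 : ℝ) 1, ENNReal.ofReal (2 * N) := by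
    refine setLIntegral_mono' measurableSet_Ioc fun τ hτ => ENNReal.ofReal_le_ofReal ?_
    have h3 := hN _ ((scaleZ_mem (pow_pos hτ.1 2)).2 hx)
    have h4 : 2 * τ ≤ 2 := by linarith [hτ.2]
    exact mul_le_mul h4 h3 (abs_nonneg _) zero_le_two
  have h3 := h1.trans h2
  rw [lintegral_const, Measure.restrict_apply_univ, Real.volume_Ioc] at h3
  simp only [sub_zero, ENNReal.ofReal_one, mul_one] at h3
  exact (ENNReal.ofReal_le_ofReal_iff (by positivity)).1 h3

/-- Quotients Z^γ u₃/z with |γ| ≤ 1 are bounded by ∂_z Z^γ u₃, which incompressibility turns into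
conormal derivatives of order two; hence ‖u‖_{2,∞} suffices. The bounds must be known on the whole
half-space, since the average runs down to the wall. -/
lemma exists_supSize_le :
    ∃ C : ℝ, 0 ≤ C ∧ ∀ {T : ℝ} (hT : 0 < T) (U : Fin 3 → smoothRing T),
      ∑ j, (slabRing hT).d j (U j) = 0 → VanishesAtBoundary (U 2) → ∀ {s : ℝ}, s ∈ Icc 0 T →
      ∀ {M : ℝ}, (∀ x ∈ halfSpace, conormalSum hT 2 U (s, x) ≤ M) →
      (∀ x ∈ halfSpace, ∑ j, ‖slice (fun k => (slabRing hT).d j (U k)) s x‖ ≤ M) →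
      ∀ x ∈ halfSpace, supSize hT U (s, x) ≤ C * M := by
  obtain ⟨C, hC, h⟩ := exists_normal_bound 1
  refine ⟨2 + (multiIndices 1).card * (2 * C), by positivity, ?_⟩
  intro T hT U hdiv hU s hs M h1 h2 x hx
  have h3 : wallSum hT U 1 (s, x) ≤ (multiIndices 1).card * (2 * (C * M)) := by
    rw [← nsmul_eq_mul]
    refine Finset.sum_le_card_nsmul _ _ _ fun γ hγ => ?_
    exact abs_div_le_of_forall hT (hU.Zpow hT γ) hs (fun x hx => (h hT U hdiv γ hγ (s, x)).trans
      (mul_le_mul_of_nonneg_left (h1 x hx) hC)) hx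
  have := h1 x hx
  have := h2 x hx
  simp only [supSize]
  linarith

end ConormalNS

namespace ConormalNS

/-! ### Integrated estimates at a fixed time -/

lemma lintegral_sum_rpow_le {p : ℝ} (hp : 2 < p) {ι : Type*} (S : Finset ι) {F : ι → E3 → ℝ}
    (hF : ∀ i ∈ S, AEMeasurable (F i) vol) (hF0 : ∀ i ∈ S, ∀ x ∈ halfSpace, 0 ≤ F i x) :
    ∫⁻ x, ENNReal.ofReal ((∑ i ∈ S, F i x) ^ p) ∂vol
      ≤ ENNReal.ofReal (S.card ^ (p - 1)) * ∑ i ∈ S, ∫⁻ x, ENNReal.ofReal (F i x ^ p) ∂vol := by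
  rw [← lintegral_finsetSum' _ fun i hi => ((hF i hi).pow_const p).ennreal_ofReal,
    ← lintegral_const_mul' _ _ ENNReal.ofReal_ne_top]
  refine lintegral_vol_mono fun x hx => ?_
  rw [← ENNReal.ofReal_sum_of_nonneg fun i hi => Real.rpow_nonneg (hF0 i hi x hx) _,
    ← ENNReal.ofReal_mul (by positivity)]
  refine ENNReal.ofReal_le_ofReal ?_
  have := Real.rpow_sum_le_const_mul_sum_rpow_of_nonneg S (f := fun i => F i x) (p := p)
    (by linarith) fun i hi => hF0 i hi x hx
  exact this

lemma lintegral_add_rpow_le {p : ℝ} (hp : 2 < p) {F G : E3 → ℝ}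
    (hF : AEMeasurable F vol) (hG : AEMeasurable G vol) (hF0 : ∀ x ∈ halfSpace, 0 ≤ F x)
    (hG0 : ∀ x ∈ halfSpace, 0 ≤ G x) :
    ∫⁻ x, ENNReal.ofReal ((F x + G x) ^ p) ∂vol ≤ ENNReal.ofReal (2 ^ (p - 1))
      * (∫⁻ x, ENNReal.ofReal (F x ^ p) ∂vol + ∫⁻ x, ENNReal.ofReal (G x ^ p) ∂vol) := by
  have := lintegral_sum_rpow_le hp (Finset.univ : Finset (Fin 2)) (F := ![F, G])
    (by simp [Fin.forall_fin_two, hF, hG])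
    (by simpa [Fin.forall_fin_two] using ⟨hF0, hG0⟩)
  simpa [Fin.sum_univ_two] using this

section

variable {T : ℝ} (hT : 0 < T)

/-- The `p`-th power of the conormal norm of a field on the slab at time `s`. -/
noncomputable def lpSum (p : ℝ) (m : ℕ) (U : Fin 3 → smoothRing T) (s : ℝ) : ℝ≥0∞ :=
  ∑ α ∈ multiIndices m,
    ∫⁻ x, ENNReal.ofReal (‖slice (fun k => (slabRing hT).Zpow α (U k)) s x‖ ^ p) ∂vol

variable {s : ℝ} (U : Fin 3 → smoothRing T)

lemma aemeasurable_norm_slice (hs : s ∈ Icc 0 T) (v : Fin 3 → smoothRing T) :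
    AEMeasurable (fun x => ‖slice v s x‖) vol :=
  ((continuousOn_slice v hs).norm.mono halfSpace_subset).aemeasurable measurableSet_halfSpace

lemma aemeasurable_conormalSum (hs : s ∈ Icc 0 T) (m : ℕ) :
    AEMeasurable (fun x => conormalSum hT m U (s, x)) vol :=
  Finset.aemeasurable_fun_sum _ fun _ _ => aemeasurable_norm_slice hs _

lemma aemeasurable_abs_div (hs : s ∈ Icc 0 T) (f : smoothRing T) :
    AEMeasurable (fun x => |f.1 (s, x)| / x 2) vol := by
  have h1 : ContinuousOn (fun x => |f.1 (s, x)| / x 2) halfSpace :=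
    ((continuousOn_apply f hs).mono halfSpace_subset).abs.div continuous_apply_two.continuousOn
      fun x hx => ne_of_gt (α := ℝ) hx
  exact h1.aemeasurable measurableSet_halfSpace

lemma aemeasurable_wallSum (hs : s ∈ Icc 0 T) (m : ℕ) :
    AEMeasurable (fun x => wallSum hT U m (s, x)) vol :=
  Finset.aemeasurable_fun_sum _ fun _ _ => aemeasurable_abs_div hs _

lemma lintegral_conormalSum_rpow_le {p : ℝ} (hp : 2 < p) (hs : s ∈ Icc 0 T) (m : ℕ) :
    ∫⁻ x, ENNReal.ofReal (conormalSum hT m U (s, x) ^ p) ∂vol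
      ≤ ENNReal.ofReal ((multiIndices m).card ^ (p - 1)) * lpSum hT p m U s :=
  lintegral_sum_rpow_le hp _ (fun _ _ => aemeasurable_norm_slice hs _)
    fun _ _ _ _ => norm_nonneg _

/-- Hardy's inequality bounds Z^γ u₃/z, |γ| ≤ 2, by ∂_z Z^γ u₃, and incompressibility makes this
conormal of order at most three: no derivative is lost. -/
lemma exists_lintegral_energySize_le {p : ℝ} (hp : 2 < p) :
    ∃ C : ℝ≥0, ∀ {T : ℝ} (hT : 0 < T) (U : Fin 3 → smoothRing T),
      ∑ j, (slabRing hT).d j (U j) = 0 → VanishesAtBoundary (U 2) → ∀ {s : ℝ}, s ∈ Icc 0 T →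
      ∫⁻ x, ENNReal.ofReal (energySize hT U (s, x) ^ p) ∂vol ≤ C * lpSum hT p 3 U s := by
  obtain ⟨C, hC, h⟩ := exists_normal_bound 2
  have hp0 : 0 < p := by linarith
  set c1 : ℝ := (multiIndices 3).card ^ (p - 1) with hc1
  set c2 : ℝ := (multiIndices 2).card ^ (p - 1) with hc2
  have hc10 : 0 ≤ c1 := by positivity
  have hc20 : 0 ≤ c2 := by positivity
  refine ⟨Real.toNNReal (2 ^ (p - 1) * (c1 + c2 * ((multiIndices 2).card * (2 ^ p * (C ^ p * c1))))),
    ?_⟩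
  intro T hT U hdiv hU s hs
  have h1 := lintegral_conormalSum_rpow_le hT U hp hs 3
  have h2 : ∫⁻ x, ENNReal.ofReal (wallSum hT U 2 (s, x) ^ p) ∂vol
      ≤ ENNReal.ofReal c2 * ∑ γ ∈ multiIndices 2, ∫⁻ x, ENNReal.ofReal
        ((|((slabRing hT).Zpow γ (U 2)).1 (s, x)| / x 2) ^ p) ∂vol :=
    lintegral_sum_rpow_le hp _ (fun _ _ => aemeasurable_abs_div hs _)
      fun _ _ x hx => div_nonneg (abs_nonneg _) (le_of_lt (α := ℝ) hx)
  have h3 : ∀ γ ∈ multiIndices 2, ∫⁻ x, ENNReal.ofReal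
        ((|((slabRing hT).Zpow γ (U 2)).1 (s, x)| / x 2) ^ p) ∂vol
      ≤ ENNReal.ofReal (2 ^ p * (C ^ p * c1)) * lpSum hT p 3 U s := by
    intro γ hγ
    refine (hardy_inequality hT hp (hU.Zpow hT γ) hs).trans ?_
    have h4 : ∫⁻ x, ENNReal.ofReal
        (|((slabRing hT).d 2 ((slabRing hT).Zpow γ (U 2))).1 (s, x)| ^ p) ∂vol
        ≤ ENNReal.ofReal (C ^ p) * ∫⁻ x, ENNReal.ofReal (conormalSum hT 3 U (s, x) ^ p) ∂vol := by
      rw [← lintegral_const_mul' _ _ ENNReal.ofReal_ne_top]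
      refine lintegral_mono fun x => ?_
      beta_reduce
      rw [← ENNReal.ofReal_mul (by positivity), ← Real.mul_rpow hC (conormalSum_nonneg hT 3 U _)]
      exact ENNReal.ofReal_le_ofReal (Real.rpow_le_rpow (abs_nonneg _) (h hT U hdiv γ hγ _) hp0.le)
    rw [ENNReal.ofReal_mul (by positivity), ENNReal.ofReal_mul (by positivity), mul_assoc, mul_assoc]
    gcongr
    exact h4.trans (by gcongr)
  have h4 : ∫⁻ x, ENNReal.ofReal (wallSum hT U 2 (s, x) ^ p) ∂vol
      ≤ ENNReal.ofReal (c2 * ((multiIndices 2).card * (2 ^ p * (C ^ p * c1))))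
        * lpSum hT p 3 U s := by
    refine h2.trans ?_
    rw [ENNReal.ofReal_mul hc20, ENNReal.ofReal_mul (by positivity), ENNReal.ofReal_natCast,
      mul_assoc, mul_assoc, ← nsmul_eq_mul]
    gcongr
    exact Finset.sum_le_card_nsmul _ _ _ h3
  calc ∫⁻ x, ENNReal.ofReal (energySize hT U (s, x) ^ p) ∂vol
      ≤ ENNReal.ofReal (2 ^ (p - 1)) * (∫⁻ x, ENNReal.ofReal (conormalSum hT 3 U (s, x) ^ p) ∂vol
          + ∫⁻ x, ENNReal.ofReal (wallSum hT U 2 (s, x) ^ p) ∂vol) :=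
        lintegral_add_rpow_le hp (aemeasurable_conormalSum hT U hs 3)
          (aemeasurable_wallSum hT U hs 2) (fun x _ => conormalSum_nonneg hT 3 U _)
          fun x hx => wallSum_nonneg hT hx 2
    _ ≤ ENNReal.ofReal (2 ^ (p - 1)) * (ENNReal.ofReal c1 * lpSum hT p 3 U s
          + ENNReal.ofReal (c2 * ((multiIndices 2).card * (2 ^ p * (C ^ p * c1))))
            * lpSum hT p 3 U s) := by gcongr
    _ = _ := by
        rw [← add_mul, ← mul_assoc, ← ENNReal.ofReal_add hc10 (by positivity),
          ← ENNReal.ofReal_mul (by positivity)]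
        rfl

lemma lintegral_mul_rpow_le {p : ℝ} (hp : 2 < p) (hs : s ∈ Icc 0 T) (f r : Fin 3 → smoothRing T)
    {N M : ℝ≥0∞} (hN : ∫⁻ x, ENNReal.ofReal (‖slice f s x‖ ^ p) ∂vol ≤ N ^ p)
    (hM : ∫⁻ x, ENNReal.ofReal (‖slice r s x‖ ^ p) ∂vol ≤ M ^ p) :
    ∫⁻ x, ENNReal.ofReal (‖slice f s x‖ ^ (p - 1) * ‖slice r s x‖) ∂vol ≤ N ^ (p - 1) * M := by
  have hp0 : 0 < p := by linarith
  have hp1 : 0 < p - 1 := by linarith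
  have hpq : p.HolderConjugate (p / (p - 1)) := Real.HolderConjugate.conjExponent (by linarith)
  have h1 := ENNReal.lintegral_mul_le_Lp_mul_Lq vol hpq.symm
    ((aemeasurable_norm_slice hs f).pow_const (p - 1)).ennreal_ofReal
    (aemeasurable_norm_slice hs r).ennreal_ofReal
  have e1 : ∀ x, ENNReal.ofReal (‖slice f s x‖ ^ (p - 1)) ^ (p / (p - 1))
      = ENNReal.ofReal (‖slice f s x‖ ^ p) := by
    intro x
    rw [ENNReal.ofReal_rpow_of_nonneg (by positivity) (by positivity), ← Real.rpow_mul (norm_nonneg _),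
      mul_div_cancel₀ _ hp1.ne']
  have e2 : ∀ x, ENNReal.ofReal ‖slice r s x‖ ^ p = ENNReal.ofReal (‖slice r s x‖ ^ p) := fun x =>
    ENNReal.ofReal_rpow_of_nonneg (norm_nonneg _) hp0.le
  simp only [e1, e2, Pi.mul_apply] at h1
  calc _ = ∫⁻ x, ENNReal.ofReal (‖slice f s x‖ ^ (p - 1)) * ENNReal.ofReal ‖slice r s x‖ ∂vol := by
        refine lintegral_congr fun x => ENNReal.ofReal_mul (by positivity)
    _ ≤ _ := h1
    _ ≤ (N ^ p) ^ (1 / (p / (p - 1))) * (M ^ p) ^ (1 / p) := by gcongr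
    _ = _ := by
        rw [← ENNReal.rpow_mul, ← ENNReal.rpow_mul, mul_one_div_cancel hp0.ne', ENNReal.rpow_one]
        congr 2
        field_simp

end

end ConormalNS

namespace ConormalNS

/-! ### The right-hand side of the energy inequality -/

lemma ofReal_conormalSum_le {T : ℝ} (hT : 0 < T) {V : E3 → E3} {U : Fin 3 → smoothRing T} {s : ℝ}
    (hs : s ∈ Icc 0 T) (hV : EqOn V (slice U s) halfSpace) (m : ℕ) {x : E3} (hx : x ∈ halfSpace) :
    ENNReal.ofReal (conormalSum hT m U (s, x)) ≤ conormalSupNorm m V := by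
  rw [conormalSum, ENNReal.ofReal_sum_of_nonneg fun _ _ => norm_nonneg _]
  exact Finset.sum_le_sum fun δ _ =>
    enorm_slice_le hs (conormalDeriv_eqOn_slice hT hs hV δ) hx

lemma ofReal_sum_norm_pd_le {T : ℝ} (hT : 0 < T) {V : E3 → E3} {U : Fin 3 → smoothRing T} {s : ℝ}
    (hs : s ∈ Icc 0 T) (hV : EqOn V (slice U s) halfSpace) {x : E3} (hx : x ∈ halfSpace) :
    ENNReal.ofReal (∑ j, ‖slice (fun k => (slabRing hT).d j (U k)) s x‖) ≤ lipNorm V := by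
  rw [ENNReal.ofReal_sum_of_nonneg fun _ _ => norm_nonneg _]
  exact (Finset.sum_le_sum fun j _ => enorm_slice_le hs (pd_eqOn_slice hT hs hV j) hx).trans
    le_add_self

lemma exists_lintegral_energySource_le {p C₀ C₁ : ℝ} (hp : 2 < p) (hC₀ : 0 ≤ C₀) (hC₁ : 0 ≤ C₁) :
    ∃ C : ℝ≥0, ∀ {ν μ T : ℝ} {u₀ : E3 → E3} {u : ℝ → E3 → E3} {q : ℝ → E3 → ℝ}, 0 ≤ ν →
      ∀ (hT : 0 < T) (h : IsSmoothSolution ν μ T u₀ u q) (r : Fin 3 → smoothRing T)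
        {α : Fin 3 → ℕ}, ∑ i, α i ≤ 3 → ∀ {s : ℝ}, s ∈ Icc 0 T →
      (∀ x ∈ halfSpace, ‖slice r s x‖
        ≤ C₁ * (supSize hT h.velocity (s, x) * energySize hT h.velocity (s, x))
          + ‖slice (fun k => (slabRing hT).Zpow α ((slabRing hT).d k h.pressure)) s x‖) →
      ∫⁻ x, ENNReal.ofReal (energySource p C₀ ν (fun k => (slabRing hT).Zpow α (h.velocity k)) r
          h.velocity (conormalSum hT 2 fun k => (slabRing hT).d 2 (h.velocity k)) (s, x)) ∂vol
        ≤ C * (conormalNorm 3 p (u s) ^ p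
          + ((conormalNorm 3 p (u s) ^ p * (conormalSupNorm 2 (u s) + lipNorm (u s))
              + conormalNorm 3 p (u s) ^ (p - 1) * conormalNorm 3 p (gradient (q s)))
            + ENNReal.ofReal (ν ^ (p / 2)) * conormalNorm 2 p (pd 2 (u s)) ^ p)) := by
  obtain ⟨CS, hCS, HS⟩ := exists_supSize_le
  obtain ⟨CH, HH⟩ := exists_lintegral_energySize_le hp
  have hp0 : 0 < p := by linarith
  set cG : ℝ := (multiIndices 2).card ^ (p - 1) with hcG
  -- 3C₀ comes from ∑|u_j| ≤ 3M, p C₁ CS from the convection commutators, and p from the pressure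
  -- term.
  set C₃ : ℝ := 3 * C₀ + p * (C₁ * CS) + p + 1 with hC₃
  have hC₃0 : 0 < C₃ := by positivity
  refine ⟨C₃.toNNReal * (CH + cG.toNNReal + 1), ?_⟩
  intro ν μ T u₀ u q hν hT h r α hα s hs hr
  set U := h.velocity with hU
  set f : Fin 3 → smoothRing T := fun k => (slabRing hT).Zpow α (U k) with hf
  set g := conormalSum hT 2 fun k => (slabRing hT).d 2 (U k) with hg
  set Q : Fin 3 → smoothRing T := fun k => (slabRing hT).Zpow α ((slabRing hT).d k h.pressure) with hQ
  set N := conormalNorm 3 p (u s) with hN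
  set NQ := conormalNorm 3 p (gradient (q s)) with hNQ
  set Sup := conormalSupNorm 2 (u s) + lipNorm (u s) with hSup
  set G := conormalNorm 2 p (pd 2 (u s)) ^ p with hG
  have hus : EqOn (u s) (slice U s) halfSpace := fun _ _ => rfl
  have eN : N ^ p = lpSum hT p 3 U s := conormalNorm_rpow hT hp hs hus 3
  have eG : G = lpSum hT p 2 (fun k => (slabRing hT).d 2 (U k)) s :=
    conormalNorm_rpow hT hp hs (pd_eqOn_slice hT hs hus 2) 2
  have hfN : ∫⁻ x, ENNReal.ofReal (‖slice f s x‖ ^ p) ∂vol ≤ N ^ p := by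
    rw [eN]
    exact Finset.single_le_sum (f := fun α => ∫⁻ x, ENNReal.ofReal
      (‖slice (fun k => (slabRing hT).Zpow α (U k)) s x‖ ^ p) ∂vol) (fun _ _ => zero_le)
      (mem_multiIndices.2 hα)
  have hQN : ∫⁻ x, ENNReal.ofReal (‖slice Q s x‖ ^ p) ∂vol ≤ NQ ^ p := by
    rw [hNQ, conormalNorm_rpow hT hp hs (h.gradient_eqOn_slice hT hs) 3]
    exact Finset.single_le_sum (f := fun α => ∫⁻ x, ENNReal.ofReal
      (‖slice (fun k => (slabRing hT).Zpow α ((slabRing hT).d k h.pressure)) s x‖ ^ p) ∂vol)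
      (fun _ _ => zero_le) (mem_multiIndices.2 hα)
  have hgG : ∫⁻ x, ENNReal.ofReal (g (s, x) ^ p) ∂vol ≤ ENNReal.ofReal cG * G := by
    rw [eG]
    exact lintegral_conormalSum_rpow_le hT _ hp hs 2
  have hg0 : ∀ y, 0 ≤ g y := conormalSum_nonneg hT 2 _
  have hνp : 0 ≤ ν ^ (p / 2) := Real.rpow_nonneg hν _
  have hgν : ∫⁻ x, ENNReal.ofReal (ν ^ (p / 2) * g (s, x) ^ p) ∂vol
      ≤ ENNReal.ofReal cG * (ENNReal.ofReal (ν ^ (p / 2)) * G) := by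
    simp only [ENNReal.ofReal_mul hνp]
    rw [lintegral_const_mul' _ _ ENNReal.ofReal_ne_top, mul_left_comm]
    gcongr
  have hCne : ((C₃.toNNReal * (CH + cG.toNNReal + 1) : ℝ≥0) : ℝ≥0∞) ≠ 0 := by
    have : 0 < C₃.toNNReal := Real.toNNReal_pos.2 hC₃0
    positivity
  -- With 0·∞ = 0 an infinite sup norm does not help when ‖u‖_{3,p} = 0. In that case f = 0 almost
  -- everywhere and only the viscous source survives.
  by_cases hN0 : N ^ p = 0
  · have hf0 : ∀ᵐ x ∂vol, ‖slice f s x‖ = 0 := by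
      have h1 := (lintegral_eq_zero_iff'
        ((aemeasurable_norm_slice hs f).pow_const p).ennreal_ofReal).1 (le_antisymm (hfN.trans_eq hN0) zero_le)
      filter_upwards [h1] with x hx
      have h2 : ‖slice f s x‖ ^ p ≤ 0 := ENNReal.ofReal_eq_zero.1 hx
      by_contra h3
      exact absurd h2 (not_le.2 (Real.rpow_pos_of_pos (lt_of_le_of_ne (norm_nonneg _) (Ne.symm h3)) p))
    calc _ ≤ ∫⁻ x, ENNReal.ofReal C₃ * ENNReal.ofReal (ν ^ (p / 2) * g (s, x) ^ p) ∂vol := by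
          refine lintegral_mono_ae ?_
          filter_upwards [hf0] with x hx
          rw [← ENNReal.ofReal_mul hC₃0.le]
          refine ENNReal.ofReal_le_ofReal ?_
          simp only [energySource, hx, Real.zero_rpow hp0.ne',
            Real.zero_rpow (by linarith : p - 1 ≠ 0), zero_mul, mul_zero, zero_add, add_zero]
          refine mul_le_mul_of_nonneg_right ?_ (mul_nonneg hνp (Real.rpow_nonneg (hg0 _) _))
          rw [hC₃]
          nlinarith [mul_nonneg hp0.le (mul_nonneg hC₁ hCS)]
      _ ≤ ENNReal.ofReal C₃ * (ENNReal.ofReal cG * (ENNReal.ofReal (ν ^ (p / 2)) * G)) := by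
          rw [lintegral_const_mul' _ _ ENNReal.ofReal_ne_top]
          gcongr
      _ ≤ _ := by
          rw [← mul_assoc]
          push_cast
          have k1 : ENNReal.ofReal cG ≤ (CH : ℝ≥0∞) + ENNReal.ofReal cG + 1 :=
            le_add_self.trans le_self_add
          have k2 : ENNReal.ofReal (ν ^ (p / 2)) * G
              ≤ N ^ p + ((N ^ p * Sup + N ^ (p - 1) * NQ) + ENNReal.ofReal (ν ^ (p / 2)) * G) :=
            le_add_self.trans le_add_self
          exact mul_le_mul' (mul_le_mul' le_rfl k1) k2
  -- Now ‖u‖_{3,p} is nonzero, so an infinite sup norm makes the right side infinite; otherwise it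
  -- can be treated as a real number.
  by_cases hSt : Sup = ⊤
  · rw [hSt, ENNReal.mul_top hN0, top_add, top_add, add_top, ENNReal.mul_top hCne]
    exact le_top
  set M := Sup.toReal with hM
  have b1 : ∀ x ∈ halfSpace, conormalSum hT 2 U (s, x) ≤ M := fun x hx =>
    (ENNReal.ofReal_le_iff_le_toReal hSt).1 ((ofReal_conormalSum_le hT hs hus 2 hx).trans le_self_add)
  have b2 : ∀ x ∈ halfSpace, ∑ j, ‖slice (fun k => (slabRing hT).d j (U k)) s x‖ ≤ M := fun x hx =>
    (ENNReal.ofReal_le_iff_le_toReal hSt).1 ((ofReal_sum_norm_pd_le hT hs hus hx).trans le_add_self)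
  have b3 := HS hT U (h.div_velocity hT) (h.vanishesAtBoundary_velocity hT) hs b1 b2
  have hM0 : 0 ≤ M := ENNReal.toReal_nonneg
  have hpt : ∀ x ∈ halfSpace, energySource p C₀ ν f r U g (s, x)
      ≤ C₃ * (energySize hT U (s, x) ^ p + (M * energySize hT U (s, x) ^ p
        + (‖slice f s x‖ ^ (p - 1) * ‖slice Q s x‖ + ν ^ (p / 2) * g (s, x) ^ p))) := by
    intro x hx
    set H := energySize hT U (s, x) with hH
    have hfH : ‖slice f s x‖ ≤ H :=
      (norm_slice_le_conormalSum hT U s x hα).trans (conormalSum_le_energySize hT hx)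
    have hH0 : 0 ≤ H := (norm_nonneg _).trans hfH
    have hfp : ‖slice f s x‖ ^ p ≤ H ^ p := Real.rpow_le_rpow (norm_nonneg _) hfH hp0.le
    have hfp1 : ‖slice f s x‖ ^ (p - 1) * H ≤ H ^ p := by
      calc _ ≤ H ^ (p - 1) * H := mul_le_mul_of_nonneg_right
            (Real.rpow_le_rpow (norm_nonneg _) hfH (by linarith)) hH0
        _ = H ^ p := by
            rw [← Real.rpow_add_one' hH0 (by linarith)]
            congr 1
            ring
    have hUM : ∑ j, |(U j).1 (s, x)| ≤ 3 * M := by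
      have : ∀ j, |(U j).1 (s, x)| ≤ M := fun j => by
        have := abs_Zpow_le_conormalSum hT (U := U) (m := 2) (δ := 0) (by simp) (s, x) j
        rw [ConormalRing.Zpow_zero] at this
        exact this.trans (b1 x hx)
      rw [Fin.sum_univ_three]
      linarith [this 0, this 1, this 2]
    have hr' : ‖slice r s x‖ ≤ C₁ * (CS * M * H) + ‖slice Q s x‖ :=
      (hr x hx).trans (add_le_add (mul_le_mul_of_nonneg_left
        (mul_le_mul_of_nonneg_right (b3 x hx) hH0) hC₁) le_rfl)
    have hfn : 0 ≤ ‖slice f s x‖ ^ (p - 1) := by positivity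
    set a := ‖slice f s x‖ ^ (p - 1) with ha
    have hHp : 0 ≤ H ^ p := by positivity
    have t1 : ‖slice f s x‖ ^ p * (1 + ∑ j, |(U j).1 (s, x)|) ≤ H ^ p * (1 + 3 * M) :=
      mul_le_mul hfp (by linarith)
        (add_nonneg zero_le_one (Finset.sum_nonneg fun j _ => abs_nonneg _)) hHp
    have t2 : a * ‖slice r s x‖ ≤ C₁ * CS * (M * H ^ p) + a * ‖slice Q s x‖ := by
      calc a * ‖slice r s x‖ ≤ a * (C₁ * (CS * M * H) + ‖slice Q s x‖) :=
            mul_le_mul_of_nonneg_left hr' hfn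
        _ = C₁ * CS * M * (a * H) + a * ‖slice Q s x‖ := by ring
        _ ≤ C₁ * CS * M * H ^ p + a * ‖slice Q s x‖ := by gcongr
        _ = _ := by ring
    have hMH : 0 ≤ M * H ^ p := by positivity
    have haQ : 0 ≤ a * ‖slice Q s x‖ := by positivity
    have hνg : 0 ≤ ν ^ (p / 2) * g (s, x) ^ p := mul_nonneg hνp (Real.rpow_nonneg (hg0 _) _)
    have hCC : 0 ≤ p * (C₁ * CS) := by positivity
    simp only [energySource]
    have t3 := mul_le_mul_of_nonneg_left t1 hC₀
    have t4 := mul_le_mul_of_nonneg_left t2 hp0.le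
    calc _ ≤ C₀ * (H ^ p * (1 + 3 * M)) + C₀ * (ν ^ (p / 2) * g (s, x) ^ p)
          + p * (C₁ * CS * (M * H ^ p) + a * ‖slice Q s x‖) := by gcongr
      _ = C₀ * H ^ p + (3 * C₀ + p * (C₁ * CS)) * (M * H ^ p)
          + p * (a * ‖slice Q s x‖) + C₀ * (ν ^ (p / 2) * g (s, x) ^ p) := by ring
      _ ≤ C₃ * H ^ p + C₃ * (M * H ^ p) + C₃ * (a * ‖slice Q s x‖)
          + C₃ * (ν ^ (p / 2) * g (s, x) ^ p) := by
            gcongr <;> rw [hC₃] <;> linarith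
      _ = _ := by ring
  have mH : AEMeasurable (fun x => energySize hT U (s, x)) vol :=
    (aemeasurable_conormalSum hT U hs 3).add (aemeasurable_wallSum hT U hs 2)
  have mg : AEMeasurable (fun x => g (s, x)) vol := aemeasurable_conormalSum hT _ hs 2
  have hH := HH hT U (h.div_velocity hT) (h.vanishesAtBoundary_velocity hT) hs
  rw [← eN] at hH
  calc _ ≤ ∫⁻ x, ENNReal.ofReal C₃ * (ENNReal.ofReal (energySize hT U (s, x) ^ p)
          + (Sup * ENNReal.ofReal (energySize hT U (s, x) ^ p)
          + (ENNReal.ofReal (‖slice f s x‖ ^ (p - 1) * ‖slice Q s x‖)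
            + ENNReal.ofReal (ν ^ (p / 2) * g (s, x) ^ p)))) ∂vol := by
        refine lintegral_vol_mono fun x hx => ?_
        have e0 : 0 ≤ energySize hT U (s, x) ^ p := Real.rpow_nonneg (energySize_nonneg hT hx) _
        have e1 : 0 ≤ ‖slice f s x‖ ^ (p - 1) * ‖slice Q s x‖ := by positivity
        have e2 : 0 ≤ ν ^ (p / 2) * g (s, x) ^ p := mul_nonneg hνp (Real.rpow_nonneg (hg0 _) _)
        have e3 : 0 ≤ M * energySize hT U (s, x) ^ p := mul_nonneg hM0 e0
        rw [← ENNReal.ofReal_toReal hSt, ← hM, ← ENNReal.ofReal_mul hM0,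
          ← ENNReal.ofReal_add e1 e2, ← ENNReal.ofReal_add e3 (add_nonneg e1 e2),
          ← ENNReal.ofReal_add e0 (add_nonneg e3 (add_nonneg e1 e2)), ← ENNReal.ofReal_mul hC₃0.le]
        exact ENNReal.ofReal_le_ofReal (hpt x hx)
    _ = ENNReal.ofReal C₃ * (∫⁻ x, ENNReal.ofReal (energySize hT U (s, x) ^ p) ∂vol
          + (Sup * ∫⁻ x, ENNReal.ofReal (energySize hT U (s, x) ^ p) ∂vol
          + (∫⁻ x, ENNReal.ofReal (‖slice f s x‖ ^ (p - 1) * ‖slice Q s x‖) ∂vol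
            + ∫⁻ x, ENNReal.ofReal (ν ^ (p / 2) * g (s, x) ^ p) ∂vol))) := by
        rw [lintegral_const_mul' _ _ ENNReal.ofReal_ne_top,
          lintegral_add_left' (mH.pow_const p).ennreal_ofReal,
          lintegral_add_left' ((mH.pow_const p).ennreal_ofReal.const_mul _),
          lintegral_add_right' _ ((mg.pow_const p).const_mul _).ennreal_ofReal,
          lintegral_const_mul' _ _ hSt]
    _ ≤ ENNReal.ofReal C₃ * (CH * N ^ p + (Sup * (CH * N ^ p) + (N ^ (p - 1) * NQ
            + ENNReal.ofReal cG * (ENNReal.ofReal (ν ^ (p / 2)) * G)))) := by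
        gcongr
        exact lintegral_mul_rpow_le hp hs f Q hfN hQN
    _ ≤ ENNReal.ofReal C₃ * ((CH + ENNReal.ofReal cG + 1) * N ^ p
          + ((CH + ENNReal.ofReal cG + 1) * (N ^ p * Sup) + ((CH + ENNReal.ofReal cG + 1)
            * (N ^ (p - 1) * NQ)
            + (CH + ENNReal.ofReal cG + 1) * (ENNReal.ofReal (ν ^ (p / 2)) * G)))) := by
        have k1 : (CH : ℝ≥0∞) ≤ CH + ENNReal.ofReal cG + 1 := by
          rw [add_assoc]; exact le_self_add
        have k2 : (1 : ℝ≥0∞) ≤ CH + ENNReal.ofReal cG + 1 := le_add_self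
        have k3 : ENNReal.ofReal cG ≤ CH + ENNReal.ofReal cG + 1 := le_add_self.trans le_self_add
        have k4 : Sup * (CH * N ^ p) = CH * (N ^ p * Sup) := by ring
        rw [k4]
        refine mul_le_mul' le_rfl (add_le_add (mul_le_mul' k1 le_rfl) (add_le_add
          (mul_le_mul' k1 le_rfl) (add_le_add (le_mul_of_one_le_left zero_le k2)
          (mul_le_mul' k3 le_rfl))))
    _ = _ := by
        push_cast
        change _ = ENNReal.ofReal C₃ * (CH + ENNReal.ofReal cG + 1) * _
        ring

/-! ### The dissipation -/

lemma norm_pd_norm_rpow_le {V : E3 → E3} {x : E3} (hV : DifferentiableAt ℝ V x) {r : ℝ} (hr : 1 < r)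
    (i : Fin 3) :
    ‖pd i (fun y => ‖V y‖ ^ r) x‖ ≤ r * ‖V x‖ ^ (r - 1) * ‖pd i V x‖ := by
  have h1 := (hasFDerivAt_norm_rpow (V x) hr).comp x hV.hasFDerivAt
  have h2 : pd i (fun y => ‖V y‖ ^ r) x
      = r * ‖V x‖ ^ (r - 2) * inner ℝ (V x) (pd i V x) := by
    have h3 : fderiv ℝ (fun y => ‖V y‖ ^ r) x = _ := h1.fderiv
    rw [pd, h3]
    rfl
  rw [h2, norm_mul, Real.norm_of_nonneg (by positivity)]
  have h4 : ‖V x‖ ^ (r - 2) * ‖V x‖ ≤ ‖V x‖ ^ (r - 1) := by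
    by_cases h0 : ‖V x‖ = 0
    · rw [h0, mul_zero]
      positivity
    · rw [← Real.rpow_add_one h0]
      exact le_of_eq (by congr 1; ring)
  calc r * ‖V x‖ ^ (r - 2) * ‖inner ℝ (V x) (pd i V x)‖
      ≤ r * ‖V x‖ ^ (r - 2) * (‖V x‖ * ‖pd i V x‖) := by
        gcongr
        exact norm_inner_le_norm _ _
    _ = r * (‖V x‖ ^ (r - 2) * ‖V x‖) * ‖pd i V x‖ := by ring
    _ ≤ _ := by gcongr

/-- Since p/2 > 1, |V|^{p/2} is differentiable even at zeros of V, and the chain rule bounds its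
squared gradient by (p²/4)|V|^{p-2}|∇V|². Both dissipation terms are thus controlled by the first.
-/
lemma dissipationDensity_le {T : ℝ} (hT : 0 < T) {p : ℝ} (hp : 2 < p) {V : E3 → E3}
    {f : Fin 3 → smoothRing T} {s : ℝ} (hs : s ∈ Icc 0 T) (hV : EqOn V (slice f s) halfSpace)
    {x : E3} (hx : x ∈ halfSpace) :
    dissipationDensity p V x ≤ (1 + p ^ 2 / 4) * dissipation hT p f (s, x) := by
  have hd : DifferentiableAt ℝ V x := by
    obtain ⟨L, hL, _⟩ := hasFDerivAt_slice_vec hT f hs hx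
    exact hL.differentiableAt.congr_of_eventuallyEq
      (Filter.mem_of_superset (isOpen_halfSpace.mem_nhds hx) hV)
  have h1 : gradSq (fun y => ‖V y‖ ^ (p / 2)) x ≤ (p ^ 2 / 4) * (gradSq V x * ‖V x‖ ^ (p - 2)) := by
    simp only [gradSq, Finset.sum_mul, Finset.mul_sum]
    refine Finset.sum_le_sum fun i _ => ?_
    have h2 := pow_le_pow_left₀ (norm_nonneg _)
      (norm_pd_norm_rpow_le hd (by linarith : 1 < p / 2) i) 2
    refine h2.trans (le_of_eq ?_)
    rw [mul_pow, mul_pow, ← Real.rpow_natCast (‖V x‖ ^ (p / 2 - 1)), ← Real.rpow_mul (norm_nonneg _)]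
    have e : (p / 2 - 1) * ((2 : ℕ) : ℝ) = p - 2 := by push_cast; ring
    rw [e]
    ring
  have h2 : dissipation hT p f (s, x) = gradSq V x * ‖V x‖ ^ (p - 2) := by
    simp only [dissipation, gradSq, hV hx, pd_eqOn_slice hT hs hV _ hx]
    ring
  rw [h2, dissipationDensity]
  linarith

/-! ### Gronwall's inequality -/

/-- No continuity or measurability of F is required. On a time step short enough for K times its
length to be at most 1/2, the integral term is absorbed. With y(s) the integral of F up to s, each
step at most doubles y + 2a, and finiteness of the integral justifies the subtraction. -/
lemma lintegral_gronwall {F : ℝ → ℝ≥0∞} {a : ℝ≥0∞} {K : ℕ} {t : ℝ} (ht0 : 0 ≤ t) (ht1 : t ≤ 1)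
    (hF : ∀ s ∈ Icc 0 t, F s ≤ a + K * ∫⁻ r in Icc 0 s, F r)
    (hfin : ∫⁻ r in Icc 0 t, F r ≠ ⊤) :
    ∫⁻ r in Icc 0 t, F r ≤ 2 ^ (2 * K + 2) * a := by
  rcases eq_or_ne a ⊤ with rfl | ha
  · rw [ENNReal.mul_top (by positivity)]
    exact le_top
  -- Since t ≤ 1, 2K + 1 equal steps suffice, also when K = 0. Starting from 2a, they lead to
  -- 2^{2K+2} a.
  set n : ℝ := 2 * K + 1 with hn
  have hn0 : 0 < n := by positivity
  set y : ℝ → ℝ≥0∞ := fun s => ∫⁻ r in Icc 0 s, F r with hy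
  have hyfin : ∀ s ≤ t, y s ≠ ⊤ := fun s hs =>
    ne_top_of_le_ne_top hfin (lintegral_mono_set (Icc_subset_Icc_right hs))
  have hδ0 : 0 ≤ t / n := by positivity
  have hδ1 : t / n ≤ 1 := (div_le_one hn0).2 (by rw [hn]; linarith [K.cast_nonneg (α := ℝ)])
  have hδK : t / n * K ≤ 1 / 2 := by
    rw [div_mul_eq_mul_div, div_le_iff₀ hn0, hn]
    nlinarith [K.cast_nonneg (α := ℝ)]
  have key : ∀ k : ℕ, k ≤ 2 * K + 1 → (y (k * (t / n))).toReal + 2 * a.toReal ≤ 2 ^ (k + 1) * a.toReal := by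
    intro k
    induction k with
    | zero => intro _; simp [hy]
    | succ k ih =>
      intro hk
      have ih := ih (by omega)
      set s := (k : ℝ) * (t / n) with hs
      set s' := ((k + 1 : ℕ) : ℝ) * (t / n) with hs'
      have hss : s' = s + t / n := by rw [hs, hs']; push_cast; ring
      have hs0 : 0 ≤ s := by positivity
      have hst : s' ≤ t := by
        have : ((k + 1 : ℕ) : ℝ) ≤ n := by rw [hn]; exact_mod_cast hk
        rw [hs', mul_div_assoc', div_le_iff₀ hn0, mul_comm]
        exact mul_le_mul_of_nonneg_left this ht0
      have h1 : y s' ≤ y s + ENNReal.ofReal (t / n) * (a + K * y s') := by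
        have e : Icc 0 s' = Icc 0 s ∪ Ioc s s' := (Icc_union_Ioc_eq_Icc hs0 (by linarith)).symm
        calc y s' ≤ y s + ∫⁻ r in Ioc s s', F r := by
              simp only [hy]
              rw [e]
              exact lintegral_union_le _ _ _
          _ ≤ y s + ∫⁻ _ in Ioc s s', (a + K * y s') := by
              refine add_le_add le_rfl ?_
              refine setLIntegral_mono' measurableSet_Ioc fun r hr => ?_
              refine (hF r ⟨hs0.trans hr.1.le, hr.2.trans hst⟩).trans ?_
              gcongr
              exact lintegral_mono_set (Icc_subset_Icc_right hr.2)
          _ = _ := by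
              rw [setLIntegral_const, Real.volume_Ioc, hss, add_sub_cancel_left, mul_comm]
      have f1 := hyfin s (by linarith)
      have f2 := hyfin s' hst
      have h2 := ENNReal.toReal_mono (by finiteness) h1
      rw [ENNReal.toReal_add f1 (by finiteness), ENNReal.toReal_mul, ENNReal.toReal_ofReal hδ0,
        ENNReal.toReal_add ha (by finiteness), ENNReal.toReal_mul, ENNReal.toReal_natCast] at h2
      have p1 : 0 ≤ (y s').toReal := ENNReal.toReal_nonneg
      have p2 : 0 ≤ a.toReal := ENNReal.toReal_nonneg
      have h3 := mul_le_mul_of_nonneg_right hδ1 p2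
      have h4 := mul_le_mul_of_nonneg_right hδK p1
      have h5 : (y s').toReal ≤ (y s).toReal + a.toReal + 1 / 2 * (y s').toReal := by linarith
      rw [pow_succ]
      linarith
  have h1 := key (2 * K + 1) le_rfl
  have e : ((2 * K + 1 : ℕ) : ℝ) * (t / n) = t := by
    rw [hn]
    push_cast
    field_simp
  rw [e] at h1
  have h2 : (y t).toReal ≤ (2 ^ (2 * K + 2) * a).toReal := by
    rw [ENNReal.toReal_mul, ENNReal.toReal_pow]
    have : 0 ≤ a.toReal := ENNReal.toReal_nonneg
    simp only [ENNReal.toReal_ofNat]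
    linarith
  exact (ENNReal.toReal_le_toReal hfin (by finiteness)).1 h2

end ConormalNS

namespace ConormalNS

/-! ### The conormal energy estimate -/

/-- The source terms of the conormal energy estimate, apart from the viscous one. -/
noncomputable def convectionSource (p : ℝ) (u : ℝ → E3 → E3) (q : ℝ → E3 → ℝ) (s : ℝ) : ℝ≥0∞ :=
  conormalNorm 3 p (u s) ^ p * (conormalSupNorm 2 (u s) + lipNorm (u s))
    + conormalNorm 3 p (u s) ^ (p - 1) * conormalNorm 3 p (gradient (q s))

/-- The order restriction stands after the constant so that constants can be chosen for all α at
once; for |α| > 3 the claim is vacuous. -/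
lemma exists_energy_estimate (μ : ℝ) {νbar p : ℝ} (hνbar : 0 < νbar) (hp : 2 < p) (α : Fin 3 → ℕ) :
    ∃ C : ℝ≥0, ∑ i, α i ≤ 3 → ∀ {ν T : ℝ} {u₀ : E3 → E3} {u : ℝ → E3 → E3} {q : ℝ → E3 → ℝ},
      0 ≤ ν → ν ≤ νbar → ∀ (hT : 0 < T) (h : IsSmoothSolution ν μ T u₀ u q) {t : ℝ},
      t ∈ Icc 0 T →
      ∫⁻ x, ENNReal.ofReal (‖slice (fun k => (slabRing hT).Zpow α (h.velocity k)) t x‖ ^ p) ∂vol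
        + ENNReal.ofReal (ν * (p / 2)) * ∫⁻ s in Icc 0 t, ∫⁻ x, ENNReal.ofReal
          (dissipation hT p (fun k => (slabRing hT).Zpow α (h.velocity k)) (s, x)) ∂vol
      ≤ ∫⁻ x, ENNReal.ofReal
          (‖slice (fun k => (slabRing hT).Zpow α (h.velocity k)) 0 x‖ ^ p) ∂vol
        + C * ∫⁻ s in Icc 0 t, (conormalNorm 3 p (u s) ^ p + (convectionSource p u q s
            + ENNReal.ofReal (ν ^ (p / 2)) * conormalNorm 2 p (pd 2 (u s)) ^ p)) := by
  by_cases hα : ∑ i, α i ≤ 3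
  · obtain ⟨K, R, hK, hR, hsys⟩ := exists_isTransportDiffusion μ hα
    obtain ⟨C₀, hC₀, hbound⟩ := exists_energy_density_bound (E := E3) hp hνbar.le hK
    obtain ⟨C₁, hC₁, hconv⟩ := exists_convection_bound hα hR
    obtain ⟨C, hC⟩ := exists_lintegral_energySource_le hp hC₀ hC₁
    refine ⟨C, fun _ => ?_⟩
    intro ν T u₀ u q hν hνb hT h t ht
    obtain ⟨A, B, hAB⟩ := hsys hT h
    refine (energy_inequality hp hAB hν hνb hbound ht).trans (add_le_add le_rfl ?_)
    rw [← lintegral_const_mul' _ _ ENNReal.coe_ne_top]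
    refine setLIntegral_mono' measurableSet_Icc fun s hs => ?_
    have hsT : s ∈ Icc 0 T := ⟨hs.1, hs.2.trans ht.2⟩
    exact hC hν hT h _ hα hsT fun x hx => hconv hT h.velocity _ hsT hx
  · exact ⟨0, fun h => absurd h hα⟩

lemma aemeasurable_lpSum {T : ℝ} (hT : 0 < T) {p : ℝ} (hp : 2 < p) (m : ℕ) (U : Fin 3 → smoothRing T)
    {t : ℝ} (ht : t ≤ T) : AEMeasurable (lpSum hT p m U) (volume.restrict (Icc 0 t)) := by
  refine Finset.aemeasurable_fun_sum _ fun α _ => ?_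
  have h1 : ContinuousOn (fun y : ℝ × E3 =>
      ‖slice (fun k => (slabRing hT).Zpow α (U k)) y.1 y.2‖ ^ p) (slab T) :=
    (continuousOn_slice_prod _).norm.rpow_const fun _ _ => Or.inr (by linarith)
  exact (aemeasurable_prod ht h1).ennreal_ofReal.lintegral_prod_right'

lemma aemeasurable_conormalNorm_rpow {T : ℝ} (hT : 0 < T) {p : ℝ} (hp : 2 < p) (m : ℕ)
    {V : ℝ → E3 → E3} {U : Fin 3 → smoothRing T}
    (hV : ∀ s ∈ Icc 0 T, EqOn (V s) (slice U s) halfSpace) {t : ℝ} (ht : t ≤ T) :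
    AEMeasurable (fun s => conormalNorm m p (V s) ^ p) (volume.restrict (Icc 0 t)) := by
  refine (aemeasurable_lpSum hT hp m U ht).congr ?_
  filter_upwards [ae_restrict_mem measurableSet_Icc] with s hs
  have hsT : s ∈ Icc 0 T := ⟨hs.1, hs.2.trans ht⟩
  exact (conormalNorm_rpow hT hp hsT (hV s hsT) m).symm

lemma lintegral_dissipationDensity_le {T : ℝ} (hT : 0 < T) {p : ℝ} (hp : 2 < p)
    {V : ℝ → E3 → E3} {f : Fin 3 → smoothRing T}
    (hV : ∀ s ∈ Icc 0 T, EqOn (V s) (slice f s) halfSpace) {t : ℝ} (ht : t ≤ T) :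
    ∫⁻ s in Icc 0 t, ∫⁻ x in halfSpace, ENNReal.ofReal (dissipationDensity p (V s) x)
      ≤ ENNReal.ofReal (1 + p ^ 2 / 4)
        * ∫⁻ s in Icc 0 t, ∫⁻ x, ENNReal.ofReal (dissipation hT p f (s, x)) ∂vol := by
  rw [← lintegral_const_mul' _ _ ENNReal.ofReal_ne_top]
  refine setLIntegral_mono' measurableSet_Icc fun s hs => ?_
  have hsT : s ∈ Icc 0 T := ⟨hs.1, hs.2.trans ht⟩
  rw [← lintegral_const_mul' _ _ ENNReal.ofReal_ne_top]
  refine lintegral_vol_mono fun x hx => ?_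
  rw [← ENNReal.ofReal_mul (by positivity)]
  exact ENNReal.ofReal_le_ofReal (dissipationDensity_le hT hp hsT (hV s hsT) hx)

/-- The energy estimate summed over the conormal derivatives, before Gronwall's inequality. -/
lemma exists_sum_energy_estimate (μ : ℝ) {νbar p : ℝ} (hνbar : 0 < νbar) (hp : 2 < p) :
    ∃ (c₀ : ℝ≥0) (K : ℕ), 0 < c₀ ∧
      ∀ {ν T : ℝ} {u₀ : E3 → E3} {u : ℝ → E3 → E3} {q : ℝ → E3 → ℝ},
      0 ≤ ν → ν ≤ νbar → ∀ (_ : 0 < T) (_ : IsSmoothSolution ν μ T u₀ u q) {t : ℝ},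
      t ∈ Icc 0 T →
      conormalNorm 3 p (u t) ^ p + c₀ * ENNReal.ofReal ν * ∑ α ∈ multiIndices 3,
          ∫⁻ s in Icc 0 t, ∫⁻ x in halfSpace,
            ENNReal.ofReal (dissipationDensity p (conormalDeriv α (u s)) x)
      ≤ conormalNorm 3 p u₀ ^ p + K * ((∫⁻ s in Icc 0 t, conormalNorm 3 p (u s) ^ p)
          + ((∫⁻ s in Icc 0 t, convectionSource p u q s)
            + ENNReal.ofReal (ν ^ (p / 2)) * ∫⁻ s in Icc 0 t, conormalNorm 2 p (pd 2 (u s)) ^ p)) := by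
  choose C hC using fun α => exists_energy_estimate μ hνbar hp α
  have hp0 : 0 < p := by linarith
  have hc : 0 < p / 2 / (1 + p ^ 2 / 4) := by positivity
  -- A natural number is taken because the Gronwall argument uses 2K + 1 time steps.
  obtain ⟨K, hK⟩ := exists_nat_ge (∑ α ∈ multiIndices 3, C α)
  -- The energy inequality gives the coefficient νp/2, and 1 + p²/4 is the loss in
  -- `dissipationDensity_le`.
  refine ⟨(p / 2 / (1 + p ^ 2 / 4)).toNNReal, K, Real.toNNReal_pos.2 hc, ?_⟩
  intro ν T u₀ u q hν hνb hT h t ht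
  have hus : ∀ s, EqOn (u s) (slice h.velocity s) halfSpace := fun _ _ _ => rfl
  set X := ∫⁻ s in Icc 0 t, (conormalNorm 3 p (u s) ^ p + (convectionSource p u q s
    + ENNReal.ofReal (ν ^ (p / 2)) * conormalNorm 2 p (pd 2 (u s)) ^ p)) with hX
  have eX : X = (∫⁻ s in Icc 0 t, conormalNorm 3 p (u s) ^ p)
      + ((∫⁻ s in Icc 0 t, convectionSource p u q s)
        + ENNReal.ofReal (ν ^ (p / 2)) * ∫⁻ s in Icc 0 t, conormalNorm 2 p (pd 2 (u s)) ^ p) := by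
    -- Additivity of the integral needs measurability of only one summand, so measurability in time
    -- is never needed for the convection source.
    rw [hX, lintegral_add_left' (aemeasurable_conormalNorm_rpow hT hp 3 (fun s _ => hus s) ht.2),
      lintegral_add_right' _ ((aemeasurable_conormalNorm_rpow hT hp 2
        (fun s hs => pd_eqOn_slice hT hs (hus s) 2) ht.2).const_mul _),
      lintegral_const_mul' _ _ ENNReal.ofReal_ne_top]
  have hdiss : ((p / 2 / (1 + p ^ 2 / 4)).toNNReal : ℝ≥0∞) * ENNReal.ofReal ν
      * ∑ α ∈ multiIndices 3, ∫⁻ s in Icc 0 t, ∫⁻ x in halfSpace,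
            ENNReal.ofReal (dissipationDensity p (conormalDeriv α (u s)) x)
      ≤ ∑ α ∈ multiIndices 3, ENNReal.ofReal (ν * (p / 2)) * ∫⁻ s in Icc 0 t, ∫⁻ x, ENNReal.ofReal
          (dissipation hT p (fun k => (slabRing hT).Zpow α (h.velocity k)) (s, x)) ∂vol := by
    rw [Finset.mul_sum]
    refine Finset.sum_le_sum fun α _ => ?_
    refine (mul_le_mul' le_rfl (lintegral_dissipationDensity_le hT hp
      (fun s hs => conormalDeriv_eqOn_slice hT hs (hus s) α) ht.2)).trans (le_of_eq ?_)
    change ENNReal.ofReal (p / 2 / (1 + p ^ 2 / 4)) * _ * _ = _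
    rw [← mul_assoc, ← ENNReal.ofReal_mul hc.le, ← ENNReal.ofReal_mul (by positivity)]
    congr 2
    field_simp
  rw [← eX, conormalNorm_rpow hT hp ht (hus t) 3,
    conormalNorm_rpow hT hp ⟨le_rfl, hT.le⟩ h.initial_eqOn_slice 3]
  refine (add_le_add le_rfl hdiss).trans ?_
  rw [← Finset.sum_add_distrib]
  refine (Finset.sum_le_sum fun α hα => hC α (mem_multiIndices.1 hα) hν hνb hT h ht).trans ?_
  rw [Finset.sum_add_distrib, ← Finset.sum_mul]
  refine add_le_add le_rfl (mul_le_mul' ?_ le_rfl)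
  exact_mod_cast hK

end ConormalNS

theorem propositionP (μ νbar p : ℝ) (hνbar : 0 < νbar) (hp : 2 < p) :
    ∃ c₀ C : ℝ≥0, 0 < c₀ ∧ 0 < C ∧
      ∀ (ν T : ℝ) (u₀ : ConormalNS.E3 → ConormalNS.E3)
        (u : ℝ → ConormalNS.E3 → ConormalNS.E3) (q : ℝ → ConormalNS.E3 → ℝ),
        0 ≤ ν → ν ≤ νbar → 0 < T → T ≤ 1 →
        ConormalNS.IsSmoothSolution ν μ T u₀ u q →
        (∫⁻ s in Icc 0 T, ConormalNS.conormalNorm 3 p (u s) ^ p) ≠ ⊤ →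
        ∀ t ∈ Icc 0 T,
          ConormalNS.conormalNorm 3 p (u t) ^ p
            + c₀ * ENNReal.ofReal ν * ∑ α ∈ ConormalNS.multiIndices 3,
                ∫⁻ s in Icc 0 t, ∫⁻ x in ConormalNS.halfSpace,
                  ENNReal.ofReal
                    (ConormalNS.dissipationDensity p (ConormalNS.conormalDeriv α (u s)) x)
          ≤ C * (ConormalNS.conormalNorm 3 p u₀ ^ p
            + (∫⁻ s in Icc 0 t,
                (ConormalNS.conormalNorm 3 p (u s) ^ p
                    * (ConormalNS.conormalSupNorm 2 (u s) + ConormalNS.lipNorm (u s))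
                  + ConormalNS.conormalNorm 3 p (u s) ^ (p - 1)
                    * ConormalNS.conormalNorm 3 p (gradient (q s))))
            + ENNReal.ofReal (ν ^ (p / 2))
                * ∫⁻ s in Icc 0 t, ConormalNS.conormalNorm 2 p (ConormalNS.pd 2 (u s)) ^ p) := by
  obtain ⟨c₀, K, hc₀, hmain⟩ := ConormalNS.exists_sum_energy_estimate μ hνbar hp
  -- The first factor is the effect of inserting Gronwall's bound into the energy estimate; the
  -- second gives the initial and source terms a common coefficient.
  refine ⟨c₀, (1 + K * 2 ^ (2 * K + 2)) * (1 + K), hc₀, by positivity, ?_⟩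
  intro ν T u₀ u q hν hνb hT hT1 h hfin t ht
  change _ ≤ _ * (_ + (∫⁻ s in Icc 0 t, ConormalNS.convectionSource p u q s) + _)
  set Y : ℝ → ℝ≥0∞ := fun t => (∫⁻ s in Icc 0 t, ConormalNS.convectionSource p u q s)
    + ENNReal.ofReal (ν ^ (p / 2))
      * ∫⁻ s in Icc 0 t, ConormalNS.conormalNorm 2 p (ConormalNS.pd 2 (u s)) ^ p with hY
  set E₀ := ConormalNS.conormalNorm 3 p u₀ ^ p with hE₀
  set F : ℝ → ℝ≥0∞ := fun s => ConormalNS.conormalNorm 3 p (u s) ^ p with hF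
  -- The source integral increases with time, so its value at t is an admissible constant in
  -- Gronwall's inequality on [0, t].
  have hYmono : ∀ s ≤ t, Y s ≤ Y t := fun s hs => add_le_add
    (lintegral_mono_set (Icc_subset_Icc_right hs))
    (mul_le_mul' le_rfl (lintegral_mono_set (Icc_subset_Icc_right hs)))
  have hgron : ∫⁻ s in Icc 0 t, F s ≤ 2 ^ (2 * K + 2) * (E₀ + K * Y t) := by
    refine ConormalNS.lintegral_gronwall ht.1 (ht.2.trans hT1) ?_
      (ne_top_of_le_ne_top hfin (lintegral_mono_set (Icc_subset_Icc_right ht.2)))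
    intro s hs
    refine (le_self_add.trans (hmain hν hνb hT h ⟨hs.1, hs.2.trans ht.2⟩)).trans ?_
    rw [mul_add, add_comm (_ * _), ← add_assoc]
    exact add_le_add (add_le_add le_rfl (mul_le_mul' le_rfl (hYmono s hs.2))) le_rfl
  refine (hmain hν hνb hT h ht).trans ?_
  calc E₀ + K * ((∫⁻ s in Icc 0 t, F s) + Y t)
      ≤ E₀ + K * (2 ^ (2 * K + 2) * (E₀ + K * Y t) + Y t) :=
        add_le_add le_rfl (mul_le_mul' le_rfl (add_le_add hgron le_rfl))
    _ = (1 + K * 2 ^ (2 * K + 2)) * (E₀ + K * Y t) := by ring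
    _ ≤ (1 + K * 2 ^ (2 * K + 2)) * ((1 + K) * E₀ + (1 + K) * Y t) :=
        mul_le_mul' le_rfl (add_le_add (le_mul_of_one_le_left zero_le le_self_add)
          (mul_le_mul' le_add_self le_rfl))
    _ = _ := by
        simp only [hY]
        push_cast
        ring
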